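/- Let $k$ be a field. A coquasitriangular Hopf algebra $(H,\mathcal R)$ is a Hopf algebra $H$ over $k$ with a convolution-invertible linear map $\mathcal R\colon H\otimes H\to k$ such that $\mathcal R(ab,c)=\mathcal R(a,c_1)\mathcal R(b,c_2)$, $\mathcal R(a,bc)=\mathcal R(a_1,c)\mathcal R(a_2,b)$ and $b_1a_1\mathcal R(a_2,b_2)=\mathcal R(a_1,b_1)a_2b_2$ for all $a,b,c\in H$; it is cotriangular if moreover $\mathcal R(a_1,b_1)\mathcal R(b_2,a_2)=\varepsilon(a)\varepsilon(b)$. Let $(H,\mathcal R)$ be a coquasitriangular Hopf algebra that is pointed (all simple subcoalgebras are one-dimensional), with coradical filtration $H_0\subseteq H_1\subseteq\cdots$. Let $\operatorname{gr}(H)=H_0\oplus H_1/H_0\oplus H_2/H_1\oplus\cdots$ with the graded Hopf algebra structure inherited from $H$, and let $\operatorname{gr}(\mathcal R)$ be the form on $\operatorname{gr}(H)$ equal to $\mathcal R$ on $H_0\otimes H_0$ and zero on pairs of homogeneous elements not both of degree $0$; then $(\operatorname{gr}(H),\operatorname{gr}(\mathcal R))$ is a coquasitriangular Hopf algebra. The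 path coalgebra $kQ$ of a quiver $Q$ has the paths as basis and $\Delta(a_l\cdots a_1)=\sum_{i=0}^{l} a_l\cdots a_{i+1}\otimes a_i\cdots a_1$, where the terms for $i=0,l$ are $a_l\cdots a_1\otimes s(a_1)$ and $t(a_l)\otimes a_l\cdots a_1$; trivial paths (vertices) are group-like with counit $1$, and all other paths have counit $0$. There are a quiver $Q$ (the quiver of $H$) and an injective homomorphism of graded coalgebras $j\colon\operatorname{gr}(H)\to kQ$ whose image contains $kQ_0\oplus kQ_1$. For every such $Q$ and $j$, the unit is mapped to a vertex $\epsilon$ of $Q$. Let $Q(\epsilon)$ be the connected component of $\epsilon$ and $kQ(\epsilon)\subseteq kQ$ the span of the paths in it; the principal block is $\operatorname{gr}(H)(\epsilon)=j^{-1}(kQ(\epsilon))$, and $\operatorname{gr}(\mathcal R)(\epsilon)$ is the restriction of $\operatorname{gr}(\mathcal R)$ to it. Then the following hold. 1. $\operatorname{gr}(H)(\epsilon)$ is a Hopf subalgebra of $\operatorname{gr}(H)$, and $(\operatorname{gr}(H)(\epsilon),\operatorname{gr}(\mathcal R)(\epsilon))$ is cotriangular. 2. $(\operatorname{gr}(H),\operatorname{gr}(\mathcal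 R))$ is a crossed product of $(D,\mathcal R_D)=(\operatorname{gr}(H)(\epsilon),\operatorname{gr}(\mathcal R)(\epsilon))$ by a group algebra: there are a group $\Gamma$, algebra endomorphisms $a\mapsto x\cdot a$ of $D$ for $x\in\Gamma$, with $1\cdot a=a$, and units $\sigma(x,y)\in D^\times$ with $\sigma(1,x)=\sigma(x,1)=1$, $\;x\cdot(y\cdot a)=\sigma(x,y)\,(xy\cdot a)\,\sigma(x,y)^{-1}$ and $(x\cdot\sigma(y,z))\,\sigma(x,yz)=\sigma(x,y)\,\sigma(xy,z)$, and there is an isomorphism of coalgebras $\Phi\colon D\otimes k\Gamma\to\operatorname{gr}(H)$ such that $\Phi(a\otimes1)=a$ and $\Phi(a\otimes x)\Phi(b\otimes y)=\Phi\big(a\,(x\cdot b)\,\sigma(x,y)\otimes xy\big)$; moreover, with $\bar x=\Phi(1\otimes x)$, the form is given by $$\operatorname{gr}(\mathcal R)(\Phi(a\otimes x),\Phi(b\otimes y))=\operatorname{gr}(\mathcal R)(a_1,\bar y)\,\mathcal R_D(a_2,b_1)\,\operatorname{gr}(\mathcal R)(\bar x,\bar y)\,\operatorname{gr}(\mathcal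 R)(\bar x,b_2).$$ 3. In particular, if $Q$ is connected, then $(\operatorname{gr}(H),\operatorname{gr}(\mathcal R))$ is cotriangular. -/

import Mathlib

open scoped TensorProduct DirectSum

universe u v

noncomputable section

/-! ### Subcoalgebras, pointed coalgebras, the coradical filtration -/

section Coradical

variable (k : Type v) [Field k] (H : Type u) [AddCommGroup H] [Module k H] [Coalgebra k H]

variable {k H} in
/-- `D` is a subcoalgebra: `Δ(D) ⊆ D ⊗ D` (inside `H ⊗ H`). -/
def IsSubcoalgebra (D : Submodule k H) : Prop :=
  ∀ x ∈ D, Coalgebra.comul (R := k) x ∈ LinearMap.range (TensorProduct.mapIncl D D)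

variable {k H} in
/-- A simple subcoalgebra: nonzero, and without proper nonzero subcoalgebras. -/
def IsSimpleSubcoalgebra (D : Submodule k H) : Prop :=
  IsSubcoalgebra D ∧ D ≠ ⊥ ∧ ∀ E : Submodule k H, IsSubcoalgebra E → E ≤ D → E = ⊥ ∨ E = D

/-- A coalgebra is pointed if all its simple subcoalgebras (equivalently, all its simple
comodules) are one-dimensional. -/
def IsPointedCoalgebra : Prop :=
  ∀ D : Submodule k H, IsSimpleSubcoalgebra D → Module.finrank k D = 1

/-- The coradical `H₀`: the sum of all simple subcoalgebras. -/
def coradical : Submodule k H :=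
  sSup {D | IsSimpleSubcoalgebra D}

/-- The coradical filtration: `H₀` is the coradical, and
`H_{n+1} = Δ⁻¹(H₀ ⊗ H + H ⊗ H_n)`. -/
def coradFilt : ℕ → Submodule k H
  | 0 => coradical k H
  | n + 1 =>
      Submodule.comap (Coalgebra.comul (R := k) (A := H))
        (LinearMap.range (TensorProduct.mapIncl (coradical k H) (⊤ : Submodule k H)) ⊔
          LinearMap.range (TensorProduct.mapIncl (⊤ : Submodule k H) (coradFilt n)))

/-- The preceding step of the coradical filtration, with `H_{-1} = 0`. -/
def coradFiltPrev : ℕ → Submodule k H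
  | 0 => ⊥
  | n + 1 => coradFilt k H n

/-- The degree `n` part `H_n / H_{n-1}` of `gr(H)`. -/
abbrev GrPiece (n : ℕ) : Type u :=
  coradFilt k H n ⧸ (coradFiltPrev k H n).submoduleOf (coradFilt k H n)

/-- The vector space `gr(H) = H₀ ⊕ H₁/H₀ ⊕ H₂/H₁ ⊕ ⋯`. -/
abbrev Gr : Type u := ⨁ n : ℕ, GrPiece k H n

/-- The class in degree `n` of `gr(H)` of an element of `H_n`. -/
def grClass (n : ℕ) : coradFilt k H n →ₗ[k] Gr k H :=
  DirectSum.lof k ℕ (GrPiece k H) n ∘ₗ Submodule.mkQ _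

/-- The projection of `gr(H)` onto its degree `0` part `H₀`, followed by `H₀ ⊆ H`. -/
def grProjZero : Gr k H →ₗ[k] H :=
  Submodule.liftQ _ (coradFilt k H 0).subtype
      (by intro x hx; simpa [Submodule.submoduleOf, coradFiltPrev] using hx) ∘ₗ
    DirectSum.component k ℕ (GrPiece k H) 0

end Coradical

/-! ### The Hopf algebra structure on `gr(H)` -/

/-- The linear isomorphism `φ` identifies the Hopf algebra `A` with `gr(H)` carrying the structure
inherited from `H`: the unit is the class of `1`, the product of the classes of `a ∈ H_m` and
`b ∈ H_n` is the class of `ab ∈ H_{m+n}`, and for `a ∈ H_n` one has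
`Δ(a) = ∑_{i+j=n} t_{ij}` with `t_{ij} ∈ H_i ⊗ H_j`, the coproduct of the class of `a` being
the sum of the classes of the `t_{ij}` in `gr(H)_i ⊗ gr(H)_j`. This determines the Hopf algebra
structure of `A` uniquely, as the antipode of a bialgebra is unique. -/
structure IsGrHopf {k : Type v} [Field k] {H : Type u} [Ring H] [HopfAlgebra k H]
    {A : Type u} [Ring A] [HopfAlgebra k A] (φ : Gr k H ≃ₗ[k] A) : Prop where
  one : ∃ e : coradFilt k H 0, (e : H) = 1 ∧ φ (grClass k H 0 e) = 1
  mul : ∀ (m n : ℕ) (a : coradFilt k H m) (b : coradFilt k H n),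
    ∃ c : coradFilt k H (m + n), (c : H) = a * b ∧
      φ (grClass k H m a) * φ (grClass k H n b) = φ (grClass k H (m + n) c)
  counit_zero : ∀ a : coradFilt k H 0,
    Coalgebra.counit (R := k) (φ (grClass k H 0 a)) = Coalgebra.counit (R := k) (a : H)
  counit_succ : ∀ (n : ℕ) (a : coradFilt k H (n + 1)),
    Coalgebra.counit (R := k) (φ (grClass k H (n + 1) a)) = 0
  comul : ∀ (n : ℕ) (a : coradFilt k H n),
    ∃ t : (p : ℕ × ℕ) → coradFilt k H p.1 ⊗[k] coradFilt k H p.2,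
      Coalgebra.comul (R := k) (a : H) =
        ∑ p ∈ Finset.HasAntidiagonal.antidiagonal n, TensorProduct.mapIncl _ _ (t p) ∧
      Coalgebra.comul (R := k) (φ (grClass k H n a)) =
        ∑ p ∈ Finset.HasAntidiagonal.antidiagonal n,
          TensorProduct.map (φ.toLinearMap ∘ₗ grClass k H p.1)
            (φ.toLinearMap ∘ₗ grClass k H p.2) (t p)

/-! ### Coquasitriangular and cotriangular structures -/

section Forms

variable {k : Type v} [Field k] {H : Type u} [Ring H] [HopfAlgebra k H]

/-- `ℛ` is a coquasitriangular structure (universal `R`-form) on the Hopf algebra `H`. -/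
structure IsCoquasitriangular (r : H ⊗[k] H →ₗ[k] k) : Prop where
  /-- invertibility for the convolution product on `(H ⊗ H)^*` -/
  conv_invertible : IsUnit (WithConv.toConv r)
  /-- `ℛ(ab, c) = ℛ(a, c₁) ℛ(b, c₂)` -/
  mul_left : ∀ a b c : H, r ((a * b) ⊗ₜ c) =
    LinearMap.mul' k k (TensorProduct.map (TensorProduct.curry r a) (TensorProduct.curry r b)
      (Coalgebra.comul (R := k) c))
  /-- `ℛ(a, bc) = ℛ(a₁, c) ℛ(a₂, b)` -/
  mul_right : ∀ a b c : H, r (a ⊗ₜ (b * c)) =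
    LinearMap.mul' k k (TensorProduct.map ((TensorProduct.curry r).flip c)
      ((TensorProduct.curry r).flip b) (Coalgebra.comul (R := k) a))
  /-- `b₁a₁ ℛ(a₂, b₂) = ℛ(a₁, b₁) a₂b₂`; note `Δ(a ⊗ b) = (a₁ ⊗ b₁) ⊗ (a₂ ⊗ b₂)` -/
  braided_comm : ∀ a b : H,
    TensorProduct.rid k H (TensorProduct.map
      (LinearMap.mul' k H ∘ₗ (TensorProduct.comm k H H).toLinearMap) r
        (Coalgebra.comul (R := k) (a ⊗ₜ[k] b))) =
    TensorProduct.lid k H (TensorProduct.map r (LinearMap.mul' k H)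
        (Coalgebra.comul (R := k) (a ⊗ₜ[k] b)))

/-- `(H, ℛ)` is cotriangular: coquasitriangular with
`ℛ(a₁, b₁) ℛ(b₂, a₂) = ε(a) ε(b)`. -/
structure IsCotriangular (r : H ⊗[k] H →ₗ[k] k) : Prop extends IsCoquasitriangular r where
  skew : ∀ a b : H,
    LinearMap.mul' k k (TensorProduct.map r (r ∘ₗ (TensorProduct.comm k H H).toLinearMap)
      (Coalgebra.comul (R := k) (a ⊗ₜ[k] b))) =
    Coalgebra.counit (R := k) a * Coalgebra.counit (R := k) b

/-- `gr(ℛ)` on a model `A` of `gr(H)`: it is `ℛ` on `H₀ ⊗ H₀`, and zero on homogeneous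
elements that are not both of degree `0`. -/
def grForm {A : Type u} [Ring A] [HopfAlgebra k A] (φ : Gr k H ≃ₗ[k] A)
    (r : H ⊗[k] H →ₗ[k] k) : A ⊗[k] A →ₗ[k] k :=
  r ∘ₗ TensorProduct.map (grProjZero k H ∘ₗ φ.symm.toLinearMap)
    (grProjZero k H ∘ₗ φ.symm.toLinearMap)

end Forms

/-! ### Path coalgebras -/

section PathCoalgebra

/-- All paths of a quiver; the path `a_l ⋯ a_1` is `⟨s(a_1), t(a_l), a_l ⋯ a_1⟩`. -/
abbrev QPath (V : Type u) [Quiver.{u} V] : Type u := Σ x y : V, Quiver.Path x y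

/-- The path coalgebra `kQ`: the vector space with basis the paths of `Q`. -/
def PathCoalgebra (k : Type v) [Field k] (V : Type u) [Quiver.{u} V] : Type (max u v) :=
  QPath V →₀ k

variable (k : Type v) [Field k] (V : Type u) [Quiver.{u} V]

instance : AddCommGroup (PathCoalgebra k V) := inferInstanceAs (AddCommGroup (QPath V →₀ k))
instance : Module k (PathCoalgebra k V) := inferInstanceAs (Module k (QPath V →₀ k))

variable {V}

/-- A path, as an element of `kQ`. -/
def pathElt {x y : V} (p : Quiver.Path x y) : PathCoalgebra k V :=
  Finsupp.single (⟨x, y, p⟩ : QPath V) (1 : k)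

variable {k} in
/-- The linear map on `kQ` with prescribed values on paths. -/
def pathLift {M : Type*} [AddCommGroup M] [Module k M]
    (f : (x y : V) → Quiver.Path x y → M) : PathCoalgebra k V →ₗ[k] M :=
  Finsupp.linearCombination k (fun p : QPath V => f p.1 p.2.1 p.2.2)

/-- All ways to write a path as a path `x → z` followed by a path `z → y`. -/
def pathSplits {x : V} : {y : V} → Quiver.Path x y →
    List (Σ z : V, Quiver.Path x z × Quiver.Path z y)
  | _, .nil => [⟨x, .nil, .nil⟩]
  | y, .cons p e =>
      ⟨y, p.cons e, .nil⟩ :: (pathSplits p).map fun s => ⟨s.1, s.2.1, s.2.2.cons e⟩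

/-- `Δ(a_l ⋯ a_1) = ∑_i a_l ⋯ a_{i+1} ⊗ a_i ⋯ a_1`, where the extreme terms are
`t(a_l) ⊗ a_l ⋯ a_1` and `a_l ⋯ a_1 ⊗ s(a_1)`. -/
def pathComul {x y : V} (p : Quiver.Path x y) : PathCoalgebra k V ⊗[k] PathCoalgebra k V :=
  ((pathSplits p).map fun s => pathElt k s.2.2 ⊗ₜ[k] pathElt k s.2.1).sum

@[simp] lemma pathLift_pathElt {M : Type*} [AddCommGroup M] [Module k M]
    (f : (x y : V) → Quiver.Path x y → M) {x y : V} (p : Quiver.Path x y) :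
    pathLift f (pathElt k p) = f x y p := by
  refine (Finsupp.linearCombination_single k (1 : k) (⟨x, y, p⟩ : QPath V)).trans ?_
  simp

variable {k} in
lemma pathHom_ext {M : Type*} [AddCommGroup M] [Module k M]
    {f g : PathCoalgebra k V →ₗ[k] M}
    (h : ∀ (x y : V) (p : Quiver.Path x y), f (pathElt k p) = g (pathElt k p)) : f = g :=
  Finsupp.lhom_ext' fun p => LinearMap.ext_ring (h p.1 p.2.1 p.2.2)

lemma pathSplits_assoc {M : Type*} [AddCommMonoid M] {x y : V} (p : Quiver.Path x y)
    (F : (z w : V) → Quiver.Path x z → Quiver.Path z w → Quiver.Path w y → M) :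
    ((pathSplits p).map fun s =>
      ((pathSplits s.2.2).map fun t => F s.1 t.1 s.2.1 t.2.1 t.2.2).sum).sum =
    ((pathSplits p).map fun s =>
      ((pathSplits s.2.1).map fun t => F t.1 s.1 t.2.1 t.2.2 s.2.2).sum).sum := by
  induction p with
  | nil => simp [pathSplits]
  | cons p e ih =>
    have := ih (fun z w a b c => F z w a b (c.cons e))
    simp only [pathSplits, List.map_cons, List.map_map, List.sum_cons, List.map_nil, List.sum_nil,
      Function.comp_def, List.sum_map_add]
    rw [this]
    abel

instance : CoalgebraStruct k (PathCoalgebra k V) where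
  comul := pathLift fun _ _ p => pathComul k p
  counit := pathLift fun _ _ p => if p.length = 0 then 1 else 0

lemma comul_pathElt {x y : V} (p : Quiver.Path x y) :
    CoalgebraStruct.comul (R := k) (pathElt k p) = pathComul k p := by
  simp [CoalgebraStruct.comul]

lemma counit_pathElt {x y : V} (p : Quiver.Path x y) :
    CoalgebraStruct.counit (R := k) (pathElt k p) = if p.length = 0 then 1 else 0 := by
  simp [CoalgebraStruct.counit]

lemma pathSplits_counit_left {x y : V} (p : Quiver.Path x y) :
    ((pathSplits p).map fun s =>
      (if s.2.2.length = 0 then (1 : k) else 0) ⊗ₜ[k] pathElt k s.2.1).sum =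
      1 ⊗ₜ[k] pathElt k p := by
  cases p with
  | nil => simp [pathSplits]
  | cons p e => simp [pathSplits, Function.comp_def]

lemma pathSplits_counit_right {x y : V} (p : Quiver.Path x y)
    {M : Type*} [AddCommGroup M] [Module k M]
    (f : (z : V) → Quiver.Path z y → M) :
    ((pathSplits p).map fun s => f s.1 s.2.2 ⊗ₜ[k]
      (if s.2.1.length = 0 then (1 : k) else 0)).sum = f x p ⊗ₜ[k] 1 := by
  induction p with
  | nil => simp [pathSplits]
  | cons p e ih =>
    simpa [pathSplits, Function.comp_def] using ih (fun z q => f z (q.cons e))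

lemma sum_tmul_list {M N ι : Type*} [AddCommGroup M] [Module k M] [AddCommGroup N] [Module k N]
    (l : List ι) (f : ι → M) (n : N) :
    (l.map f).sum ⊗ₜ[k] n = (l.map fun i => f i ⊗ₜ[k] n).sum := by
  induction l with
  | nil => simp
  | cons a l ih => simp [TensorProduct.add_tmul, ih]

lemma tmul_sum_list {M N ι : Type*} [AddCommGroup M] [Module k M] [AddCommGroup N] [Module k N]
    (l : List ι) (f : ι → N) (m : M) :
    m ⊗ₜ[k] (l.map f).sum = (l.map fun i => m ⊗ₜ[k] f i).sum := by
  induction l with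
  | nil => simp
  | cons a l ih => simp [TensorProduct.tmul_add, ih]

instance : Coalgebra k (PathCoalgebra k V) where
  coassoc := by
    refine pathHom_ext fun x y p => ?_
    simp only [LinearMap.comp_apply, comul_pathElt, pathComul, map_list_sum, List.map_map,
      Function.comp_def, LinearMap.rTensor_tmul, LinearMap.lTensor_tmul, LinearEquiv.coe_coe]
    have := pathSplits_assoc p (fun z w a b c =>
      pathElt k c ⊗ₜ[k] (pathElt k b ⊗ₜ[k] pathElt k a))
    simpa only [sum_tmul_list, tmul_sum_list, map_list_sum, List.map_map, Function.comp_def,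
      TensorProduct.assoc_tmul] using this
  rTensor_counit_comp_comul := by
    refine pathHom_ext fun x y p => ?_
    simp only [LinearMap.comp_apply, comul_pathElt, pathComul, map_list_sum, List.map_map,
      Function.comp_def, LinearMap.rTensor_tmul, counit_pathElt, pathSplits_counit_left,
      TensorProduct.mk_apply]
  lTensor_counit_comp_comul := by
    refine pathHom_ext fun x y p => ?_
    simp only [LinearMap.comp_apply, comul_pathElt, pathComul, map_list_sum, List.map_map,
      Function.comp_def, LinearMap.lTensor_tmul, counit_pathElt,
      LinearMap.flip_apply, TensorProduct.mk_apply]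
    exact pathSplits_counit_right k p (fun z q => pathElt k q)

variable (V) in
/-- The homogeneous part `kQ_n`, spanned by the paths of length `n`. -/
def pathDegree (n : ℕ) : Submodule k (PathCoalgebra k V) :=
  Submodule.span k {a | ∃ (x y : V) (p : Quiver.Path x y), p.length = n ∧ a = pathElt k p}

/-- The subspace `kQ(e)` spanned by the paths lying in the connected component of the vertex
`e` (a path lies in the component that contains its source). -/
def componentSpan (e : V) : Submodule k (PathCoalgebra k V) :=
  Submodule.span k {a | ∃ (x y : V) (p : Quiver.Path x y),
    Quiver.WeaklyConnectedComponent.mk x = Quiver.WeaklyConnectedComponent.mk e ∧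
      a = pathElt k p}

variable (V) in
/-- The quiver is connected: all vertices lie in one connected component. -/
def IsConnectedQuiver : Prop :=
  Nonempty V ∧ ∀ x y : V,
    Quiver.WeaklyConnectedComponent.mk x = Quiver.WeaklyConnectedComponent.mk y

end PathCoalgebra

section Embedding

variable {k : Type v} [Field k] {H : Type u} [Ring H] [HopfAlgebra k H]
  {A : Type u} [Ring A] [HopfAlgebra k A] {V : Type u} [Quiver.{u} V]

/-- `j` realizes `gr(H)` (in the model `A`) as a large graded subcoalgebra of the path coalgebra
`kQ`: it is injective, respects degrees, and its image contains `kQ₀ ⊕ kQ₁`. The quiver `Q` is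
then the quiver of `H`. -/
structure IsLargeEmbedding (φ : Gr k H ≃ₗ[k] A) (j : A →ₗc[k] PathCoalgebra k V) : Prop where
  injective : Function.Injective j
  graded : ∀ (n : ℕ) (a : coradFilt k H n), j (φ (grClass k H n a)) ∈ pathDegree k V n
  large : ∀ n ≤ 1, ∀ a ∈ pathDegree k V n, ∃ b : A, j b = a

/-- The part of `A` that lies in the connected component `kQ(e)`. For `e` the vertex
corresponding to the unit this is the principal block. -/
def blockAt (j : A →ₗc[k] PathCoalgebra k V) (e : V) : Submodule k A :=
  (componentSpan k e).comap (j : A →ₗ[k] PathCoalgebra k V)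

end Embedding

/-! ### Crossed products with group algebras -/

/-- The data for a crossed product `D #_σ kΓ` of an algebra `D` by a group algebra: `Γ` acts
weakly on `D` by algebra endomorphisms (the elements of `Γ` being group-like, this says that `kΓ`
measures `D`), the action being twisted by a normalized 2-cocycle `σ` with invertible values. -/
structure CrossedSystem (k : Type v) [Field k] (D : Type u) [Ring D] [Algebra k D]
    (Γ : Type u) [Group Γ] where
  act : Γ → D →ₐ[k] D
  cocycle : Γ → Γ → Dˣ
  act_one : ∀ a : D, act 1 a = a
  twisted : ∀ (x y : Γ) (a : D),
    act x (act y a) = cocycle x y * act (x * y) a * ((cocycle x y)⁻¹ : Dˣ)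
  cocycle_one_left : ∀ x : Γ, cocycle 1 x = 1
  cocycle_one_right : ∀ x : Γ, cocycle x 1 = 1
  cocycle_assoc : ∀ x y z : Γ,
    act x (cocycle y z) * cocycle x (y * z) = (cocycle x y * cocycle (x * y) z : D)

/-- `Φ` identifies `(A, rA)` with the crossed product of `(D, rD)` by the group algebra `kΓ`.
As a coalgebra the crossed product is the tensor product `D ⊗ kΓ`; `D` sits in it as `D ⊗ 1`; its
multiplication is `(a # x)(b # y) = a (x · b) σ(x, y) # xy`; and its form is the extension of `rD`
by the two multiplicativity rules of a coquasitriangular structure: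
`r(a # x, b # y) = r(a₁, y) rD(a₂, b₁) r(x, y) r(x, b₂)`. -/
structure IsCrossedProduct {k : Type v} [Field k]
    {A : Type u} [Ring A] [HopfAlgebra k A] (rA : A ⊗[k] A →ₗ[k] k)
    {D : Type u} [Ring D] [HopfAlgebra k D] (rD : D ⊗[k] D →ₗ[k] k) (i : D →ₐc[k] A)
    {Γ : Type u} [Group Γ] (S : CrossedSystem k D Γ)
    (Φ : (D ⊗[k] MonoidAlgebra k Γ) ≃ₗc[k] A) : Prop where
  incl : ∀ a : D, Φ (a ⊗ₜ MonoidAlgebra.single 1 1) = i a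
  mul : ∀ (a b : D) (x y : Γ),
    Φ (a ⊗ₜ MonoidAlgebra.single x 1) * Φ (b ⊗ₜ MonoidAlgebra.single y 1) =
      Φ ((a * S.act x b * S.cocycle x y) ⊗ₜ MonoidAlgebra.single (x * y) 1)
  restrict : ∀ a b : D, rA (i a ⊗ₜ i b) = rD (a ⊗ₜ b)
  form : ∀ (a b : D) (x y : Γ),
    rA (Φ (a ⊗ₜ MonoidAlgebra.single x 1) ⊗ₜ Φ (b ⊗ₜ MonoidAlgebra.single y 1)) =
      rA (Φ (1 ⊗ₜ MonoidAlgebra.single x 1) ⊗ₜ Φ (1 ⊗ₜ MonoidAlgebra.single y 1)) *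
      rD (TensorProduct.lid k D (TensorProduct.map
            ((TensorProduct.curry rA).flip (Φ (1 ⊗ₜ MonoidAlgebra.single y 1)) ∘ₗ
              (i : D →ₗ[k] A)) LinearMap.id (Coalgebra.comul (R := k) a)) ⊗ₜ
          TensorProduct.rid k D (TensorProduct.map LinearMap.id
            (TensorProduct.curry rA (Φ (1 ⊗ₜ MonoidAlgebra.single x 1)) ∘ₗ
              (i : D →ₗ[k] A)) (Coalgebra.comul (R := k) b)))

end

/-! Write G for the group of group-like elements of H, so that H₀ = k[G]. The form gr(ℛ) is the
pullback of ℛ along the projection π : gr(H) → H₀ ⊆ H, a homomorphism of Hopf algebras, so it only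
sees the images in k[G]. Braided commutativity makes G commutative, since ℛ has nonzero values on
group-likes.

The decisive point is what an arrow g → g' of the quiver does. It comes from a nonzero x in gr(H)
with Δ(x) = g' ⊗ x + x ⊗ g and π(x) = 0, so gr(ℛ) vanishes when paired with x. For group-like y,
braided commutativity of (x, y) and of (y, x) gives ℛ(g,y) yx = ℛ(g',y) xy and ℛ(y,g) xy = ℛ(y,g')
yx. As yx ≠ 0, this forces ℛ(g,y)ℛ(y,g) = ℛ(g',y)ℛ(y,g'). So g ↦ ℛ(g,y)ℛ(y,g) is constant on
connected components, with value 1 on the component of the unit (`form_mul_form`). This is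
cotriangularity of the block, and of gr(H) if the quiver is connected (`skew`).

For the crossed product, translation by group-likes preserves the relation of lying in one component
(`component_mul_left`), so the component of the unit is a subgroup N. Let ϖ be the composite gr(H) →
k[G] → k[G/N]. A path has source and target in the same component, hence the left and right
coactions of k[G/N] agree and the coinvariants form a Hopf subalgebra (`isHopfSubalgebra_coinv`);
they are the principal block. A set-theoretic section of G → G/N lifts to group-like units, so the
coaction is cleft and gr(H) is a crossed product (`mulMap_bijective`, `exists_isCrossedProduct`).

The objects themselves must be constructed. The Hopf structure of gr(H) and the braided
commutativity of gr(ℛ) come from a calculus of symbols of filtered maps: symbols are unique and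
compatible with composition and tensor products, so identities pass from H to gr(H)
(`IsSymbol.unique`, `IsHopf.symbol`). This needs the coradical filtration to respect the coproduct
(`comul_mem_tensFilt`) and, by pointedness, product and antipode. For the quiver, arrows are bases
of the degree 1 components between two vertices. Products of the dual functionals define a coalgebra
map to kQ (`exists_pathMap`), which is injective because gr(H) is coradically graded
(`degProj_eq_zero`, `exists_gradedPathEmbedding`). -/

noncomputable section

/-! ### Tensor products of subspaces over a field -/

section TensorSubmodule

variable {k : Type*} [Field k] {V W V' W' : Type*} [AddCommGroup V] [Module k V] [AddCommGroup W]
  [Module k W] [AddCommGroup V'] [Module k V'] [AddCommGroup W'] [Module k W']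

/-- The subspace `X ⊗ Y` of `V ⊗ W`. -/
abbrev tens (X : Submodule k V) (Y : Submodule k W) : Submodule k (V ⊗[k] W) :=
  LinearMap.range (TensorProduct.mapIncl X Y)

lemma tmul_mem_tens {X : Submodule k V} {Y : Submodule k W} {x : V} {y : W} (hx : x ∈ X)
    (hy : y ∈ Y) : x ⊗ₜ[k] y ∈ tens X Y :=
  ⟨⟨x, hx⟩ ⊗ₜ ⟨y, hy⟩, rfl⟩

lemma tens_le {X : Submodule k V} {Y : Submodule k W} {Z : Submodule k (V ⊗[k] W)} :
    tens X Y ≤ Z ↔ ∀ x ∈ X, ∀ y ∈ Y, x ⊗ₜ[k] y ∈ Z := by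
  refine ⟨fun h x hx y hy => h (tmul_mem_tens hx hy), fun h => ?_⟩
  rintro _ ⟨t, rfl⟩
  induction t with
  | zero => simp
  | add a b ha hb => rw [map_add]; exact add_mem ha hb
  | tmul a b => exact h _ a.2 _ b.2

lemma tens_mono {X X' : Submodule k V} {Y Y' : Submodule k W} (hX : X ≤ X') (hY : Y ≤ Y') :
    tens X Y ≤ tens X' Y' :=
  tens_le.2 fun _ hx _ hy => tmul_mem_tens (hX hx) (hY hy)

lemma tens_top_top : tens (⊤ : Submodule k V) (⊤ : Submodule k W) = ⊤ := by
  rw [eq_top_iff]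
  rintro t -
  induction t with
  | zero => simp
  | add a b ha hb => exact add_mem ha hb
  | tmul a b => exact tmul_mem_tens trivial trivial

lemma tens_bot_left (Y : Submodule k W) : tens (⊥ : Submodule k V) Y = ⊥ := by
  rw [eq_bot_iff, tens_le]
  rintro x hx y -
  simp [(Submodule.mem_bot k).1 hx]

lemma tens_bot_right (X : Submodule k V) : tens X (⊥ : Submodule k W) = ⊥ := by
  rw [eq_bot_iff, tens_le]
  rintro x - y hy
  simp [(Submodule.mem_bot k).1 hy]

lemma map_injective_of_injective {f : V →ₗ[k] V'} {g : W →ₗ[k] W'} (hf : Function.Injective f)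
    (hg : Function.Injective g) : Function.Injective (TensorProduct.map f g) :=
  TensorProduct.map_injective_of_flat_flat _ _ hf hg

/-- Right exactness of ⊗ gives the kernel for the surjections onto the ranges; over a field the
inclusions of the ranges stay injective after tensoring. Membership in a sum X ⊗ W + V ⊗ Y can thus
be tested by a linear map. -/
lemma ker_tensorMap (f : V →ₗ[k] V') (g : W →ₗ[k] W') :
    LinearMap.ker (TensorProduct.map f g) =
      tens (LinearMap.ker f) ⊤ ⊔ tens ⊤ (LinearMap.ker g) := by
  have h1 : TensorProduct.map f g = TensorProduct.map (LinearMap.range f).subtype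
      (LinearMap.range g).subtype ∘ₗ TensorProduct.map f.rangeRestrict g.rangeRestrict := by
    rw [← TensorProduct.map_comp]; rfl
  have h2 := TensorProduct.map_ker (f := (LinearMap.ker f).subtype) (g := f.rangeRestrict)
    (f' := (LinearMap.ker g).subtype) (g' := g.rangeRestrict)
    (by rw [LinearMap.exact_iff]; simp) f.surjective_rangeRestrict
    (by rw [LinearMap.exact_iff]; simp) g.surjective_rangeRestrict
  rw [h1, LinearMap.ker_comp_of_ker_eq_bot _ (LinearMap.ker_eq_bot.2
    (map_injective_of_injective (Submodule.subtype_injective _) (Submodule.subtype_injective _))),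
    h2, sup_comm]
  congr 1
  · apply le_antisymm
    · rintro _ ⟨t, rfl⟩
      induction t with
      | zero => simp
      | add a b ha hb => rw [map_add]; exact add_mem ha hb
      | tmul a b => exact tmul_mem_tens a.2 trivial
    · exact tens_le.2 fun x hx y _ => ⟨⟨x, hx⟩ ⊗ₜ y, rfl⟩
  · apply le_antisymm
    · rintro _ ⟨t, rfl⟩
      induction t with
      | zero => simp
      | add a b ha hb => rw [map_add]; exact add_mem ha hb
      | tmul a b => exact tmul_mem_tens trivial b.2
    · exact tens_le.2 fun x _ y hy => ⟨x ⊗ₜ ⟨y, hy⟩, rfl⟩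

/-- The kernel of the restricted map V ⊗ B → V/A ⊗ W/B' is A ⊗ B + V ⊗ (B ∩ B'). -/
lemma tens_sup_inf {A : Submodule k V} {B B' : Submodule k W} {t : V ⊗[k] W}
    (ht : t ∈ tens A ⊤ ⊔ tens ⊤ B') (ht' : t ∈ tens ⊤ B) : t ∈ tens A B ⊔ tens ⊤ B' := by
  obtain ⟨s, rfl⟩ := ht'
  have hs : TensorProduct.map (A.mkQ ∘ₗ Submodule.subtype ⊤) (B'.mkQ ∘ₗ B.subtype) s = 0 := by
    rw [TensorProduct.map_comp]
    have : TensorProduct.mapIncl ⊤ B s ∈ LinearMap.ker (TensorProduct.map A.mkQ B'.mkQ) := by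
      rw [ker_tensorMap]; simpa using ht
    exact this
  rw [← LinearMap.mem_ker, ker_tensorMap] at hs
  have : tens (LinearMap.ker (A.mkQ ∘ₗ Submodule.subtype ⊤)) ⊤ ⊔
      tens ⊤ (LinearMap.ker (B'.mkQ ∘ₗ B.subtype)) ≤
      (tens A B ⊔ tens ⊤ B').comap (TensorProduct.mapIncl ⊤ B) := by
    refine sup_le (tens_le.2 fun x hx y _ => ?_) (tens_le.2 fun x _ y hy => ?_)
    · refine Submodule.mem_sup_left (tmul_mem_tens ?_ y.2)
      simpa using hx
    · refine Submodule.mem_sup_right (tmul_mem_tens trivial ?_)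
      simpa using hy
  exact this hs

lemma tens_inf {A : Submodule k V} {B : Submodule k W} {t : V ⊗[k] W}
    (ht : t ∈ tens A ⊤) (ht' : t ∈ tens ⊤ B) : t ∈ tens A B := by
  have := tens_sup_inf (B' := ⊥) (Submodule.mem_sup_left ht) ht'
  rwa [tens_bot_right, sup_bot_eq] at this

end TensorSubmodule

/-! ### Wedge products of subspaces of a coalgebra -/

section Wedge

variable {k : Type*} [Field k] {H : Type*} [AddCommGroup H] [Module k H] [Coalgebra k H]

/-- The wedge product `X ∧ Y = Δ⁻¹(X ⊗ H + H ⊗ Y)` of subspaces of a coalgebra. -/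
def wedge (X Y : Submodule k H) : Submodule k H :=
  (tens X ⊤ ⊔ tens ⊤ Y).comap (Coalgebra.comul (R := k) (A := H))

lemma mem_wedge_iff {V W : Type*} [AddCommGroup V] [Module k V] [AddCommGroup W] [Module k W]
    (f : H →ₗ[k] V) (g : H →ₗ[k] W) (x : H) :
    x ∈ wedge (LinearMap.ker f) (LinearMap.ker g) ↔
      TensorProduct.map f g (Coalgebra.comul (R := k) x) = 0 := by
  rw [← LinearMap.mem_ker, ker_tensorMap]; rfl

lemma wedge_mono {X X' Y Y' : Submodule k H} (hX : X ≤ X') (hY : Y ≤ Y') :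
    wedge X Y ≤ wedge X' Y' :=
  Submodule.comap_mono (sup_le_sup (tens_mono hX le_rfl) (tens_mono le_rfl hY))

/-- By coassociativity both sides are the kernel of the iterated coproduct followed by H ⊗ H ⊗ H →
H/X ⊗ H/Y ⊗ H/Z. -/
lemma wedge_assoc (X Y Z : Submodule k H) : wedge (wedge X Y) Z = wedge X (wedge Y Z) := by
  have key : ∀ X Y : Submodule k H, wedge X Y =
      LinearMap.ker (TensorProduct.map X.mkQ Y.mkQ ∘ₗ Coalgebra.comul (R := k)) := by
    intro X Y
    ext x
    have := mem_wedge_iff X.mkQ Y.mkQ x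
    simpa using this
  have hZ : Z = LinearMap.ker Z.mkQ := by simp
  have hX : X = LinearMap.ker X.mkQ := by simp
  ext x
  rw [key X Y, key Y Z]
  conv_lhs => rw [hZ]
  conv_rhs => rw [hX]
  rw [mem_wedge_iff, mem_wedge_iff]
  have h1 := LinearMap.congr_fun (TensorProduct.map_map_comp_assoc_eq X.mkQ Y.mkQ Z.mkQ)
    (Coalgebra.comul.rTensor H (Coalgebra.comul (R := k) x))
  simp only [LinearMap.comp_apply, LinearEquiv.coe_coe, Coalgebra.coassoc_apply] at h1
  rw [← LinearMap.map_comp_rTensor, ← LinearMap.map_comp_lTensor, LinearMap.comp_apply,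
    LinearMap.comp_apply, h1]
  simp

end Wedge

/-! ### The coradical filtration of a coalgebra -/

section Filtration

variable {k : Type v} [Field k] {H : Type u} [AddCommGroup H] [Module k H] [Coalgebra k H]

lemma coradFilt_succ (n : ℕ) :
    coradFilt k H (n + 1) = wedge (coradFilt k H 0) (coradFilt k H n) := rfl

/-- H_n is the wedge power of the coradical with n + 1 factors, whence the shift by one;
associativity allows any bracketing. -/
lemma coradFilt_add (m n : ℕ) :
    coradFilt k H (m + n + 1) = wedge (coradFilt k H m) (coradFilt k H n) := by
  induction m with
  | zero => rw [zero_add, coradFilt_succ]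
  | succ m ih =>
    rw [coradFilt_succ m, wedge_assoc, ← ih, ← coradFilt_succ]
    congr 1; omega

lemma isSubcoalgebra_coradical : IsSubcoalgebra (coradical k H) := by
  intro x hx
  have : coradical k H ≤
      (tens (coradical k H) (coradical k H)).comap (Coalgebra.comul (R := k)) := by
    refine sSup_le fun D hD x hx => ?_
    exact tens_mono (le_sSup hD) (le_sSup hD) (hD.1 x hx)
  exact this hx

/-- A wedge with `⊥` on the left encodes Δ(H_n) ⊆ H ⊗ H_n. Associativity moves `⊥` next to the
coradical, where the subcoalgebra property suffices. -/
lemma coradFilt_le_wedge_bot (n : ℕ) : coradFilt k H n ≤ wedge ⊥ (coradFilt k H n) := by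
  induction n with
  | zero =>
    intro x hx
    exact Submodule.mem_sup_right (tens_mono le_top le_rfl (isSubcoalgebra_coradical x hx))
  | succ n ih =>
    rw [coradFilt_succ n]
    conv_rhs => rw [← wedge_assoc]
    refine wedge_mono ?_ le_rfl
    intro x hx
    exact Submodule.mem_sup_right (tens_mono le_top le_rfl (isSubcoalgebra_coradical x hx))

lemma coradFilt_le_bot_wedge (n : ℕ) : coradFilt k H n ≤ wedge (coradFilt k H n) ⊥ := by
  induction n with
  | zero =>
    intro x hx
    exact Submodule.mem_sup_left (tens_mono le_rfl le_top (isSubcoalgebra_coradical x hx))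
  | succ n ih =>
    rw [coradFilt_succ n, wedge_assoc]
    exact wedge_mono le_rfl ih

lemma comul_mem_top_tens {n : ℕ} {x : H} (hx : x ∈ coradFilt k H n) :
    Coalgebra.comul (R := k) x ∈ tens ⊤ (coradFilt k H n) := by
  have := coradFilt_le_wedge_bot n hx
  rwa [wedge, Submodule.mem_comap, tens_bot_left, bot_sup_eq] at this

lemma comul_mem_tens_top {n : ℕ} {x : H} (hx : x ∈ coradFilt k H n) :
    Coalgebra.comul (R := k) x ∈ tens (coradFilt k H n) ⊤ := by
  have := coradFilt_le_bot_wedge n hx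
  rwa [wedge, Submodule.mem_comap, tens_bot_right, sup_bot_eq] at this

lemma coradFilt_le_succ (n : ℕ) : coradFilt k H n ≤ coradFilt k H (n + 1) := fun _ hx =>
  Submodule.mem_sup_right (comul_mem_top_tens hx)

lemma coradFilt_mono : Monotone (coradFilt k H) := monotone_nat_of_le_succ coradFilt_le_succ

variable (k H) in
/-- The degree `n` part `∑_{i+j=n} H_i ⊗ H_j` of the tensor product filtration. -/
def tensFilt (n : ℕ) : Submodule k (H ⊗[k] H) :=
  ⨆ p ∈ Finset.HasAntidiagonal.antidiagonal n, tens (coradFilt k H p.1) (coradFilt k H p.2)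

lemma tens_le_tensFilt {i j n : ℕ} (h : i + j = n) :
    tens (coradFilt k H i) (coradFilt k H j) ≤ tensFilt k H n :=
  le_iSup₂_of_le (i, j) (by simpa using h) le_rfl

lemma tensFilt_le {n : ℕ} {Z : Submodule k (H ⊗[k] H)}
    (h : ∀ i j : ℕ, i + j = n → ∀ a ∈ coradFilt k H i, ∀ b ∈ coradFilt k H j, a ⊗ₜ[k] b ∈ Z) :
    tensFilt k H n ≤ Z :=
  iSup₂_le fun p hp => tens_le.2 (h p.1 p.2 (by simpa using hp))

/-- The coradical filtration is a coalgebra filtration. -/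
lemma comul_mem_tensFilt {n : ℕ} {x : H} (hx : x ∈ coradFilt k H n) :
    Coalgebra.comul (R := k) x ∈ tensFilt k H n := by
  -- Good terms are split off one degree at a time. The remainder in H ⊗ H_{n-i} also lies in H_i ⊗
  -- H + H ⊗ H_{n-i-1}, because H_n = H_i ∧ H_{n-i-1}; so it lies in H_i ⊗ H_{n-i} + H ⊗ H_{n-i-1},
  -- and the first summand has total degree n. At i = n the remainder is in H_n ⊗ H_0.
  have key : ∀ i ≤ n, Coalgebra.comul (R := k) x ∈
      (tens (coradFilt k H i) ⊤ ⊓ tensFilt k H n) ⊔ tens ⊤ (coradFilt k H (n - i)) := by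
    intro i
    induction i with
    | zero => exact fun _ => Submodule.mem_sup_right (comul_mem_top_tens hx)
    | succ i ih =>
      intro hi
      obtain ⟨s, hs, r, hr, hsr⟩ := Submodule.mem_sup.1 (ih (by omega))
      have hx' : x ∈ coradFilt k H (i + (n - (i + 1)) + 1) := by
        rwa [show i + (n - (i + 1)) + 1 = n by omega]
      rw [coradFilt_add] at hx'
      have hr' : r ∈ tens (coradFilt k H i) ⊤ ⊔ tens ⊤ (coradFilt k H (n - (i + 1))) := by
        rw [show r = Coalgebra.comul (R := k) x - s by rw [← hsr]; abel]
        exact sub_mem hx' (Submodule.mem_sup_left hs.1)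
      obtain ⟨s', hs', r', hr'', hsr'⟩ := Submodule.mem_sup.1 (tens_sup_inf hr' hr)
      rw [← hsr, ← hsr', ← add_assoc]
      refine add_mem (Submodule.mem_sup_left (add_mem ?_ ?_)) (Submodule.mem_sup_right hr'')
      · exact ⟨tens_mono (coradFilt_le_succ i) le_rfl hs.1, hs.2⟩
      · exact ⟨tens_mono (coradFilt_le_succ i) le_top hs',
          tens_le_tensFilt (by omega) hs'⟩
  obtain ⟨s, hs, r, hr, hsr⟩ := Submodule.mem_sup.1 (key n le_rfl)
  have hr' : r ∈ tens (coradFilt k H n) ⊤ := by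
    rw [show r = Coalgebra.comul (R := k) x - s by rw [← hsr]; abel]
    exact sub_mem (comul_mem_tens_top hx) hs.1
  rw [← hsr]
  refine add_mem hs.2 (tens_le_tensFilt (by omega) (tens_inf hr' hr))

/-- The coradical of a pointed coalgebra is spanned by the group-like elements. -/
lemma coradical_eq_span (hH : IsPointedCoalgebra k H) :
    coradical k H = Submodule.span k (Set.range (GroupLike.val (R := k) (A := H))) := by
  apply le_antisymm
  · refine sSup_le fun D hD => ?_
    obtain ⟨d, hd0, hd⟩ := finrank_eq_one_iff'.1 (hH D hD)
    have hspan : ∀ x ∈ D, ∃ c : k, c • (d : H) = x := fun x hx => by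
      obtain ⟨c, hc⟩ := hd ⟨x, hx⟩
      exact ⟨c, congrArg Subtype.val hc⟩
    have hle : tens D D ≤ k ∙ ((d : H) ⊗ₜ[k] (d : H)) := by
      refine tens_le.2 fun x hx y hy => ?_
      obtain ⟨a, rfl⟩ := hspan x hx
      obtain ⟨b, rfl⟩ := hspan y hy
      rw [TensorProduct.smul_tmul_smul]
      exact Submodule.smul_mem _ _ (Submodule.mem_span_singleton_self _)
    -- A spanning vector d satisfies Δ(d) = c⁻¹-free relation c (d ⊗ d) = Δ(d); the counit then
    -- gives c ε(d) = 1, and c d is group-like.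
    obtain ⟨c, hc⟩ := Submodule.mem_span_singleton.1 (hle (hD.1 d d.2))
    have h1 : c * Coalgebra.counit (R := k) (d : H) = 1 := by
      have := Coalgebra.lTensor_counit_comul (R := k) (d : H)
      rw [← hc] at this
      have := congrArg (TensorProduct.rid k H) this
      simp only [map_smul, LinearMap.lTensor_tmul, TensorProduct.rid_tmul, one_smul,
        smul_smul] at this
      have hd0' : (d : H) ≠ 0 := by simpa using hd0
      exact smul_left_injective k hd0' (by simpa using this)
    let g : GroupLike k H := ⟨c • (d : H),
      ⟨by simpa using h1, by rw [map_smul, ← hc, TensorProduct.smul_tmul_smul, smul_smul]⟩⟩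
    intro x hx
    obtain ⟨b, rfl⟩ := hspan x hx
    have hc0 : c ≠ 0 := by rintro rfl; simp at h1
    have : b • (d : H) = (b * c⁻¹) • g.val := by
      simp only [g]
      rw [smul_smul, mul_assoc, inv_mul_cancel₀ hc0, mul_one]
    rw [this]
    exact Submodule.smul_mem _ _ (Submodule.subset_span ⟨g, rfl⟩)
  · rw [Submodule.span_le]
    rintro _ ⟨g, rfl⟩
    have hg0 : g.val ≠ 0 := g.2.ne_zero
    suffices h : IsSimpleSubcoalgebra (k ∙ g.val) from
      le_sSup (a := k ∙ g.val) h (Submodule.mem_span_singleton_self _)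
    refine ⟨?_, ?_, ?_⟩
    · intro x hx
      obtain ⟨c, rfl⟩ := Submodule.mem_span_singleton.1 hx
      rw [map_smul, g.2.comul_eq_tmul_self]
      exact Submodule.smul_mem _ _ (tmul_mem_tens (Submodule.mem_span_singleton_self _)
        (Submodule.mem_span_singleton_self _))
    · simpa using hg0
    · intro E _ hE
      by_cases h : E = ⊥
      · exact Or.inl h
      · right
        obtain ⟨x, hx, hx0⟩ := Submodule.exists_mem_ne_zero_of_ne_bot h
        refine le_antisymm hE ?_
        obtain ⟨c, rfl⟩ := Submodule.mem_span_singleton.1 (hE hx)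
        have hc : c ≠ 0 := by rintro rfl; simp at hx0
        rw [Submodule.span_singleton_le_iff_mem]
        simpa [smul_smul, inv_mul_cancel₀ hc] using E.smul_mem c⁻¹ hx

end Filtration

/-! ### The antipode reverses the coproduct -/

section Antipode

open HopfAlgebra WithConv

variable {k : Type*} [Field k] {H : Type*} [Ring H] [HopfAlgebra k H]

/-- Applying `a ⊗ b ⊗ c ⊗ d ↦ F(a, b, c, d)` to the iterated coproduct in two ways. -/
lemma comul_comul_middle {M : Type*} [AddCommGroup M] [Module k M]
    (F : (H ⊗[k] H) ⊗[k] (H ⊗[k] H) →ₗ[k] M) (a : H) :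
    F (TensorProduct.map Coalgebra.comul Coalgebra.comul (Coalgebra.comul (R := k) a)) =
      F ((TensorProduct.assoc k H H (H ⊗[k] H)).symm (LinearMap.lTensor H
        ((TensorProduct.assoc k H H H).toLinearMap ∘ₗ Coalgebra.comul.rTensor H)
          (Coalgebra.comul.lTensor H (Coalgebra.comul a)))) := by
  congr 1
  have h1 : TensorProduct.map (Coalgebra.comul (R := k)) Coalgebra.comul (Coalgebra.comul a) =
      LinearMap.lTensor (H ⊗[k] H) (Coalgebra.comul (R := k))
        (Coalgebra.comul.rTensor H (Coalgebra.comul (R := k) a)) :=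
    (LinearMap.congr_fun (LinearMap.lTensor_comp_rTensor _ _ _) _).symm
  have h2 : ∀ t : H ⊗[k] (H ⊗[k] H),
      LinearMap.lTensor (H ⊗[k] H) (Coalgebra.comul (R := k))
        ((TensorProduct.assoc k H H H).symm t) =
      (TensorProduct.assoc k H H (H ⊗[k] H)).symm
        (LinearMap.lTensor H (Coalgebra.comul.lTensor H) t) := by
    intro t
    induction t with
    | zero => simp
    | add x y hx hy => simp only [map_add, hx, hy]
    | tmul x y =>
      induction y with
      | zero => simp
      | add y z hy hz => simp only [map_add, TensorProduct.tmul_add, hy, hz]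
      | tmul y z => simp
  rw [h1, ← Coalgebra.coassoc_symm_apply, h2]
  congr 1
  rw [← LinearMap.lTensor_comp_apply, ← LinearMap.lTensor_comp_apply, LinearMap.comp_assoc,
    Coalgebra.coassoc]

/-- Δ ∘ S and a ↦ S(a₂) ⊗ S(a₁) are a right and a left convolution inverse of Δ. For the left one,
S(a₂)a₃ ⊗ S(a₁)a₄ collapses in the middle first; `comul_comul_middle` supplies that bracketing. -/
lemma comul_antipode (a : H) :
    Coalgebra.comul (R := k) (antipode k a) =
      TensorProduct.map (antipode k) (antipode k)
        (TensorProduct.comm k H H (Coalgebra.comul (R := k) a)) := by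
  suffices h : (Coalgebra.comul (R := k) (A := H)) ∘ₗ antipode k =
      TensorProduct.map (antipode k) (antipode k) ∘ₗ
        (TensorProduct.comm k H H).toLinearMap ∘ₗ Coalgebra.comul (R := k) from
    LinearMap.congr_fun h a
  apply toConv_injective
  refine (left_inv_eq_right_inv (a := toConv (Coalgebra.comul (R := k) (A := H))) ?_
    LinearMap.comul_right_inv).symm
  ext a
  rw [LinearMap.convMul_apply, LinearMap.convOne_apply, ofConv_toConv, ofConv_toConv,
    ← LinearMap.comp_assoc, ← Function.comp_apply (f := LinearMap.mul' k (H ⊗[k] H)),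
    ← LinearMap.coe_comp]
  have := comul_comul_middle (LinearMap.mul' k (H ⊗[k] H) ∘ₗ
    LinearMap.rTensor (H ⊗[k] H) (TensorProduct.map (antipode k) (antipode k) ∘ₗ
        (TensorProduct.comm k H H).toLinearMap)) a
  rw [LinearMap.comp_apply, LinearMap.comp_apply, ← LinearMap.comp_apply (LinearMap.rTensor _ _),
    LinearMap.rTensor_comp_map] at this
  refine this.trans ?_
  have h3 : ∀ t : H ⊗[k] H,
      (LinearMap.mul' k (H ⊗[k] H) ∘ₗ
        LinearMap.rTensor (H ⊗[k] H) (TensorProduct.map (antipode k) (antipode k) ∘ₗ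
        (TensorProduct.comm k H H).toLinearMap)) ((TensorProduct.assoc k H H (H ⊗[k] H)).symm
        (LinearMap.lTensor H
        ((TensorProduct.assoc k H H H).toLinearMap ∘ₗ Coalgebra.comul.rTensor H)
          (Coalgebra.comul.lTensor H t))) =
      (1 : H) ⊗ₜ[k] LinearMap.mul' k H ((antipode k).rTensor H t) := by
    intro t
    induction t with
    | zero => simp
    | add x y hx hy => simp only [map_add, hx, hy, TensorProduct.tmul_add]
    | tmul x y =>
      simp only [LinearMap.lTensor_tmul, LinearMap.comp_apply, LinearEquiv.coe_coe]
      have h4 : ∀ s : (H ⊗[k] H) ⊗[k] H,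
        (LinearMap.mul' k (H ⊗[k] H)) (LinearMap.rTensor (H ⊗[k] H)
          (TensorProduct.map (antipode k) (antipode k) ∘ₗ (TensorProduct.comm k H H).toLinearMap)
          ((TensorProduct.assoc k H H (H ⊗[k] H)).symm
            (x ⊗ₜ[k] (TensorProduct.assoc k H H H) s))) =
          TensorProduct.map (LinearMap.mul' k H ∘ₗ (antipode k).rTensor H)
            (LinearMap.mulLeft k (antipode k x)) s := by
        intro s
        induction s with
        | zero => simp
        | add u v hu hv => simp only [map_add, hu, hv, TensorProduct.tmul_add]
        | tmul u v =>
          induction u with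
          | zero => simp
          | add u w hu hw => simp only [map_add, hu, hw, TensorProduct.add_tmul,
              TensorProduct.tmul_add]
          | tmul u w => simp
      rw [h4, ← LinearMap.comp_apply, LinearMap.map_comp_rTensor, LinearMap.comp_assoc,
        mul_antipode_rTensor_comul, ← LinearMap.map_comp_rTensor, LinearMap.comp_apply,
        Coalgebra.rTensor_counit_comul]
      simp
  refine (h3 _).trans ?_
  rw [mul_antipode_rTensor_comul_apply]
  simp [Algebra.algebraMap_eq_smul_one, Algebra.TensorProduct.one_def]

end Antipode

/-! ### Product and antipode on the filtration of a pointed Hopf algebra -/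

section Pointed

variable {k : Type v} [Field k] {H : Type u} [Ring H] [HopfAlgebra k H]

lemma groupLike_mem_coradFilt (hH : IsPointedCoalgebra k H) (g : GroupLike k H) :
    g.val ∈ coradFilt k H 0 := by
  change g.val ∈ coradical k H
  rw [coradical_eq_span hH]
  exact Submodule.subset_span ⟨g, rfl⟩

lemma coradFilt_zero_le_iff (hH : IsPointedCoalgebra k H) {Z : Submodule k H} :
    coradFilt k H 0 ≤ Z ↔ ∀ g : GroupLike k H, g.val ∈ Z := by
  change coradical k H ≤ Z ↔ _
  rw [coradical_eq_span hH, Submodule.span_le]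
  exact Set.range_subset_iff

/-- The coradical filtration of a pointed Hopf algebra is an algebra filtration. -/
lemma mul_mem_coradFilt (hH : IsPointedCoalgebra k H) {m n : ℕ} {a b : H}
    (ha : a ∈ coradFilt k H m) (hb : b ∈ coradFilt k H n) : a * b ∈ coradFilt k H (m + n) := by
  have h0 : ∀ x ∈ coradFilt k H 0, ∀ y ∈ coradFilt k H 0, x * y ∈ coradFilt k H 0 := by
    intro x hx y hy
    have h1 : ∀ g : GroupLike k H, coradFilt k H 0 ≤
        (coradFilt k H 0).comap (LinearMap.mulLeft k g.val) := fun g =>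
      (coradFilt_zero_le_iff hH).2 fun h => groupLike_mem_coradFilt hH (g * h)
    have h2 : coradFilt k H 0 ≤ (coradFilt k H 0).comap (LinearMap.mulRight k y) :=
      (coradFilt_zero_le_iff hH).2 fun g => h1 g hy
    exact h2 hx
  obtain ⟨l, hl⟩ : ∃ l, l = m + n := ⟨_, rfl⟩
  -- In Δ(a)Δ(b) a term whose two left factors have degree 0 lies in H₀ ⊗ H, as H₀ is closed under
  -- products. In any other term the right factors have total degree below m + n, so induction puts
  -- it in H ⊗ H_{m+n-1}.
  induction l using Nat.strong_induction_on generalizing m n a b with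
  | _ l ih =>
    rcases Nat.eq_zero_or_pos (m + n) with hmn | hmn
    · obtain ⟨rfl, rfl⟩ : m = 0 ∧ n = 0 := by omega
      exact h0 a ha b hb
    · obtain ⟨l', hl'⟩ : ∃ l', m + n = l' + 1 := ⟨m + n - 1, by omega⟩
      rw [hl', coradFilt_succ, wedge, Submodule.mem_comap, Bialgebra.comul_mul]
      set W := tens (coradFilt k H 0) ⊤ ⊔ tens ⊤ (coradFilt k H l') with hW
      have h2 : ∀ i j : ℕ, i + j = m → ∀ x ∈ coradFilt k H i, ∀ y ∈ coradFilt k H j,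
          tensFilt k H n ≤ W.comap (LinearMap.mulLeft k (x ⊗ₜ[k] y)) := by
        intro i j hij x hx y hy
        refine tensFilt_le fun i' j' hij' x' hx' y' hy' => ?_
        change x ⊗ₜ[k] y * x' ⊗ₜ[k] y' ∈ W
        rw [Algebra.TensorProduct.tmul_mul_tmul]
        rcases Nat.eq_zero_or_pos (i + i') with hi | hi
        · obtain ⟨rfl, rfl⟩ : i = 0 ∧ i' = 0 := by omega
          exact Submodule.mem_sup_left (tmul_mem_tens (h0 _ hx _ hx') trivial)
        · refine Submodule.mem_sup_right (tmul_mem_tens trivial ?_)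
          exact coradFilt_mono (by omega) (ih (j + j') (by omega) hy hy' rfl)
      have h3 : tensFilt k H m ≤ W.comap (LinearMap.mulRight k (Coalgebra.comul (R := k) b)) :=
        tensFilt_le fun i j hij x hx y hy => h2 i j hij x hx y hy (comul_mem_tensFilt hb)
      exact h3 (comul_mem_tensFilt ha)

/-- Strong induction: a term x ⊗ y of bidegree (i, j) in the coproduct becomes S(y) ⊗ S(x). If j = 0
then S(y) lies in H₀; otherwise i is smaller than the degree of a and induction applies to S(x). -/
lemma antipode_mem_coradFilt (hH : IsPointedCoalgebra k H) {n : ℕ} {a : H}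
    (ha : a ∈ coradFilt k H n) : HopfAlgebra.antipode k a ∈ coradFilt k H n := by
  have h0 : coradFilt k H 0 ≤ (coradFilt k H 0).comap (HopfAlgebra.antipode k) :=
    (coradFilt_zero_le_iff hH).2 fun g => groupLike_mem_coradFilt hH g⁻¹
  induction n using Nat.strong_induction_on generalizing a with
  | _ n ih =>
    rcases n with _ | n
    · exact h0 ha
    · rw [coradFilt_succ, wedge, Submodule.mem_comap, comul_antipode]
      have h1 : tensFilt k H (n + 1) ≤
          (tens (coradFilt k H 0) ⊤ ⊔ tens ⊤ (coradFilt k H n)).comap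
            (TensorProduct.map (HopfAlgebra.antipode k) (HopfAlgebra.antipode k) ∘ₗ
              (TensorProduct.comm k H H).toLinearMap) := by
        refine tensFilt_le fun i j hij x hx y hy => ?_
        change HopfAlgebra.antipode k y ⊗ₜ[k] HopfAlgebra.antipode k x ∈
          tens (coradFilt k H 0) ⊤ ⊔ tens ⊤ (coradFilt k H n)
        rcases Nat.eq_zero_or_pos j with rfl | hj
        · exact Submodule.mem_sup_left (tmul_mem_tens (h0 hy) trivial)
        · exact Submodule.mem_sup_right (tmul_mem_tens trivial
            (coradFilt_mono (by omega) (ih i (by omega) hx)))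
      exact h1 (comul_mem_tensFilt ha)

end Pointed

/-! ### Symbols of filtered linear maps -/

section Symbols

variable (k : Type*) [Field k]

/-- A filtered vector space `V` together with its associated graded space `V'`: `Rel n` relates the
elements of the `n`-th step of the filtration to their classes in degree `n`, and `P n` extends
the class map in degree `n` to all of `V`. -/
structure FiltGr (V V' : Type*) [AddCommGroup V] [Module k V] [AddCommGroup V'] [Module k V'] where
  Rel : ℕ → Submodule k (V × V')
  P : ℕ → V →ₗ[k] V'
  P_eq : ∀ n, ∀ p ∈ Rel n, P n p.1 = p.2
  P_lt : ∀ m n, m < n → ∀ p ∈ Rel m, P n p.1 = 0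
  shift : ∀ n, ∀ p ∈ Rel n, (p.1, 0) ∈ Rel (n + 1)
  span : ⨆ n, (Rel n).map (LinearMap.snd k V V') = ⊤

namespace FiltGr

variable {k}
variable {V V' W W' U U' Z Z' : Type*} [AddCommGroup V] [Module k V] [AddCommGroup V'] [Module k V']
  [AddCommGroup W] [Module k W] [AddCommGroup W'] [Module k W']
  [AddCommGroup U] [Module k U] [AddCommGroup U'] [Module k U']
  [AddCommGroup Z] [Module k Z] [AddCommGroup Z'] [Module k Z']

lemma shift_add (X : FiltGr k V V') {n m : ℕ} (hnm : n < m) {p : V × V'} (hp : p ∈ X.Rel n) :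
    (p.1, 0) ∈ X.Rel m := by
  induction m, hnm using Nat.le_induction with
  | base => exact X.shift n p hp
  | succ m _ ih => exact X.shift m (p.1, 0) ih

/-- `f₀` is the symbol of the filtered map `f`. -/
def IsSymbol (X : FiltGr k V V') (Y : FiltGr k W W') (f : V →ₗ[k] W) (f₀ : V' →ₗ[k] W') : Prop :=
  ∀ n, ∀ p ∈ X.Rel n, (f p.1, f₀ p.2) ∈ Y.Rel n

/-- `P n` recovers the class in degree n from the filtered element, and such classes span. This
carries every identity between filtered maps over to the graded spaces. -/
lemma IsSymbol.unique {X : FiltGr k V V'} {Y : FiltGr k W W'} {f : V →ₗ[k] W}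
    {f₀ f₁ : V' →ₗ[k] W'} (h₀ : IsSymbol X Y f f₀) (h₁ : IsSymbol X Y f f₁) : f₀ = f₁ := by
  rw [← LinearMap.eqLocus_eq_top, eq_top_iff, ← X.span]
  refine iSup_le fun n => ?_
  rintro _ ⟨p, hp, rfl⟩
  exact (Y.P_eq n _ (h₀ n p hp)).symm.trans (Y.P_eq n _ (h₁ n p hp))

lemma IsSymbol.comp {X : FiltGr k V V'} {Y : FiltGr k W W'} {T : FiltGr k U U'}
    {g : W →ₗ[k] U} {g₀ : W' →ₗ[k] U'} {f : V →ₗ[k] W} {f₀ : V' →ₗ[k] W'}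
    (hg : IsSymbol Y T g g₀) (hf : IsSymbol X Y f f₀) : IsSymbol X T (g ∘ₗ f) (g₀ ∘ₗ f₀) :=
  fun n p hp => hg n _ (hf n p hp)

lemma IsSymbol.id (X : FiltGr k V V') : IsSymbol X X LinearMap.id LinearMap.id :=
  fun _ _ hp => hp

variable (k) in
/-- The base field, in degree `0`. -/
def unit : FiltGr k k k where
  Rel n := match n with
    | 0 => LinearMap.range (LinearMap.prod LinearMap.id LinearMap.id)
    | _ + 1 => LinearMap.range (LinearMap.prod LinearMap.id 0)
  P n := match n with
    | 0 => LinearMap.id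
    | _ + 1 => 0
  P_eq n p hp := by
    cases n <;> obtain ⟨x, rfl⟩ := hp <;> rfl
  P_lt m n hmn p hp := by
    cases n
    · omega
    · rfl
  shift n p hp := ⟨p.1, rfl⟩
  span := by
    rw [eq_top_iff]
    rintro x -
    exact Submodule.mem_iSup_of_mem 0 ⟨(x, x), ⟨x, rfl⟩, rfl⟩

lemma mem_unit_zero {p : k × k} : p ∈ (unit k).Rel 0 ↔ p.2 = p.1 :=
  ⟨by rintro ⟨x, rfl⟩; rfl, fun h => ⟨p.1, Prod.ext rfl h.symm⟩⟩

lemma mem_unit_succ {n : ℕ} {p : k × k} : p ∈ (unit k).Rel (n + 1) ↔ p.2 = 0 :=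
  ⟨by rintro ⟨x, rfl⟩; rfl, fun h => ⟨p.1, Prod.ext rfl h.symm⟩⟩

/-- Tensor products of filtered spaces and their associated graded spaces. -/
def tensor (X : FiltGr k V V') (Y : FiltGr k W W') : FiltGr k (V ⊗[k] W) (V' ⊗[k] W') where
  Rel n := Submodule.span k {z | ∃ i j p q, i + j = n ∧ p ∈ X.Rel i ∧ q ∈ Y.Rel j ∧
    z = (p.1 ⊗ₜ[k] q.1, p.2 ⊗ₜ[k] q.2)}
  P n := ∑ a ∈ Finset.HasAntidiagonal.antidiagonal n, TensorProduct.map (X.P a.1) (Y.P a.2)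
  P_eq n z hz := by
    induction hz using Submodule.span_induction with
    | zero => simp
    | add x y _ _ hx hy => rw [Prod.fst_add, map_add, hx, hy]; rfl
    | smul c x _ hx => rw [Prod.smul_fst, map_smul, hx]; rfl
    | mem z hz =>
      obtain ⟨i, j, p, q, hij, hp, hq, rfl⟩ := hz
      -- If a + b = i + j and (a, b) ≠ (i, j), then a > i or b > j, and one of the two class maps
      -- vanishes on the lower filtration step.
      rw [LinearMap.sum_apply, Finset.sum_eq_single (i, j)]
      · simp [X.P_eq i p hp, Y.P_eq j q hq]
      · rintro ⟨a, b⟩ hab hne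
        rw [Finset.HasAntidiagonal.mem_antidiagonal] at hab
        simp only [ne_eq, Prod.mk.injEq, not_and] at hne hab
        rw [TensorProduct.map_tmul]
        rcases lt_trichotomy i a with h | h | h
        · rw [X.P_lt i a h p hp, TensorProduct.zero_tmul]
        · exact absurd (by omega) (hne h.symm)
        · rw [Y.P_lt j b (by omega) q hq, TensorProduct.tmul_zero]
      · intro h
        exact absurd (by simpa using hij) h
  P_lt m n hmn z hz := by
    induction hz using Submodule.span_induction with
    | zero => simp
    | add x y _ _ hx hy => rw [Prod.fst_add, map_add, hx, hy, add_zero]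
    | smul c x _ hx => rw [Prod.smul_fst, map_smul, hx, smul_zero]
    | mem z hz =>
      obtain ⟨i, j, p, q, hij, hp, hq, rfl⟩ := hz
      rw [LinearMap.sum_apply]
      refine Finset.sum_eq_zero ?_
      rintro ⟨a, b⟩ hab
      rw [Finset.HasAntidiagonal.mem_antidiagonal] at hab
      rw [TensorProduct.map_tmul]
      simp only at hab ⊢
      rcases lt_or_ge i a with h | h
      · rw [X.P_lt i a h p hp, TensorProduct.zero_tmul]
      · rw [Y.P_lt j b (by omega) q hq, TensorProduct.tmul_zero]
  shift n z hz := by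
    induction hz using Submodule.span_induction with
    | zero => exact zero_mem _
    | add x y _ _ hx hy => simpa using add_mem hx hy
    | smul c x _ hx => simpa using Submodule.smul_mem _ c hx
    | mem z hz =>
      obtain ⟨i, j, p, q, hij, hp, hq, rfl⟩ := hz
      refine Submodule.subset_span ⟨i + 1, j, _, q, by omega, X.shift i p hp, hq, ?_⟩
      simp
  span := by
    rw [eq_top_iff, ← tens_top_top, tens_le]
    intro v _ w _
    set S := ⨆ n, (Submodule.span k {z | ∃ i j p q, i + j = n ∧ p ∈ X.Rel i ∧ q ∈ Y.Rel j ∧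
      z = (p.1 ⊗ₜ[k] q.1, p.2 ⊗ₜ[k] q.2)}).map (LinearMap.snd k (V ⊗[k] W) (V' ⊗[k] W')) with hS
    have h1 : ∀ i, ∀ p ∈ X.Rel i, (⊤ : Submodule k W') ≤ S.comap (TensorProduct.mk k V' W' p.2) := by
      intro i p hp
      rw [← Y.span]
      refine iSup_le fun j => ?_
      rintro _ ⟨q, hq, rfl⟩
      exact Submodule.mem_iSup_of_mem (i + j)
        ⟨_, Submodule.subset_span ⟨i, j, p, q, rfl, hp, hq, rfl⟩, rfl⟩
    have h2 : (⊤ : Submodule k V') ≤ S.comap ((TensorProduct.mk k V' W').flip w) := by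
      rw [← X.span]
      refine iSup_le fun i => ?_
      rintro _ ⟨p, hp, rfl⟩
      exact h1 i p hp (Submodule.mem_top (x := w))
    exact h2 (Submodule.mem_top (x := v))

lemma tmul_mem_tensor {X : FiltGr k V V'} {Y : FiltGr k W W'} {i j : ℕ} {p : V × V'} {q : W × W'}
    (hp : p ∈ X.Rel i) (hq : q ∈ Y.Rel j) :
    (p.1 ⊗ₜ[k] q.1, p.2 ⊗ₜ[k] q.2) ∈ (X.tensor Y).Rel (i + j) :=
  Submodule.subset_span ⟨i, j, p, q, rfl, hp, hq, rfl⟩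

lemma tensor_rel_induction {X : FiltGr k V V'} {Y : FiltGr k W W'} {T : FiltGr k U U'}
    (f : V ⊗[k] W →ₗ[k] U) (f₀ : V' ⊗[k] W' →ₗ[k] U') {n m : ℕ}
    (h : ∀ i j, i + j = n → ∀ p ∈ X.Rel i, ∀ q ∈ Y.Rel j,
      (f (p.1 ⊗ₜ q.1), f₀ (p.2 ⊗ₜ q.2)) ∈ T.Rel m)
    {z : (V ⊗[k] W) × (V' ⊗[k] W')} (hz : z ∈ (X.tensor Y).Rel n) :
    (f z.1, f₀ z.2) ∈ T.Rel m := by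
  induction hz using Submodule.span_induction with
  | zero => rw [Prod.fst_zero, Prod.snd_zero, map_zero, map_zero]; exact zero_mem _
  | add x y _ _ hx hy => simpa using add_mem hx hy
  | smul c x _ hx => simpa using Submodule.smul_mem _ c hx
  | mem z hz =>
    obtain ⟨i, j, p, q, hij, hp, hq, rfl⟩ := hz
    exact h i j hij p hp q hq

/-- To recognize the symbol of a map on a tensor product it is enough to look at pure tensors. -/
lemma isSymbol_tensor {X : FiltGr k V V'} {Y : FiltGr k W W'} {T : FiltGr k U U'}
    {f : V ⊗[k] W →ₗ[k] U} {f₀ : V' ⊗[k] W' →ₗ[k] U'}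
    (h : ∀ i j, ∀ p ∈ X.Rel i, ∀ q ∈ Y.Rel j,
      (f (p.1 ⊗ₜ q.1), f₀ (p.2 ⊗ₜ q.2)) ∈ T.Rel (i + j)) : IsSymbol (X.tensor Y) T f f₀ := by
  intro n z hz
  refine tensor_rel_induction f f₀ ?_ hz
  rintro i j rfl
  exact h i j

lemma IsSymbol.map {X : FiltGr k V V'} {Y : FiltGr k W W'} {T : FiltGr k U U'} {R : FiltGr k Z Z'}
    {f : V →ₗ[k] U} {f₀ : V' →ₗ[k] U'} {g : W →ₗ[k] Z} {g₀ : W' →ₗ[k] Z'}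
    (hf : IsSymbol X T f f₀) (hg : IsSymbol Y R g g₀) :
    IsSymbol (X.tensor Y) (T.tensor R) (TensorProduct.map f g) (TensorProduct.map f₀ g₀) :=
  isSymbol_tensor fun i j p hp q hq => tmul_mem_tensor (hf i p hp) (hg j q hq)

lemma isSymbol_comm (X : FiltGr k V V') (Y : FiltGr k W W') :
    IsSymbol (X.tensor Y) (Y.tensor X) (TensorProduct.comm k V W).toLinearMap
      (TensorProduct.comm k V' W').toLinearMap :=
  isSymbol_tensor fun i j p hp q hq => by
    rw [add_comm]; exact tmul_mem_tensor hq hp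

lemma isSymbol_lid (X : FiltGr k V V') :
    IsSymbol ((unit k).tensor X) X (TensorProduct.lid k V).toLinearMap
      (TensorProduct.lid k V').toLinearMap :=
  isSymbol_tensor fun i j p hp q hq => by
    simp only [LinearEquiv.coe_coe, TensorProduct.lid_tmul]
    cases i with
    | zero =>
      rw [mem_unit_zero] at hp
      rw [hp, zero_add]
      exact Submodule.smul_mem _ p.1 hq
    | succ i =>
      rw [mem_unit_succ] at hp
      rw [hp, zero_smul]
      exact X.shift_add (p := p.1 • q) (by omega) (Submodule.smul_mem _ p.1 hq)

lemma isSymbol_rid (X : FiltGr k V V') :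
    IsSymbol (X.tensor (unit k)) X (TensorProduct.rid k V).toLinearMap
      (TensorProduct.rid k V').toLinearMap := by
  have := (isSymbol_lid X).comp (isSymbol_comm X (unit k))
  convert this using 1 <;> ext <;> simp

lemma isSymbol_mk_one (X : FiltGr k V V') :
    IsSymbol X ((unit k).tensor X) (TensorProduct.mk k k V 1) (TensorProduct.mk k k V' 1) := by
  intro n p hp
  have := tmul_mem_tensor (X := unit k) (p := (1, 1)) (mem_unit_zero.2 rfl) hp
  rwa [zero_add] at this

lemma isSymbol_mk_flip_one (X : FiltGr k V V') :
    IsSymbol X (X.tensor (unit k)) ((TensorProduct.mk k V k).flip 1)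
      ((TensorProduct.mk k V' k).flip 1) := by
  have := (isSymbol_comm (unit k) X).comp (isSymbol_mk_one X)
  convert this using 1 <;> ext <;> simp

lemma isSymbol_assoc (X : FiltGr k V V') (Y : FiltGr k W W') (T : FiltGr k U U') :
    IsSymbol ((X.tensor Y).tensor T) (X.tensor (Y.tensor T))
      (TensorProduct.assoc k V W U).toLinearMap (TensorProduct.assoc k V' W' U').toLinearMap :=
  isSymbol_tensor fun i j p hp q hq => by
    have := tensor_rel_induction (T := X.tensor (Y.tensor T)) (m := i + j)
      ((TensorProduct.assoc k V W U).toLinearMap ∘ₗ (TensorProduct.mk k _ _).flip q.1)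
      ((TensorProduct.assoc k V' W' U').toLinearMap ∘ₗ (TensorProduct.mk k _ _).flip q.2)
      (by rintro i' j' rfl p hp p' hp'
          simp only [LinearMap.comp_apply, LinearMap.flip_apply, TensorProduct.mk_apply,
            LinearEquiv.coe_coe, TensorProduct.assoc_tmul, add_assoc]
          exact tmul_mem_tensor hp (tmul_mem_tensor hp' hq)) hp
    simpa only [LinearMap.comp_apply, LinearMap.flip_apply, TensorProduct.mk_apply,
      LinearEquiv.coe_coe] using this

lemma isSymbol_assoc_symm (X : FiltGr k V V') (Y : FiltGr k W W') (T : FiltGr k U U') :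
    IsSymbol (X.tensor (Y.tensor T)) ((X.tensor Y).tensor T)
      (TensorProduct.assoc k V W U).symm.toLinearMap
      (TensorProduct.assoc k V' W' U').symm.toLinearMap :=
  isSymbol_tensor fun i j p hp q hq => by
    have := tensor_rel_induction (T := (X.tensor Y).tensor T) (m := i + j)
      ((TensorProduct.assoc k V W U).symm.toLinearMap ∘ₗ TensorProduct.mk k _ _ p.1)
      ((TensorProduct.assoc k V' W' U').symm.toLinearMap ∘ₗ TensorProduct.mk k _ _ p.2)
      (by rintro i' j' rfl q hq q' hq'
          simp only [LinearMap.comp_apply, TensorProduct.mk_apply,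
            LinearEquiv.coe_coe, TensorProduct.assoc_symm_tmul, ← add_assoc]
          exact tmul_mem_tensor (tmul_mem_tensor hp hq) hq') hq
    simpa only [LinearMap.comp_apply, TensorProduct.mk_apply, LinearEquiv.coe_coe] using this

lemma isSymbol_tensorTensorTensorComm (X : FiltGr k V V') (Y : FiltGr k W W') (T : FiltGr k U U')
    (R : FiltGr k Z Z') :
    IsSymbol ((X.tensor Y).tensor (T.tensor R)) ((X.tensor T).tensor (Y.tensor R))
      (TensorProduct.tensorTensorTensorComm k V W U Z).toLinearMap
      (TensorProduct.tensorTensorTensorComm k V' W' U' Z').toLinearMap := by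
  have h := ((isSymbol_assoc_symm X T (Y.tensor R)).comp ((IsSymbol.id X).map
    ((isSymbol_assoc T Y R).comp
      (((isSymbol_comm Y T).map (IsSymbol.id R)).comp (isSymbol_assoc_symm Y T R))))).comp
        (isSymbol_assoc X Y (T.tensor R))
  convert h using 1 <;> ext <;> simp

end FiltGr
end Symbols

/-! ### Hopf algebras presented by linear maps -/

section HopfOps

/-- The operations of a Hopf algebra, as linear maps. -/
structure HopfOps (k A : Type*) [Field k] [AddCommGroup A] [Module k A] where
  mul : A ⊗[k] A →ₗ[k] A
  unit : k →ₗ[k] A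
  comul : A →ₗ[k] A ⊗[k] A
  counit : A →ₗ[k] k
  antipode : A →ₗ[k] A

namespace HopfOps

variable {k A : Type*} [Field k] [AddCommGroup A] [Module k A]

open TensorProduct (map)

/-- The axioms of a Hopf algebra, as identities of linear maps. -/
structure IsHopf (d : HopfOps k A) : Prop where
  mul_assoc : d.mul ∘ₗ map d.mul LinearMap.id =
    d.mul ∘ₗ map LinearMap.id d.mul ∘ₗ (TensorProduct.assoc k A A A).toLinearMap
  one_mul : d.mul ∘ₗ map d.unit LinearMap.id = (TensorProduct.lid k A).toLinearMap
  mul_one : d.mul ∘ₗ map LinearMap.id d.unit = (TensorProduct.rid k A).toLinearMap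
  coassoc : (TensorProduct.assoc k A A A).toLinearMap ∘ₗ map d.comul LinearMap.id ∘ₗ d.comul =
    map LinearMap.id d.comul ∘ₗ d.comul
  counit_comul : map d.counit LinearMap.id ∘ₗ d.comul = TensorProduct.mk k k A 1
  comul_counit : map LinearMap.id d.counit ∘ₗ d.comul = (TensorProduct.mk k A k).flip 1
  comul_mul : d.comul ∘ₗ d.mul = map d.mul d.mul ∘ₗ
    (TensorProduct.tensorTensorTensorComm k A A A A).toLinearMap ∘ₗ map d.comul d.comul
  counit_mul : d.counit ∘ₗ d.mul = (TensorProduct.lid k k).toLinearMap ∘ₗ map d.counit d.counit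
  comul_unit : d.comul ∘ₗ d.unit = map d.unit d.unit ∘ₗ TensorProduct.mk k k k 1
  counit_unit : d.counit ∘ₗ d.unit = LinearMap.id
  antipode_mul : d.mul ∘ₗ map d.antipode LinearMap.id ∘ₗ d.comul = d.unit ∘ₗ d.counit
  mul_antipode : d.mul ∘ₗ map LinearMap.id d.antipode ∘ₗ d.comul = d.unit ∘ₗ d.counit

variable (k A) in
/-- The operations of a given Hopf algebra. -/
def ofHopf (k A : Type*) [Field k] [Ring A] [HopfAlgebra k A] : HopfOps k A where
  mul := LinearMap.mul' k A
  unit := Algebra.linearMap k A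
  comul := Coalgebra.comul
  counit := Coalgebra.counit
  antipode := HopfAlgebra.antipode k

lemma isHopf_ofHopf (k A : Type*) [Field k] [Ring A] [HopfAlgebra k A] :
    (ofHopf k A).IsHopf where
  mul_assoc := by ext; simp [ofHopf, _root_.mul_assoc]
  one_mul := by ext; simp [ofHopf]
  mul_one := by ext; simp [ofHopf]
  coassoc := Coalgebra.coassoc
  counit_comul := Coalgebra.rTensor_counit_comp_comul
  comul_counit := Coalgebra.lTensor_counit_comp_comul
  comul_mul := by
    ext a b
    simp only [ofHopf, TensorProduct.AlgebraTensorModule.curry_apply, LinearMap.restrictScalars_self,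
      TensorProduct.curry_apply, LinearMap.comp_apply, LinearMap.mul'_apply, Bialgebra.comul_mul,
      TensorProduct.map_tmul, LinearEquiv.coe_coe]
    generalize Coalgebra.comul (R := k) a = s
    generalize Coalgebra.comul (R := k) b = t
    induction s with
    | zero => simp
    | add x y hx hy => simp only [add_mul, TensorProduct.add_tmul, map_add, hx, hy]
    | tmul x y =>
      induction t with
      | zero => simp
      | add x y hx hy => simp only [mul_add, TensorProduct.tmul_add, map_add, hx, hy]
      | tmul x' y' => simp
  counit_mul := by ext; simp [ofHopf]
  comul_unit := by ext; simp [ofHopf, Algebra.TensorProduct.one_def]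
  counit_unit := by ext; simp [ofHopf]
  antipode_mul := HopfAlgebra.mul_antipode_rTensor_comul
  mul_antipode := HopfAlgebra.mul_antipode_lTensor_comul

open FiltGr in
/-- Symbols of the operations of a Hopf algebra satisfy the axioms of a Hopf algebra. -/
lemma IsHopf.symbol {A' : Type*} [AddCommGroup A'] [Module k A'] {d : HopfOps k A}
    (hd : d.IsHopf) {d' : HopfOps k A'} (X : FiltGr k A A')
    (hmul : IsSymbol (X.tensor X) X d.mul d'.mul)
    (hunit : IsSymbol (FiltGr.unit k) X d.unit d'.unit)
    (hcomul : IsSymbol X (X.tensor X) d.comul d'.comul)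
    (hcounit : IsSymbol X (FiltGr.unit k) d.counit d'.counit)
    (hantipode : IsSymbol X X d.antipode d'.antipode) : d'.IsHopf := by
  have hid := IsSymbol.id X
  constructor
  -- In each axiom the two sides are symbols of the two sides of the same axiom for `d`, which are
  -- equal maps.
  · refine (hmul.comp (hmul.map hid)).unique ?_
    rw [hd.mul_assoc]
    exact hmul.comp ((hid.map hmul).comp (isSymbol_assoc X X X))
  · refine (hmul.comp (hunit.map hid)).unique ?_
    rw [hd.one_mul]
    exact isSymbol_lid X
  · refine (hmul.comp (hid.map hunit)).unique ?_
    rw [hd.mul_one]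
    exact isSymbol_rid X
  · refine ((isSymbol_assoc X X X).comp ((hcomul.map hid).comp hcomul)).unique ?_
    rw [hd.coassoc]
    exact (hid.map hcomul).comp hcomul
  · refine ((hcounit.map hid).comp hcomul).unique ?_
    rw [hd.counit_comul]
    exact isSymbol_mk_one X
  · refine ((hid.map hcounit).comp hcomul).unique ?_
    rw [hd.comul_counit]
    exact isSymbol_mk_flip_one X
  · refine (hcomul.comp hmul).unique ?_
    rw [hd.comul_mul]
    exact (hmul.map hmul).comp
      ((isSymbol_tensorTensorTensorComm X X X X).comp (hcomul.map hcomul))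
  · refine (hcounit.comp hmul).unique ?_
    rw [hd.counit_mul]
    exact (isSymbol_lid _).comp (hcounit.map hcounit)
  · refine (hcomul.comp hunit).unique ?_
    rw [hd.comul_unit]
    exact (hunit.map hunit).comp (isSymbol_mk_one _)
  · refine (hcounit.comp hunit).unique ?_
    rw [hd.counit_unit]
    exact IsSymbol.id _
  · refine (hmul.comp ((hantipode.map hid).comp hcomul)).unique ?_
    rw [hd.antipode_mul]
    exact hunit.comp hcounit
  · refine (hmul.comp ((hid.map hantipode).comp hcomul)).unique ?_
    rw [hd.mul_antipode]
    exact hunit.comp hcounit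

section Instances

variable {d : HopfOps k A} (h : d.IsHopf)

/-- The ring with the given operations. -/
abbrev IsHopf.ring : Ring A :=
  { (inferInstance : AddCommGroup A) with
    mul := fun a b => d.mul (a ⊗ₜ[k] b)
    one := d.unit 1
    left_distrib := fun a b c => (congrArg d.mul (TensorProduct.tmul_add a b c)).trans
      (map_add d.mul _ _)
    right_distrib := fun a b c => (congrArg d.mul (TensorProduct.add_tmul a b c)).trans
      (map_add d.mul _ _)
    zero_mul := fun a => (congrArg d.mul (TensorProduct.zero_tmul A a)).trans (map_zero d.mul)
    mul_zero := fun a => (congrArg d.mul (TensorProduct.tmul_zero A a)).trans (map_zero d.mul)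
    mul_assoc := fun a b c => LinearMap.congr_fun h.mul_assoc ((a ⊗ₜ[k] b) ⊗ₜ[k] c)
    one_mul := fun a => (LinearMap.congr_fun h.one_mul ((1 : k) ⊗ₜ[k] a)).trans (one_smul k a)
    mul_one := fun a => (LinearMap.congr_fun h.mul_one (a ⊗ₜ[k] (1 : k))).trans (one_smul k a) }

/-- The algebra with the given operations. -/
abbrev IsHopf.algebra : @Algebra k A _ h.ring.toSemiring :=
  letI := h.ring
  Algebra.ofModule
    (fun c a b => (congrArg d.mul (TensorProduct.smul_tmul' c a b).symm).trans
      (map_smul d.mul c _))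
    (fun c a b => (congrArg d.mul (TensorProduct.tmul_smul c a b)).trans
      (map_smul d.mul c _))

/-- The coalgebra with the given operations. -/
abbrev IsHopf.coalgebra : Coalgebra k A where
  comul := d.comul
  counit := d.counit
  coassoc := h.coassoc
  rTensor_counit_comp_comul := h.counit_comul
  lTensor_counit_comp_comul := h.comul_counit

/-- Links the axiom `comul_mul`, stated with linear maps, to the product of the tensor square
algebra, which the bialgebra structure refers to. -/
lemma IsHopf.map_mul_tensorTensorTensorComm (s t : A ⊗[k] A) :
    letI := h.ring
    letI := h.algebra
    map d.mul d.mul (TensorProduct.tensorTensorTensorComm k A A A A (s ⊗ₜ[k] t)) = s * t := by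
  obtain ⟨F, hF⟩ : ∃ F : (A ⊗[k] A) ⊗[k] (A ⊗[k] A) →ₗ[k] A ⊗[k] A, F = map d.mul d.mul ∘ₗ
    (TensorProduct.tensorTensorTensorComm k A A A A).toLinearMap := ⟨_, rfl⟩
  have hF' : ∀ x y x' y' : A, F ((x ⊗ₜ[k] y) ⊗ₜ[k] (x' ⊗ₜ[k] y')) =
      d.mul (x ⊗ₜ[k] x') ⊗ₜ[k] d.mul (y ⊗ₜ[k] y') := by
    intro x y x' y'
    rw [hF]; rfl
  let := h.ring
  let := h.algebra
  refine (LinearMap.congr_fun hF (s ⊗ₜ[k] t)).symm.trans ?_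
  induction s with
  | zero => rw [zero_mul, TensorProduct.zero_tmul, F.map_zero]
  | add x y hx hy => rw [add_mul, TensorProduct.add_tmul, F.map_add, hx, hy]
  | tmul x y =>
    induction t with
    | zero => rw [mul_zero, TensorProduct.tmul_zero, F.map_zero]
    | add x y hx hy => rw [mul_add, TensorProduct.tmul_add, F.map_add, hx, hy]
    | tmul x' y' =>
      rw [hF', Algebra.TensorProduct.tmul_mul_tmul]
      rfl

/-- The bialgebra with the given operations. -/
abbrev IsHopf.bialgebra : @Bialgebra k A _ h.ring.toSemiring :=
  letI := h.ring
  letI := h.algebra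
  letI := h.coalgebra
  Bialgebra.mk' k A (LinearMap.congr_fun h.counit_unit 1)
    (fun {a b} => LinearMap.congr_fun h.counit_mul (a ⊗ₜ[k] b))
    ((LinearMap.congr_fun h.comul_unit 1))
    (fun {a b} => (LinearMap.congr_fun h.comul_mul (a ⊗ₜ[k] b)).trans
      (h.map_mul_tensorTensorTensorComm _ _))

lemma IsHopf.unit_eq :
    letI := h.ring
    letI := h.algebra
    Algebra.linearMap k A = d.unit := by
  let := h.ring
  let := h.algebra
  refine LinearMap.ext_ring ?_
  rw [Algebra.linearMap_apply, map_one]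
  rfl

/-- The Hopf algebra with the given operations. -/
abbrev IsHopf.hopfAlgebra : @HopfAlgebra k A _ h.ring.toSemiring :=
  letI := h.ring
  letI := h.bialgebra
  { h.bialgebra with
    antipode := d.antipode
    mul_antipode_rTensor_comul := by
      have : LinearMap.mul' k A = d.mul := TensorProduct.ext' fun _ _ => rfl
      rw [this, h.unit_eq]
      exact h.antipode_mul
    mul_antipode_lTensor_comul := by
      have : LinearMap.mul' k A = d.mul := TensorProduct.ext' fun _ _ => rfl
      rw [this, h.unit_eq]
      exact h.mul_antipode }

end Instances

end HopfOps

end HopfOps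

/-! ### The symbol calculus for gr(H) -/

section GrFilt

variable {k : Type v} [Field k] {H : Type u} [AddCommGroup H] [Module k H] [Coalgebra k H]

lemma grClass_eq_zero {n : ℕ} {a : H} (h : a ∈ coradFilt k H n) (ha : a ∈ coradFiltPrev k H n) :
    grClass k H n ⟨a, h⟩ = 0 := by
  have : Submodule.mkQ ((coradFiltPrev k H n).submoduleOf (coradFilt k H n)) ⟨a, h⟩ = 0 := by
    rw [Submodule.mkQ_apply, Submodule.Quotient.mk_eq_zero]
    exact ha
  rw [grClass, LinearMap.comp_apply, this, map_zero]

lemma iSup_range_grClass : ⨆ n, LinearMap.range (grClass k H n) = ⊤ := by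
  rw [eq_top_iff]
  rintro x -
  induction x using DirectSum.induction_on with
  | zero => exact zero_mem _
  | add x y hx hy => exact add_mem hx hy
  | of n x =>
    obtain ⟨a, rfl⟩ := Submodule.mkQ_surjective _ x
    exact Submodule.mem_iSup_of_mem n ⟨a, rfl⟩

variable {A : Type*} [AddCommGroup A] [Module k A]

/-- An extension of the class map in degree `n` to `H`. -/
def grClassExt (φ : Gr k H ≃ₗ[k] A) (n : ℕ) : H →ₗ[k] A :=
  (LinearMap.exists_extend (φ.toLinearMap ∘ₗ grClass k H n)).choose

lemma grClassExt_apply (φ : Gr k H ≃ₗ[k] A) {n : ℕ} (a : coradFilt k H n) :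
    grClassExt φ n (a : H) = φ (grClass k H n a) :=
  LinearMap.congr_fun (LinearMap.exists_extend (φ.toLinearMap ∘ₗ grClass k H n)).choose_spec a

/-- The coradical filtration of `H` together with the model `A` of `gr(H)`. -/
def grFilt (φ : Gr k H ≃ₗ[k] A) : FiltGr k H A where
  Rel n := LinearMap.range ((coradFilt k H n).subtype.prod (φ.toLinearMap ∘ₗ grClass k H n))
  P n := grClassExt φ n
  P_eq n p hp := by
    obtain ⟨a, rfl⟩ := hp
    exact grClassExt_apply φ a
  P_lt m n hmn p hp := by
    obtain ⟨a, rfl⟩ := hp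
    obtain ⟨n, rfl⟩ : ∃ l, n = l + 1 := ⟨n - 1, by omega⟩
    have h1 : (a : H) ∈ coradFilt k H n := coradFilt_mono (by omega) a.2
    refine (grClassExt_apply φ (⟨a, coradFilt_le_succ n h1⟩ : coradFilt k H (n + 1))).trans ?_
    rw [grClass_eq_zero (n := n + 1) _ h1, map_zero]
  shift n p hp := by
    obtain ⟨a, rfl⟩ := hp
    refine ⟨⟨a, coradFilt_le_succ n a.2⟩, Prod.ext rfl ?_⟩
    change φ (grClass k H (n + 1) ⟨a, coradFilt_le_succ n a.2⟩) = 0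
    rw [grClass_eq_zero (n := n + 1) _ a.2, map_zero]
  span := by
    have : ∀ n, Submodule.map (LinearMap.snd k H A) (LinearMap.range
        ((coradFilt k H n).subtype.prod (φ.toLinearMap ∘ₗ grClass k H n))) =
        (LinearMap.range (grClass k H n)).map φ.toLinearMap := by
      intro n
      rw [← LinearMap.range_comp, ← LinearMap.range_comp]
      rfl
    simp_rw [this]
    rw [← Submodule.map_iSup, iSup_range_grClass, Submodule.map_top]
    exact LinearEquiv.range φ

lemma mem_grFilt {φ : Gr k H ≃ₗ[k] A} {n : ℕ} (a : coradFilt k H n) :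
    ((a : H), φ (grClass k H n a)) ∈ (grFilt φ).Rel n := ⟨a, rfl⟩

lemma exists_of_mem_grFilt {φ : Gr k H ≃ₗ[k] A} {n : ℕ} {p : H × A}
    (hp : p ∈ (grFilt φ).Rel n) : ∃ a : coradFilt k H n, p = ((a : H), φ (grClass k H n a)) := by
  obtain ⟨a, rfl⟩ := hp
  exact ⟨a, rfl⟩

variable {W W' : Type*} [AddCommGroup W] [Module k W] [AddCommGroup W'] [Module k W']

/-- Filtered maps have symbols. -/
lemma exists_isSymbol (φ : Gr k H ≃ₗ[k] A) (Y : FiltGr k W W') (f : H →ₗ[k] W)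
    (hf : ∀ n, ∀ a ∈ coradFilt k H n, ∃ w, (f a, w) ∈ Y.Rel n) :
    ∃ f₀ : A →ₗ[k] W', (grFilt φ).IsSymbol Y f f₀ := by
  -- If a already lies in the preceding step, then so does f a, and its class in degree n is zero;
  -- hence the class of f a depends only on that of a.
  have hker : ∀ n, (coradFiltPrev k H n).submoduleOf (coradFilt k H n) ≤
      LinearMap.ker (Y.P n ∘ₗ f ∘ₗ (coradFilt k H n).subtype) := by
    rintro (_ | n) a ha
    · have : (a : H) = 0 := ha
      simp [this]
    · obtain ⟨w, hw⟩ := hf n a ha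
      exact Y.P_lt n (n + 1) (by omega) _ hw
  refine ⟨(DirectSum.toModule k ℕ W' fun n => Submodule.liftQ _ _ (hker n)) ∘ₗ
    φ.symm.toLinearMap, ?_⟩
  rintro n _ ⟨a, rfl⟩
  obtain ⟨w, hw⟩ := hf n a a.2
  convert hw using 1
  refine Prod.ext rfl ?_
  change DirectSum.toModule k ℕ W' (fun n => Submodule.liftQ _ _ (hker n))
    (φ.symm (φ (DirectSum.lof k ℕ (GrPiece k H) n (Submodule.mkQ _ a)))) = w
  rw [φ.symm_apply_apply, DirectSum.toModule_lof]
  exact Y.P_eq n _ hw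

/-- Filtered bilinear maps have symbols. -/
lemma exists_isSymbol_tensor (φ : Gr k H ≃ₗ[k] A) (Y : FiltGr k W W') (f : H ⊗[k] H →ₗ[k] W)
    (hf : ∀ m n, ∀ a ∈ coradFilt k H m, ∀ b ∈ coradFilt k H n,
      ∃ w, (f (a ⊗ₜ b), w) ∈ Y.Rel (m + n)) :
    ∃ f₀ : A ⊗[k] A →ₗ[k] W', ((grFilt φ).tensor (grFilt φ)).IsSymbol Y f f₀ := by
  let B : ∀ m n, coradFilt k H m →ₗ[k] coradFilt k H n →ₗ[k] W' := fun m n =>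
    ((TensorProduct.curry f).compr₂ (Y.P (m + n))).compl₁₂ (coradFilt k H m).subtype
      (coradFilt k H n).subtype
  have h1 : ∀ m n, (coradFiltPrev k H m).submoduleOf (coradFilt k H m) ≤
      LinearMap.ker (B m n) := by
    rintro (_ | m) n a ha
    · have : a = 0 := Subtype.ext ha
      simp [this]
    · refine LinearMap.ext fun b => ?_
      obtain ⟨w, hw⟩ := hf m n a ha b b.2
      exact Y.P_lt (m + n) (m + 1 + n) (by omega) _ hw
  -- The bilinear map descends to the quotients one variable at a time.
  let B' : ∀ m n, GrPiece k H m →ₗ[k] coradFilt k H n →ₗ[k] W' := fun m n =>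
    Submodule.liftQ _ (B m n) (h1 m n)
  have h2 : ∀ m n, (coradFiltPrev k H n).submoduleOf (coradFilt k H n) ≤
      LinearMap.ker (B' m n).flip := by
    rintro m (_ | n) b hb
    · have : b = 0 := Subtype.ext hb
      simp [this]
    · refine LinearMap.ext fun x => ?_
      obtain ⟨a, rfl⟩ := Submodule.mkQ_surjective _ x
      obtain ⟨w, hw⟩ := hf m n a a.2 b hb
      exact Y.P_lt (m + n) (m + (n + 1)) (by omega) _ hw
  let G : Gr k H →ₗ[k] Gr k H →ₗ[k] W' := DirectSum.toModule k ℕ _ fun m =>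
    (DirectSum.toModule k ℕ _ fun n => Submodule.liftQ _ (B' m n).flip (h2 m n)).flip
  have hG : ∀ m n (a : coradFilt k H m) (b : coradFilt k H n),
      G (grClass k H m a) (grClass k H n b) = Y.P (m + n) (f ((a : H) ⊗ₜ (b : H))) := by
    intro m n a b
    change (DirectSum.toModule k ℕ _ fun m =>
      (DirectSum.toModule k ℕ _ fun n => Submodule.liftQ _ (B' m n).flip (h2 m n)).flip)
      (DirectSum.lof k ℕ (GrPiece k H) m (Submodule.mkQ _ a))
      (DirectSum.lof k ℕ (GrPiece k H) n (Submodule.mkQ _ b)) = _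
    rw [DirectSum.toModule_lof, LinearMap.flip_apply, DirectSum.toModule_lof]
    rfl
  refine ⟨TensorProduct.lift (G.compl₁₂ φ.symm.toLinearMap φ.symm.toLinearMap),
    FiltGr.isSymbol_tensor ?_⟩
  rintro m n _ ⟨a, rfl⟩ _ ⟨b, rfl⟩
  obtain ⟨w, hw⟩ := hf m n a a.2 b b.2
  convert hw using 1
  refine Prod.ext rfl ?_
  refine Eq.trans ?_ ((hG m n a b).trans (Y.P_eq _ _ hw))
  change G (φ.symm (φ _)) (φ.symm (φ _)) = _
  rw [φ.symm_apply_apply, φ.symm_apply_apply]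

lemma exists_rel_of_mem_tensFilt {φ : Gr k H ≃ₗ[k] A} {n : ℕ} {t : H ⊗[k] H}
    (ht : t ∈ tensFilt k H n) : ∃ t', (t, t') ∈ ((grFilt φ).tensor (grFilt φ)).Rel n := by
  have : tensFilt k H n ≤
      (((grFilt φ).tensor (grFilt φ)).Rel n).map (LinearMap.fst k (H ⊗[k] H) (A ⊗[k] A)) := by
    refine tensFilt_le fun i j hij a ha b hb => ?_
    subst hij
    exact ⟨_, FiltGr.tmul_mem_tensor (mem_grFilt ⟨a, ha⟩) (mem_grFilt ⟨b, hb⟩), rfl⟩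
  obtain ⟨p, hp, rfl⟩ := this ht
  exact ⟨p.2, hp⟩

/-- Produces the family of components t_{ij} in the shape required by `IsGrHopf.comul`. -/
lemma exists_components {φ : Gr k H ≃ₗ[k] A} {n : ℕ} {z : (H ⊗[k] H) × (A ⊗[k] A)}
    (hz : z ∈ ((grFilt φ).tensor (grFilt φ)).Rel n) :
    ∃ t : (p : ℕ × ℕ) → coradFilt k H p.1 ⊗[k] coradFilt k H p.2,
      z.1 = ∑ p ∈ Finset.HasAntidiagonal.antidiagonal n, TensorProduct.mapIncl _ _ (t p) ∧
      z.2 = ∑ p ∈ Finset.HasAntidiagonal.antidiagonal n,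
          TensorProduct.map (φ.toLinearMap ∘ₗ grClass k H p.1)
            (φ.toLinearMap ∘ₗ grClass k H p.2) (t p) := by
  induction hz using Submodule.span_induction with
  | zero => exact ⟨0, by simp⟩
  | add x y _ _ hx hy =>
    obtain ⟨t, h1, h2⟩ := hx
    obtain ⟨s, h3, h4⟩ := hy
    refine ⟨t + s, ?_, ?_⟩
    · simp only [Pi.add_apply, map_add, Finset.sum_add_distrib, ← h1, ← h3, Prod.fst_add]
    · simp only [Pi.add_apply, map_add, Finset.sum_add_distrib, ← h2, ← h4, Prod.snd_add]
  | smul c x _ hx =>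
    obtain ⟨t, h1, h2⟩ := hx
    refine ⟨c • t, ?_, ?_⟩
    · simp only [Pi.smul_apply, map_smul, ← Finset.smul_sum, ← h1, Prod.smul_fst]
    · simp only [Pi.smul_apply, map_smul, ← Finset.smul_sum, ← h2, Prod.smul_snd]
  | mem z hz =>
    obtain ⟨i, j, _, _, hij, ⟨a, rfl⟩, ⟨b, rfl⟩, rfl⟩ := hz
    classical
    refine ⟨Pi.single (i, j) (a ⊗ₜ[k] b), ?_, ?_⟩
    · rw [Finset.sum_eq_single (i, j), Pi.single_eq_same]
      · rfl
      · intro p _ hp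
        rw [Pi.single_eq_of_ne hp, map_zero]
      · intro h
        exact absurd (Finset.HasAntidiagonal.mem_antidiagonal.2 hij) h
    · rw [Finset.sum_eq_single (i, j), Pi.single_eq_same]
      · rfl
      · intro p _ hp
        rw [Pi.single_eq_of_ne hp, map_zero]
      · intro h
        exact absurd (Finset.HasAntidiagonal.mem_antidiagonal.2 hij) h

lemma map_mem_tensor_rel (φ : Gr k H ≃ₗ[k] A) (i j : ℕ)
    (t : coradFilt k H i ⊗[k] coradFilt k H j) :
    (TensorProduct.mapIncl _ _ t, TensorProduct.map (φ.toLinearMap ∘ₗ grClass k H i)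
      (φ.toLinearMap ∘ₗ grClass k H j) t) ∈ ((grFilt φ).tensor (grFilt φ)).Rel (i + j) := by
  induction t with
  | zero => rw [map_zero, map_zero]; exact zero_mem _
  | add x y hx hy => rw [map_add, map_add]; exact add_mem hx hy
  | tmul a b => exact FiltGr.tmul_mem_tensor (mem_grFilt a) (mem_grFilt b)

end GrFilt

/-! ### Existence of the Hopf algebra gr(H) -/

section GrHopf

variable {k : Type v} [Field k] {H : Type u} [Ring H] [HopfAlgebra k H]

/-- The associated graded Hopf algebra of a pointed Hopf algebra. -/
theorem exists_isGrHopf (hH : IsPointedCoalgebra k H) :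
    ∃ (A : Type u) (_ : Ring A) (_ : HopfAlgebra k A) (φ : Gr k H ≃ₗ[k] A), IsGrHopf φ := by
  obtain ⟨A, _, _, ⟨φ⟩⟩ : ∃ (A : Type u) (_ : AddCommGroup A) (_ : Module k A),
    Nonempty (Gr k H ≃ₗ[k] A) := ⟨Gr k H, inferInstance, inferInstance, ⟨LinearEquiv.refl k _⟩⟩
  set X := grFilt φ with hX
  let d := HopfOps.ofHopf k H
  obtain ⟨m, hm⟩ := exists_isSymbol_tensor φ X d.mul fun m n a ha b hb =>
    ⟨_, mem_grFilt ⟨a * b, mul_mem_coradFilt hH ha hb⟩⟩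
  obtain ⟨c, hc⟩ := exists_isSymbol φ (X.tensor X) d.comul fun n a ha =>
    exists_rel_of_mem_tensFilt (comul_mem_tensFilt ha)
  obtain ⟨s, hs⟩ := exists_isSymbol φ X d.antipode fun n a ha =>
    ⟨_, mem_grFilt ⟨_, antipode_mem_coradFilt hH ha⟩⟩
  -- The base field is concentrated in degree 0, so in positive degree the class of ε(a) is 0.
  obtain ⟨e, he⟩ := exists_isSymbol φ (FiltGr.unit k) d.counit fun n a ha => by
    cases n with
    | zero => exact ⟨_, FiltGr.mem_unit_zero.2 rfl⟩
    | succ n => exact ⟨_, FiltGr.mem_unit_succ.2 rfl⟩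
  let one : coradFilt k H 0 := ⟨1, groupLike_mem_coradFilt hH 1⟩
  let d' : HopfOps k A :=
    ⟨m, LinearMap.toSpanSingleton k A (φ (grClass k H 0 one)), c, e, s⟩
  have hu : (FiltGr.unit k).IsSymbol X d.unit d'.unit := by
    rintro (_ | n) p hp
    · rw [FiltGr.mem_unit_zero] at hp
      have := mem_grFilt (φ := φ) (p.1 • one)
      convert this using 1
      refine Prod.ext ?_ ?_
      · change algebraMap k H p.1 = p.1 • (1 : H)
        rw [Algebra.algebraMap_eq_smul_one]
      · change p.2 • φ (grClass k H 0 one) = φ (grClass k H 0 (p.1 • one))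
        rw [hp, map_smul, map_smul]
    · rw [FiltGr.mem_unit_succ] at hp
      rw [hp, map_zero]
      refine X.shift_add (n := 0) (p := (d.unit p.1, φ (grClass k H 0 (p.1 • one)))) (by omega) ?_
      have := mem_grFilt (φ := φ) (p.1 • one)
      convert this using 1
      refine Prod.ext ?_ rfl
      change algebraMap k H p.1 = p.1 • (1 : H)
      rw [Algebra.algebraMap_eq_smul_one]
  have h : d'.IsHopf := (HopfOps.isHopf_ofHopf k H).symbol X hm hu hc he hs
  refine ⟨A, h.ring, h.hopfAlgebra, φ, ?_⟩
  refine @IsGrHopf.mk k _ H _ _ A h.ring h.hopfAlgebra _ ?_ ?_ ?_ ?_ ?_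
  · exact ⟨one, rfl, (one_smul k (φ (grClass k H 0 one))).symm⟩
  · intro m n a b
    have := hm (m + n) _ (FiltGr.tmul_mem_tensor (mem_grFilt a) (mem_grFilt b))
    obtain ⟨c, hc⟩ := exists_of_mem_grFilt this
    exact ⟨c, (congrArg Prod.fst hc).symm, congrArg Prod.snd hc⟩
  · intro a
    exact FiltGr.mem_unit_zero.1 (he 0 _ (mem_grFilt a))
  · intro n a
    exact FiltGr.mem_unit_succ.1 (he (n + 1) _ (mem_grFilt a))
  · intro n a
    exact exists_components (hc n _ (mem_grFilt a))

end GrHopf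

/-! ### Pulling forms back along homomorphisms -/

section Pullback

open WithConv

variable {k : Type v} [Field k] {A : Type*} [Ring A] [HopfAlgebra k A]
  {B : Type*} [Ring B] [HopfAlgebra k B]

lemma bialgHom_comul (F : B →ₐc[k] A) (x : B) : Coalgebra.comul (R := k) (F x) =
    TensorProduct.map (F : B →ₗ[k] A) (F : B →ₗ[k] A) (Coalgebra.comul (R := k) x) :=
  (CoalgHomClass.map_comp_comul_apply F x).symm

/-- Precomposition with a coalgebra map is a homomorphism of convolution monoids. -/
lemma isUnit_toConv_comp {C E : Type*} [AddCommGroup C] [Module k C] [Coalgebra k C]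
    [AddCommGroup E] [Module k E] [Coalgebra k E] (F : C →ₗc[k] E) {r : E →ₗ[k] k}
    (hr : IsUnit (toConv r)) : IsUnit (toConv (r ∘ₗ F.toLinearMap)) := by
  let M : WithConv (E →ₗ[k] k) →* WithConv (C →ₗ[k] k) :=
    { toFun := fun f => toConv (f.ofConv ∘ₗ F.toLinearMap)
      map_one' := by
        ext c
        exact congrArg (algebraMap k k) (CoalgHomClass.counit_comp_apply F c)
      map_mul' := fun f g => by
        apply WithConv.ofConv_injective
        exact LinearMap.convMul_comp_coalgHom_distrib f g F }
  exact hr.map M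

/-- This axiom has its values in the algebra, not in k: `F` carries both sides to those for A, and
injectivity of `F` is what allows going back. -/
lemma braided_comm_comp (F : B →ₐc[k] A) (hF : Function.Injective F) {r : A ⊗[k] A →ₗ[k] k}
    (h : ∀ a b : A,
      TensorProduct.rid k A (TensorProduct.map
        (LinearMap.mul' k A ∘ₗ (TensorProduct.comm k A A).toLinearMap) r
          (Coalgebra.comul (R := k) (a ⊗ₜ[k] b))) =
      TensorProduct.lid k A (TensorProduct.map r (LinearMap.mul' k A)
        (Coalgebra.comul (R := k) (a ⊗ₜ[k] b)))) (a b : B) :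
    TensorProduct.rid k B (TensorProduct.map
      (LinearMap.mul' k B ∘ₗ (TensorProduct.comm k B B).toLinearMap)
        (r ∘ₗ TensorProduct.map (F : B →ₗ[k] A) (F : B →ₗ[k] A))
        (Coalgebra.comul (R := k) (a ⊗ₜ[k] b))) =
    TensorProduct.lid k B (TensorProduct.map
      (r ∘ₗ TensorProduct.map (F : B →ₗ[k] A) (F : B →ₗ[k] A)) (LinearMap.mul' k B)
        (Coalgebra.comul (R := k) (a ⊗ₜ[k] b))) := by
  apply hF
  set f : B →ₗ[k] A := (F : B →ₗ[k] A) with hf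
  have hΔ : Coalgebra.comul (R := k) (F a ⊗ₜ[k] F b) =
      TensorProduct.map (TensorProduct.map f f) (TensorProduct.map f f)
        (Coalgebra.comul (R := k) (a ⊗ₜ[k] b)) :=
    (CoalgHomClass.map_comp_comul_apply
      (Coalgebra.TensorProduct.map (F : B →ₗc[k] A) (F : B →ₗc[k] A)) (a ⊗ₜ[k] b)).symm
  have h1 : ∀ t : (B ⊗[k] B) ⊗[k] (B ⊗[k] B),
      F (TensorProduct.rid k B (TensorProduct.map
        (LinearMap.mul' k B ∘ₗ (TensorProduct.comm k B B).toLinearMap)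
        (r ∘ₗ TensorProduct.map f f) t)) =
      TensorProduct.rid k A (TensorProduct.map
        (LinearMap.mul' k A ∘ₗ (TensorProduct.comm k A A).toLinearMap) r
          (TensorProduct.map (TensorProduct.map f f) (TensorProduct.map f f) t)) := by
    intro t
    induction t with
    | zero => simp
    | add x y hx hy => simp only [map_add, hx, hy]
    | tmul x y =>
      induction x with
      | zero => simp
      | add x y hx hy => simp only [map_add, hx, hy, TensorProduct.add_tmul]
      | tmul x x' => simp [hf]
  have h2 : ∀ t : (B ⊗[k] B) ⊗[k] (B ⊗[k] B),
      F (TensorProduct.lid k B (TensorProduct.map (r ∘ₗ TensorProduct.map f f)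
        (LinearMap.mul' k B) t)) =
      TensorProduct.lid k A (TensorProduct.map r (LinearMap.mul' k A)
          (TensorProduct.map (TensorProduct.map f f) (TensorProduct.map f f) t)) := by
    intro t
    induction t with
    | zero => simp
    | add x y hx hy => simp only [map_add, hx, hy]
    | tmul x y =>
      induction y with
      | zero => simp
      | add x y hx hy => simp only [map_add, hx, hy, TensorProduct.tmul_add]
      | tmul y y' => simp [hf]
  rw [h1, h2, ← hΔ]
  exact h _ _

/-- Forms can be pulled back along homomorphisms of Hopf algebras, apart from the braided
commutativity. -/
lemma IsCoquasitriangular.comp {r : A ⊗[k] A →ₗ[k] k} (hr : IsCoquasitriangular r)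
    (F : B →ₐc[k] A)
    (h : ∀ a b : B,
      TensorProduct.rid k B (TensorProduct.map
        (LinearMap.mul' k B ∘ₗ (TensorProduct.comm k B B).toLinearMap)
        (r ∘ₗ TensorProduct.map (F : B →ₗ[k] A) (F : B →ₗ[k] A))
        (Coalgebra.comul (R := k) (a ⊗ₜ[k] b))) =
      TensorProduct.lid k B (TensorProduct.map
        (r ∘ₗ TensorProduct.map (F : B →ₗ[k] A) (F : B →ₗ[k] A)) (LinearMap.mul' k B)
        (Coalgebra.comul (R := k) (a ⊗ₜ[k] b)))) :
    IsCoquasitriangular (r ∘ₗ TensorProduct.map (F : B →ₗ[k] A) (F : B →ₗ[k] A)) where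
  conv_invertible := isUnit_toConv_comp
    (Coalgebra.TensorProduct.map (F : B →ₗc[k] A) (F : B →ₗc[k] A)) hr.conv_invertible
  mul_left a b c := by
    have := hr.mul_left (F a) (F b) (F c)
    rw [bialgHom_comul, ← LinearMap.comp_apply (TensorProduct.map _ _),
      ← TensorProduct.map_comp] at this
    refine Eq.trans ?_ this
    rw [← map_mul]
    rfl
  mul_right a b c := by
    have := hr.mul_right (F a) (F b) (F c)
    rw [bialgHom_comul, ← LinearMap.comp_apply (TensorProduct.map _ _),
      ← TensorProduct.map_comp] at this
    refine Eq.trans ?_ this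
    rw [← map_mul]
    rfl
  braided_comm := h

end Pullback

/-! ### The form gr(ℛ) is coquasitriangular -/

section GrForm

variable {k : Type v} [Field k] {H : Type u} [Ring H] [HopfAlgebra k H]
  {A : Type u} [Ring A] [HopfAlgebra k A] {φ : Gr k H ≃ₗ[k] A}

lemma gr_hom_ext {k : Type v} [Field k] {H : Type u} [AddCommGroup H] [Module k H] [Coalgebra k H]
    {A : Type*} [AddCommGroup A] [Module k A] (φ : Gr k H ≃ₗ[k] A)
    {W : Type*} [AddCommGroup W] [Module k W] {f g : A →ₗ[k] W}
    (h : ∀ n (a : coradFilt k H n), f (φ (grClass k H n a)) = g (φ (grClass k H n a))) :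
    f = g := by
  rw [← LinearMap.eqLocus_eq_top, eq_top_iff, ← (grFilt φ).span]
  refine iSup_le fun n => ?_
  rintro _ ⟨_, ⟨a, rfl⟩, rfl⟩
  exact h n a

/-- The projection of `gr(H)` to `H₀`, as a map into `H`. -/
def grProj (φ : Gr k H ≃ₗ[k] A) : A →ₗ[k] H := grProjZero k H ∘ₗ φ.symm.toLinearMap

lemma grForm_tmul (φ : Gr k H ≃ₗ[k] A) (r : H ⊗[k] H →ₗ[k] k) (a b : A) :
    grForm φ r (a ⊗ₜ b) = r (grProj φ a ⊗ₜ grProj φ b) := rfl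

@[simp] lemma grProj_zero (φ : Gr k H ≃ₗ[k] A) (a : coradFilt k H 0) :
    grProj φ (φ (grClass k H 0 a)) = a := by
  simp only [grProj, LinearMap.comp_apply, LinearEquiv.coe_coe, LinearEquiv.symm_apply_apply]
  rw [grProjZero, LinearMap.comp_apply, grClass, LinearMap.comp_apply, DirectSum.component.lof_self]
  rfl

@[simp] lemma grProj_succ (φ : Gr k H ≃ₗ[k] A) (n : ℕ) (a : coradFilt k H (n + 1)) :
    grProj φ (φ (grClass k H (n + 1) a)) = 0 := by
  simp only [grProj, LinearMap.comp_apply, LinearEquiv.coe_coe, LinearEquiv.symm_apply_apply]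
  rw [grProjZero, LinearMap.comp_apply, grClass, LinearMap.comp_apply, DirectSum.component.of,
    dif_neg (by omega), map_zero]

lemma grProj_pos (φ : Gr k H ≃ₗ[k] A) {n : ℕ} (hn : 0 < n) (a : coradFilt k H n) :
    grProj φ (φ (grClass k H n a)) = 0 := by
  obtain ⟨n, rfl⟩ : ∃ m, n = m + 1 := ⟨n - 1, by omega⟩
  exact grProj_succ φ n a

lemma grProj_mem (φ : Gr k H ≃ₗ[k] A) (a : A) : grProj φ a ∈ coradFilt k H 0 := by
  have h : (coradFilt k H 0).mkQ ∘ₗ grProj φ = 0 := by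
    refine gr_hom_ext φ ?_
    rintro (_ | n) a
    · rw [LinearMap.comp_apply, grProj_zero]; simp
    · rw [LinearMap.comp_apply, grProj_succ]; simp
  exact (Submodule.Quotient.mk_eq_zero _).1 (LinearMap.congr_fun h a)

namespace IsGrHopf

open FiltGr

lemma isSymbol_mul (h : IsGrHopf φ) : IsSymbol ((grFilt φ).tensor (grFilt φ)) (grFilt φ) (LinearMap.mul' k H)
    (LinearMap.mul' k A) := by
  refine isSymbol_tensor ?_
  rintro m n _ ⟨a, rfl⟩ _ ⟨b, rfl⟩
  obtain ⟨c, hc, hc'⟩ := h.mul m n a b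
  exact ⟨c, Prod.ext hc hc'.symm⟩

lemma isSymbol_comul (h : IsGrHopf φ) : IsSymbol (grFilt φ) ((grFilt φ).tensor (grFilt φ))
    (Coalgebra.comul (R := k)) (Coalgebra.comul (R := k)) := by
  rintro n _ ⟨a, rfl⟩
  obtain ⟨t, h1, h2⟩ := h.comul n a
  have : ∑ p ∈ Finset.HasAntidiagonal.antidiagonal n, (TensorProduct.mapIncl _ _ (t p),
      TensorProduct.map (φ.toLinearMap ∘ₗ grClass k H p.1) (φ.toLinearMap ∘ₗ grClass k H p.2)
        (t p)) ∈ ((grFilt φ).tensor (grFilt φ)).Rel n := by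
    refine sum_mem fun p hp => ?_
    have := map_mem_tensor_rel φ p.1 p.2 (t p)
    rwa [Finset.HasAntidiagonal.mem_antidiagonal.1 hp] at this
  convert this using 1
  refine Prod.ext ?_ ?_
  · rw [Prod.fst_sum]; exact h1
  · rw [Prod.snd_sum]; exact h2

lemma grProj_mul (h : IsGrHopf φ) (x y : A) : grProj φ (x * y) = grProj φ x * grProj φ y := by
  suffices H : grProj φ ∘ₗ LinearMap.mul' k A =
      LinearMap.mul' k H ∘ₗ TensorProduct.map (grProj φ) (grProj φ) from
    LinearMap.congr_fun H (x ⊗ₜ y)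
  refine TensorProduct.ext (gr_hom_ext φ fun m a => gr_hom_ext φ fun n b => ?_)
  change grProj φ (φ (grClass k H m a) * φ (grClass k H n b)) =
    grProj φ (φ (grClass k H m a)) * grProj φ (φ (grClass k H n b))
  obtain ⟨c, hc, hc'⟩ := h.mul m n a b
  rw [hc']
  rcases Nat.eq_zero_or_pos m with rfl | hm
  · rcases Nat.eq_zero_or_pos n with rfl | hn
    · exact (grProj_zero φ c).trans (hc.trans (congrArg₂ _ (grProj_zero φ a).symm
        (grProj_zero φ b).symm))
    · rw [grProj_pos φ hn, mul_zero, grProj_pos φ (by omega)]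
  · rw [grProj_pos φ hm, zero_mul, grProj_pos φ (by omega)]

lemma grProj_one (h : IsGrHopf φ) : grProj φ (1 : A) = 1 := by
  obtain ⟨e, he, he'⟩ := h.one
  rw [← he', grProj_zero, he]

lemma counit_grProj (h : IsGrHopf φ) (x : A) :
    Coalgebra.counit (R := k) (grProj φ x) = Coalgebra.counit (R := k) x := by
  suffices H : Coalgebra.counit (R := k) ∘ₗ grProj φ = Coalgebra.counit (R := k) from
    LinearMap.congr_fun H x
  refine gr_hom_ext φ ?_
  rintro (_ | n) a
  · rw [LinearMap.comp_apply, grProj_zero, h.counit_zero]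
  · rw [LinearMap.comp_apply, grProj_succ, h.counit_succ, map_zero]

/-- In degree n > 0 every component of the coproduct has a leg of positive degree, which the
projection kills. -/
lemma comul_grProj (h : IsGrHopf φ) (x : A) : Coalgebra.comul (R := k) (grProj φ x) =
    TensorProduct.map (grProj φ) (grProj φ) (Coalgebra.comul (R := k) x) := by
  suffices H : Coalgebra.comul (R := k) ∘ₗ grProj φ =
      TensorProduct.map (grProj φ) (grProj φ) ∘ₗ Coalgebra.comul (R := k) from
    LinearMap.congr_fun H x
  refine gr_hom_ext φ fun n a => ?_
  obtain ⟨t, h1, h2⟩ := h.comul n a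
  rw [LinearMap.comp_apply, LinearMap.comp_apply, h2, map_sum]
  simp_rw [← LinearMap.comp_apply (TensorProduct.map (grProj φ) (grProj φ)),
    ← TensorProduct.map_comp, ← LinearMap.comp_assoc]
  have h0 : (grProj φ ∘ₗ φ.toLinearMap) ∘ₗ grClass k H 0 = (coradFilt k H 0).subtype :=
    LinearMap.ext fun a => grProj_zero φ a
  have hp : ∀ n, 0 < n → (grProj φ ∘ₗ φ.toLinearMap) ∘ₗ grClass k H n = 0 :=
    fun n hn => LinearMap.ext fun a => grProj_pos φ hn a
  rcases Nat.eq_zero_or_pos n with rfl | hn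
  · have h3 : Finset.HasAntidiagonal.antidiagonal 0 = {((0, 0) : ℕ × ℕ)} := by
      ext ⟨i, j⟩
      simp
    rw [grProj_zero, h1, h3, Finset.sum_singleton, Finset.sum_singleton, h0]
  · rw [grProj_pos φ hn, map_zero, eq_comm]
    refine Finset.sum_eq_zero fun p hp' => ?_
    rw [Finset.HasAntidiagonal.mem_antidiagonal] at hp'
    rcases Nat.eq_zero_or_pos p.1 with h3 | h3
    · rw [hp p.2 (by omega), TensorProduct.map_zero_right, LinearMap.zero_apply]
    · rw [hp p.1 h3, TensorProduct.map_zero_left, LinearMap.zero_apply]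

/-- The projection `gr(H) → H₀ ⊆ H` is a homomorphism of Hopf algebras. -/
def projHom (h : IsGrHopf φ) : A →ₐc[k] H :=
  BialgHom.ofAlgHom (AlgHom.ofLinearMap (grProj φ) h.grProj_one h.grProj_mul)
    (AlgHom.ext h.counit_grProj) (AlgHom.ext fun x => (h.comul_grProj x).symm)


/-- With k in degree 0, the symbol of ℛ keeps the values on H₀ ⊗ H₀ and vanishes in positive total
degree. So gr(ℛ) is the symbol of ℛ, besides being a pullback of it. -/
lemma isSymbol_form (r : H ⊗[k] H →ₗ[k] k) :
    IsSymbol ((grFilt φ).tensor (grFilt φ)) (FiltGr.unit k) r (grForm φ r) := by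
  refine isSymbol_tensor ?_
  rintro m n _ ⟨a, rfl⟩ _ ⟨b, rfl⟩
  change (r ((a : H) ⊗ₜ[k] (b : H)), r (grProj φ (φ (grClass k H m a)) ⊗ₜ[k]
    grProj φ (φ (grClass k H n b)))) ∈ _
  rcases Nat.eq_zero_or_pos m with rfl | hm
  · rcases Nat.eq_zero_or_pos n with rfl | hn
    · rw [grProj_zero, grProj_zero]
      exact mem_unit_zero.2 rfl
    · rw [grProj_pos φ hn, TensorProduct.tmul_zero, map_zero]
      obtain ⟨n, rfl⟩ : ∃ m, n = m + 1 := ⟨n - 1, by omega⟩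
      rw [← add_assoc]
      exact mem_unit_succ.2 rfl
  · rw [grProj_pos φ hm, TensorProduct.zero_tmul, map_zero]
    obtain ⟨m, rfl⟩ : ∃ n, m = n + 1 := ⟨m - 1, by omega⟩
    rw [add_right_comm]
    exact mem_unit_succ.2 rfl

lemma isSymbol_comul_tensor (h : IsGrHopf φ) : IsSymbol ((grFilt φ).tensor (grFilt φ))
    (((grFilt φ).tensor (grFilt φ)).tensor ((grFilt φ).tensor (grFilt φ)))
    (Coalgebra.comul (R := k) (A := H ⊗[k] H)) (Coalgebra.comul (R := k) (A := A ⊗[k] A)) :=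
  (isSymbol_tensorTensorTensorComm _ _ _ _).comp (h.isSymbol_comul.map h.isSymbol_comul)

/-- `gr(ℛ)` is a coquasitriangular structure. -/
theorem isCoquasitriangular (h : IsGrHopf φ) {r : H ⊗[k] H →ₗ[k] k} (hr : IsCoquasitriangular r) :
    IsCoquasitriangular (grForm φ r) := by
  -- The scalar axioms are pulled back along gr(H) → H. Braided commutativity is not, as this map
  -- need not be injective; it is obtained by comparing the symbols of its two sides in H.
  refine hr.comp h.projHom fun a b => ?_
  set X := grFilt φ
  have hL := (isSymbol_rid X).comp (((h.isSymbol_mul.comp (isSymbol_comm X X)).map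
    (isSymbol_form r)).comp h.isSymbol_comul_tensor)
  have hR := (isSymbol_lid X).comp (((isSymbol_form r).map h.isSymbol_mul).comp
    h.isSymbol_comul_tensor)
  have hLR : (TensorProduct.rid k H).toLinearMap ∘ₗ
      TensorProduct.map (LinearMap.mul' k H ∘ₗ (TensorProduct.comm k H H).toLinearMap) r ∘ₗ
      Coalgebra.comul (R := k) (A := H ⊗[k] H) = (TensorProduct.lid k H).toLinearMap ∘ₗ
      TensorProduct.map r (LinearMap.mul' k H) ∘ₗ Coalgebra.comul (R := k) (A := H ⊗[k] H) :=
    TensorProduct.ext' hr.braided_comm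
  rw [hLR] at hL
  exact LinearMap.congr_fun (hL.unique hR) (a ⊗ₜ b)

end IsGrHopf

end GrForm

/-! ### Hopf subalgebras as Hopf algebras -/

section HopfSubalgebra

open TensorProduct (map)

variable {k : Type v} [Field k] {A : Type*} [Ring A] [HopfAlgebra k A]

/-- A Hopf subalgebra: a subalgebra closed under the coproduct and the antipode. -/
structure IsHopfSubalgebra (D : Subalgebra k A) : Prop where
  comul_mem : ∀ a ∈ D, Coalgebra.comul (R := k) a ∈
    tens (Subalgebra.toSubmodule D) (Subalgebra.toSubmodule D)
  antipode_mem : ∀ a ∈ D, HopfAlgebra.antipode k a ∈ D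

namespace IsHopfSubalgebra

variable {D : Subalgebra k A} (h : IsHopfSubalgebra D)

/-- The coproduct of a Hopf subalgebra. -/
def comul : D →ₗ[k] D ⊗[k] D :=
  (LinearEquiv.ofInjective (map D.val.toLinearMap D.val.toLinearMap)
    (map_injective_of_injective Subtype.val_injective Subtype.val_injective)).symm.toLinearMap ∘ₗ
  (Coalgebra.comul (R := k) ∘ₗ D.val.toLinearMap).codRestrict _ fun a => h.comul_mem a a.2

lemma map_comul : map D.val.toLinearMap D.val.toLinearMap ∘ₗ h.comul =
    Coalgebra.comul (R := k) ∘ₗ D.val.toLinearMap := by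
  refine LinearMap.ext fun a => ?_
  have hinj : Function.Injective (map D.val.toLinearMap D.val.toLinearMap) :=
    map_injective_of_injective Subtype.val_injective Subtype.val_injective
  have := (LinearEquiv.ofInjective _ hinj).apply_symm_apply
    ((Coalgebra.comul (R := k) ∘ₗ D.val.toLinearMap).codRestrict
      (LinearMap.range (map D.val.toLinearMap D.val.toLinearMap)) (fun a => h.comul_mem a a.2) a)
  exact congrArg Subtype.val this

/-- The counit of a Hopf subalgebra. -/
def counit (_ : IsHopfSubalgebra D) : D →ₗ[k] k := Coalgebra.counit (R := k) ∘ₗ D.val.toLinearMap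

/-- The antipode of a Hopf subalgebra. -/
def antipode : D →ₗ[k] D :=
  (HopfAlgebra.antipode k ∘ₗ D.val.toLinearMap).codRestrict (Subalgebra.toSubmodule D)
    fun a => h.antipode_mem a a.2

/-- The coalgebra structure of a Hopf subalgebra. -/
abbrev coalgebra : Coalgebra k D where
  comul := h.comul
  counit := h.counit
  coassoc := by
    set i := D.val.toLinearMap with hi
    have hinj : Function.Injective i := Subtype.val_injective
    -- Over a field the inclusion stays injective on tensor powers, so the coalgebra axioms may be
    -- checked inside those of A.
    refine (LinearMap.cancel_left (map_injective_of_injective hinj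
      (map_injective_of_injective hinj hinj))).1 ?_
    have h1 : map i (map i i) ∘ₗ (TensorProduct.assoc k D D D).toLinearMap =
        (TensorProduct.assoc k A A A).toLinearMap ∘ₗ map (map i i) i := by
      ext; rfl
    have h2 : map (map i i) i ∘ₗ h.comul.rTensor D =
        (Coalgebra.comul (R := k) (A := A)).rTensor A ∘ₗ map i i := by
      rw [LinearMap.rTensor, LinearMap.rTensor, ← TensorProduct.map_comp, ← TensorProduct.map_comp,
        h.map_comul]
      rfl
    have h3 : map i (map i i) ∘ₗ h.comul.lTensor D =
        (Coalgebra.comul (R := k) (A := A)).lTensor A ∘ₗ map i i := by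
      rw [LinearMap.lTensor, LinearMap.lTensor, ← TensorProduct.map_comp, ← TensorProduct.map_comp,
        h.map_comul]
      rfl
    rw [← LinearMap.comp_assoc, h1, LinearMap.comp_assoc, ← LinearMap.comp_assoc h.comul (h.comul.rTensor D),
      h2, ← LinearMap.comp_assoc h.comul (h.comul.lTensor D), h3, LinearMap.comp_assoc, h.map_comul,
      LinearMap.comp_assoc, h.map_comul, ← hi,
      ← LinearMap.comp_assoc i, ← LinearMap.comp_assoc i, ← LinearMap.comp_assoc i,
      Coalgebra.coassoc, LinearMap.comp_assoc]
  rTensor_counit_comp_comul := by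
    set i := D.val.toLinearMap with hi
    have hinj : Function.Injective i := Subtype.val_injective
    refine (LinearMap.cancel_left (f := i.lTensor k)
      (map_injective_of_injective Function.injective_id hinj)).1 ?_
    have h2 : i.lTensor k ∘ₗ h.counit.rTensor D =
        (Coalgebra.counit (R := k) (A := A)).rTensor A ∘ₗ map i i := by
      rw [LinearMap.rTensor, LinearMap.lTensor, LinearMap.rTensor, ← TensorProduct.map_comp,
        ← TensorProduct.map_comp]
      rfl
    rw [← LinearMap.comp_assoc, h2, LinearMap.comp_assoc, h.map_comul, ← hi,
      ← LinearMap.comp_assoc i, Coalgebra.rTensor_counit_comp_comul]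
    rfl
  lTensor_counit_comp_comul := by
    set i := D.val.toLinearMap with hi
    have hinj : Function.Injective i := Subtype.val_injective
    refine (LinearMap.cancel_left (f := i.rTensor k)
      (map_injective_of_injective hinj Function.injective_id)).1 ?_
    have h2 : i.rTensor k ∘ₗ h.counit.lTensor D =
        (Coalgebra.counit (R := k) (A := A)).lTensor A ∘ₗ map i i := by
      rw [LinearMap.rTensor, LinearMap.lTensor, LinearMap.lTensor, ← TensorProduct.map_comp,
        ← TensorProduct.map_comp]
      rfl
    rw [← LinearMap.comp_assoc, h2, LinearMap.comp_assoc, h.map_comul, ← hi,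
      ← LinearMap.comp_assoc i, Coalgebra.lTensor_counit_comp_comul]
    rfl

lemma map_comul_apply (a : D) : Algebra.TensorProduct.map D.val D.val (h.comul a) =
    Coalgebra.comul (R := k) (a : A) := LinearMap.congr_fun h.map_comul a

/-- The bialgebra structure of a Hopf subalgebra. -/
abbrev bialgebra : Bialgebra k D :=
  letI := h.coalgebra
  Bialgebra.mk' k D (Bialgebra.counit_one (R := k) (A := A))
    (fun {a b} => Bialgebra.counit_mul (R := k) (a : A) b)
    (map_injective_of_injective (f := D.val.toLinearMap) (g := D.val.toLinearMap)
      Subtype.val_injective Subtype.val_injective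
      ((h.map_comul_apply 1).trans ((Bialgebra.comul_one (R := k) (A := A)).trans
        (map_one (Algebra.TensorProduct.map D.val D.val)).symm)))
    (fun {a b} => map_injective_of_injective (f := D.val.toLinearMap) (g := D.val.toLinearMap)
      Subtype.val_injective Subtype.val_injective
      ((h.map_comul_apply (a * b)).trans ((Bialgebra.comul_mul (R := k) (a : A) b).trans
        ((congrArg₂ (· * ·) (h.map_comul_apply a).symm (h.map_comul_apply b).symm).trans
        (map_mul (Algebra.TensorProduct.map D.val D.val) _ _).symm))))

/-- The Hopf algebra structure of a Hopf subalgebra. -/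
abbrev hopfAlgebra : HopfAlgebra k D :=
  letI := h.bialgebra
  { h.bialgebra with
    antipode := h.antipode
    mul_antipode_rTensor_comul := by
      set i := D.val.toLinearMap with hi
      refine (LinearMap.cancel_left (f := i) Subtype.val_injective).1 ?_
      have h1 : i ∘ₗ LinearMap.mul' k D = LinearMap.mul' k A ∘ₗ map i i := by ext; rfl
      have h2 : map i i ∘ₗ h.antipode.rTensor D =
          (HopfAlgebra.antipode k (A := A)).rTensor A ∘ₗ map i i := by
        rw [LinearMap.rTensor, LinearMap.rTensor, ← TensorProduct.map_comp,
          ← TensorProduct.map_comp]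
        rfl
      change i ∘ₗ LinearMap.mul' k D ∘ₗ h.antipode.rTensor D ∘ₗ h.comul =
        i ∘ₗ Algebra.linearMap k D ∘ₗ h.counit
      rw [← LinearMap.comp_assoc, h1, LinearMap.comp_assoc, ← LinearMap.comp_assoc h.comul (h.antipode.rTensor D), h2,
        LinearMap.comp_assoc, h.map_comul, ← hi, ← LinearMap.comp_assoc i,
        ← LinearMap.comp_assoc i, HopfAlgebra.mul_antipode_rTensor_comul]
      rfl
    mul_antipode_lTensor_comul := by
      set i := D.val.toLinearMap with hi
      refine (LinearMap.cancel_left (f := i) Subtype.val_injective).1 ?_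
      have h1 : i ∘ₗ LinearMap.mul' k D = LinearMap.mul' k A ∘ₗ map i i := by ext; rfl
      have h2 : map i i ∘ₗ h.antipode.lTensor D =
          (HopfAlgebra.antipode k (A := A)).lTensor A ∘ₗ map i i := by
        rw [LinearMap.lTensor, LinearMap.lTensor, ← TensorProduct.map_comp,
          ← TensorProduct.map_comp]
        rfl
      change i ∘ₗ LinearMap.mul' k D ∘ₗ h.antipode.lTensor D ∘ₗ h.comul =
        i ∘ₗ Algebra.linearMap k D ∘ₗ h.counit
      rw [← LinearMap.comp_assoc, h1, LinearMap.comp_assoc, ← LinearMap.comp_assoc h.comul (h.antipode.lTensor D), h2,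
        LinearMap.comp_assoc, h.map_comul, ← hi, ← LinearMap.comp_assoc i,
        ← LinearMap.comp_assoc i, HopfAlgebra.mul_antipode_lTensor_comul]
      rfl }

/-- A Hopf subalgebra is the image of an injective homomorphism of Hopf algebras. -/
lemma exists_bialgHom {A : Type u} [Ring A] [HopfAlgebra k A] {D : Subalgebra k A}
    (h : IsHopfSubalgebra D) : ∃ (B : Type u) (_ : Ring B) (_ : HopfAlgebra k B) (i : B →ₐc[k] A),
    Function.Injective i ∧ LinearMap.range (i : B →ₗ[k] A) = Subalgebra.toSubmodule D := by
  let _ := h.hopfAlgebra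
  refine ⟨D, inferInstance, h.hopfAlgebra, BialgHom.ofAlgHom D.val (AlgHom.ext fun a => rfl)
    (AlgHom.ext fun a => h.map_comul_apply a), Subtype.val_injective, ?_⟩
  ext a
  exact ⟨by rintro ⟨b, rfl⟩; exact b.2, fun ha => ⟨⟨a, ha⟩, rfl⟩⟩

end IsHopfSubalgebra

end HopfSubalgebra

/-! ### Coinvariants of a Hopf algebra homomorphism -/

section Coinvariants

open TensorProduct (map)
open WithConv

variable {k : Type v} [Field k] {A B : Type*} [Ring A] [HopfAlgebra k A] [Ring B] [HopfAlgebra k B]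

/-- Antipode after `F` and `F` after antipode are a left and a right convolution inverse of `F`. -/
lemma bialgHom_antipode (F : A →ₐc[k] B) (a : A) :
    F (HopfAlgebra.antipode k a) = HopfAlgebra.antipode k (F a) := by
  have hl : toConv (HopfAlgebra.antipode k ∘ₗ (F : A →ₗ[k] B)) * toConv (F : A →ₗ[k] B) = 1 := by
    have h := LinearMap.convMul_comp_coalgHom_distrib (toConv (HopfAlgebra.antipode k (A := B)))
      (toConv LinearMap.id) (F : A →ₗc[k] B)
    rw [LinearMap.antipode_mul_id] at h
    apply WithConv.ofConv_injective
    refine Eq.trans h.symm (LinearMap.ext fun a => ?_)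
    exact congrArg (algebraMap k B) (CoalgHomClass.counit_comp_apply F a)
  have hr : toConv (F : A →ₗ[k] B) * toConv ((F : A →ₗ[k] B) ∘ₗ HopfAlgebra.antipode k) = 1 := by
    have h := LinearMap.algHom_comp_convMul_distrib (F : A →ₐ[k] B) (toConv LinearMap.id)
      (toConv (HopfAlgebra.antipode k (A := A)))
    rw [LinearMap.id_mul_antipode] at h
    apply WithConv.ofConv_injective
    refine Eq.trans h.symm (LinearMap.ext fun a => ?_)
    exact AlgHomClass.commutes F _
  exact (LinearMap.congr_fun (congrArg WithConv.ofConv (left_inv_eq_right_inv hl hr)) a).symm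

/-- The right coaction of `B` on `A` along a homomorphism `A → B`. -/
def coact (π : A →ₐc[k] B) : A →ₐ[k] A ⊗[k] B :=
  (Algebra.TensorProduct.map (AlgHom.id k A) (π : A →ₐ[k] B)).comp (Bialgebra.comulAlgHom k A)

lemma coact_apply (π : A →ₐc[k] B) (a : A) :
    coact π a = map LinearMap.id (π : A →ₗ[k] B) (Coalgebra.comul (R := k) a) := rfl

/-- The coinvariants of the right coaction. -/
def coinv (π : A →ₐc[k] B) : Subalgebra k A :=
  AlgHom.equalizer (coact π) Algebra.TensorProduct.includeLeft

lemma mem_coinv {π : A →ₐc[k] B} {a : A} : a ∈ coinv π ↔ coact π a = a ⊗ₜ 1 := Iff.rfl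

lemma map_coact_comul (π : A →ₐc[k] B) (a : A) :
    map LinearMap.id (coact π).toLinearMap (Coalgebra.comul (R := k) a) =
      TensorProduct.assoc k A A B (map Coalgebra.comul LinearMap.id (coact π a)) := by
  have h1 : (coact π).toLinearMap = map LinearMap.id (π : A →ₗ[k] B) ∘ₗ Coalgebra.comul :=
    rfl
  have h2 := congrArg (map LinearMap.id (map LinearMap.id (π : A →ₗ[k] B)))
    (Coalgebra.coassoc_apply (R := k) a)
  rw [TensorProduct.map_map_assoc, LinearMap.rTensor, LinearMap.lTensor,
    TensorProduct.map_map, TensorProduct.map_map] at h2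
  rw [h1, coact_apply, TensorProduct.map_map]
  simp only [TensorProduct.map_id, LinearMap.comp_id, LinearMap.id_comp] at h2 ⊢
  exact h2.symm

lemma counit_coact (π : A →ₐc[k] B) (a : A) :
    TensorProduct.rid k A (map LinearMap.id Coalgebra.counit (coact π a)) = a := by
  rw [coact_apply, ← LinearMap.comp_apply (map _ _), ← TensorProduct.map_comp]
  have : Coalgebra.counit (R := k) ∘ₗ (π : A →ₗ[k] B) = Coalgebra.counit :=
    CoalgHomClass.counit_comp π
  rw [this, LinearMap.comp_id]
  have := Coalgebra.lTensor_counit_comul (R := k) a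
  rw [LinearMap.lTensor] at this
  rw [this, TensorProduct.rid_tmul, one_smul]

lemma coinv_toSubmodule (π : A →ₐc[k] B) : Subalgebra.toSubmodule (coinv π) =
    LinearMap.ker ((coact π).toLinearMap -
      (Algebra.TensorProduct.includeLeft : A →ₐ[k] A ⊗[k] B).toLinearMap) := by
  ext a
  rw [LinearMap.mem_ker, LinearMap.sub_apply, sub_eq_zero]
  rfl

lemma tensorMap_sub_left {V W V' W' : Type*} [AddCommGroup V] [Module k V] [AddCommGroup W]
    [Module k W] [AddCommGroup V'] [Module k V'] [AddCommGroup W'] [Module k W']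
    (f g : V →ₗ[k] V') (h : W →ₗ[k] W') : map (f - g) h = map f h - map g h := by
  ext; simp [TensorProduct.sub_tmul]

lemma tensorMap_sub_right {V W V' W' : Type*} [AddCommGroup V] [Module k V] [AddCommGroup W]
    [Module k W] [AddCommGroup V'] [Module k V'] [AddCommGroup W'] [Module k W']
    (f : V →ₗ[k] V') (g h : W →ₗ[k] W') : map f (g - h) = map f g - map f h := by
  ext; simp [TensorProduct.tmul_sub]

lemma mem_tens_top_ker {V W U : Type*} [AddCommGroup V] [Module k V] [AddCommGroup W] [Module k W]
    [AddCommGroup U] [Module k U] {f : W →ₗ[k] U} {t : V ⊗[k] W} :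
    t ∈ tens ⊤ (LinearMap.ker f) ↔ map LinearMap.id f t = 0 := by
  rw [← LinearMap.mem_ker, ker_tensorMap, LinearMap.ker_id, tens_bot_left, bot_sup_eq]

lemma mem_tens_ker_top {V W U : Type*} [AddCommGroup V] [Module k V] [AddCommGroup W] [Module k W]
    [AddCommGroup U] [Module k U] {f : V →ₗ[k] U} {t : V ⊗[k] W} :
    t ∈ tens (LinearMap.ker f) ⊤ ↔ map f LinearMap.id t = 0 := by
  rw [← LinearMap.mem_ker, ker_tensorMap, LinearMap.ker_id, tens_bot_right, sup_bot_eq]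

/-- If the left and right coactions agree then the coinvariants are a Hopf subalgebra. -/
lemma isHopfSubalgebra_coinv (π : A →ₐc[k] B)
    (hπ : ∀ a : A, coact π a =
      TensorProduct.comm k B A (map (π : A →ₗ[k] B) LinearMap.id (Coalgebra.comul (R := k) a))) :
    IsHopfSubalgebra (coinv π) where
  comul_mem a ha := by
    -- The coproduct is colinear for the coaction on the second leg, which is therefore coinvariant
    -- whenever a is.
    have h1 : map LinearMap.id (coact π).toLinearMap (Coalgebra.comul (R := k) a) =
        map LinearMap.id (Algebra.TensorProduct.includeLeft : A →ₐ[k] A ⊗[k] B).toLinearMap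
          (Coalgebra.comul (R := k) a) := by
      rw [map_coact_comul, mem_coinv.1 ha, TensorProduct.map_tmul]
      generalize Coalgebra.comul (R := k) a = t
      induction t with
      | zero => simp
      | add x y hx hy => simp only [map_add, TensorProduct.add_tmul, hx, hy]
      | tmul x y => rfl
    rw [coinv_toSubmodule]
    refine tens_inf ?_ ?_
    · rw [mem_tens_ker_top, tensorMap_sub_left, LinearMap.sub_apply, sub_eq_zero]
      -- For the first leg, consider a₁ ⊗ π(a₂) ⊗ a₃. Its last two factors are the left coaction,
      -- which by `hπ` is the flipped right coaction on the second leg, and `h1` applies.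
      have h2 : (coact π).toLinearMap = map LinearMap.id (π : A →ₗ[k] B) ∘ₗ Coalgebra.comul :=
        rfl
      have h3 : map (π : A →ₗ[k] B) LinearMap.id ∘ₗ Coalgebra.comul (R := k) =
          (TensorProduct.comm k A B).toLinearMap ∘ₗ (coact π).toLinearMap := by
        refine LinearMap.ext fun a => ?_
        change _ = TensorProduct.comm k A B (coact π a)
        rw [hπ]
        exact ((TensorProduct.comm k A B).apply_symm_apply _).symm
      have h4 := congrArg (map (map LinearMap.id (π : A →ₗ[k] B)) LinearMap.id)
        (Coalgebra.coassoc_symm_apply (R := k) a)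
      rw [TensorProduct.map_map_assoc_symm, LinearMap.rTensor, LinearMap.lTensor,
        TensorProduct.map_map, TensorProduct.map_map, ← h2, h3,
        TensorProduct.map_comp, LinearMap.comp_apply, LinearMap.comp_id, h1] at h4
      rw [← h4]
      generalize Coalgebra.comul (R := k) a = t
      induction t with
      | zero => simp
      | add x y hx hy => simp only [map_add, hx, hy]
      | tmul x y => rfl
    · rw [mem_tens_top_ker, tensorMap_sub_right, LinearMap.sub_apply, sub_eq_zero, h1]
  antipode_mem a ha := by
    rw [mem_coinv, coact_apply, comul_antipode]
    have h1 : coact π a = map LinearMap.id (π : A →ₗ[k] B)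
        (TensorProduct.comm k A A (Coalgebra.comul (R := k) a)) := by
      rw [hπ]
      generalize Coalgebra.comul (R := k) a = t
      induction t with
      | zero => simp
      | add x y hx hy => simp only [map_add, hx, hy]
      | tmul x y => rfl
    have h2 : map LinearMap.id (π : A →ₗ[k] B) ∘ₗ
        map (HopfAlgebra.antipode k (A := A)) (HopfAlgebra.antipode k) =
        map (HopfAlgebra.antipode k) (HopfAlgebra.antipode k) ∘ₗ
          map LinearMap.id (π : A →ₗ[k] B) := by
      ext x y
      exact congrArg (HopfAlgebra.antipode k x ⊗ₜ[k] ·) (bialgHom_antipode π y)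
    rw [← LinearMap.comp_apply, h2, LinearMap.comp_apply, ← h1, mem_coinv.1 ha,
      TensorProduct.map_tmul, HopfAlgebra.antipode_one]

end Coinvariants

/-! ### Crossed products from group-like sections -/

section CrossedProduct

open TensorProduct (map)
open MonoidAlgebra (single)

variable {k : Type v} [Field k] {A : Type u} [Ring A] [HopfAlgebra k A]
  {D : Type u} [Ring D] [HopfAlgebra k D] {Γ : Type u}

lemma map_coact_coact {B : Type*} [Ring B] [HopfAlgebra k B] (π : A →ₐc[k] B) (a : A) :
    map (coact π).toLinearMap LinearMap.id (coact π a) =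
      (TensorProduct.assoc k A B B).symm (map LinearMap.id Coalgebra.comul (coact π a)) := by
  have h1 : (coact π).toLinearMap = map LinearMap.id (π : A →ₗ[k] B) ∘ₗ Coalgebra.comul :=
    rfl
  have h2 := congrArg (map (map LinearMap.id (π : A →ₗ[k] B)) (π : A →ₗ[k] B))
    (Coalgebra.coassoc_symm_apply (R := k) a)
  have h3 : map (π : A →ₗ[k] B) (π : A →ₗ[k] B) ∘ₗ Coalgebra.comul =
    Coalgebra.comul ∘ₗ (π : A →ₗ[k] B) := CoalgHomClass.map_comp_comul π
  rw [TensorProduct.map_map_assoc_symm, LinearMap.rTensor, LinearMap.lTensor,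
    TensorProduct.map_map, TensorProduct.map_map, h3] at h2
  rw [h1, coact_apply, TensorProduct.map_map, TensorProduct.map_map]
  simp only [LinearMap.comp_id, LinearMap.id_comp] at h2 ⊢
  exact h2.symm

/-- The linear map on a group algebra with prescribed values on the group. -/
def groupLift {M : Type*} [AddCommGroup M] [Module k M] (w : Γ → M) : MonoidAlgebra k Γ →ₗ[k] M :=
  Finsupp.linearCombination k w ∘ₗ (MonoidAlgebra.coeffLinearEquiv k).toLinearMap

@[simp] lemma groupLift_single {M : Type*} [AddCommGroup M] [Module k M] (w : Γ → M) (x : Γ)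
    (c : k) : groupLift w (single x c) = c • w x :=
  Finsupp.linearCombination_single k c x

lemma comul_single_one (x : Γ) : Coalgebra.comul (R := k) (single x (1 : k)) =
    single x (1 : k) ⊗ₜ[k] single x (1 : k) :=
  (MonoidAlgebra.isGroupLikeElem_single_one (R := k) (A := k) x).comul_eq_tmul_self

lemma tensor_group_ext {V M : Type*} [AddCommGroup V] [Module k V] [AddCommGroup M] [Module k M]
    {f g : V ⊗[k] MonoidAlgebra k Γ →ₗ[k] M}
    (h : ∀ v x, f (v ⊗ₜ single x 1) = g (v ⊗ₜ single x 1)) : f = g := by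
  refine TensorProduct.ext (LinearMap.ext fun v => MonoidAlgebra.lhom_ext' fun x => ?_)
  exact LinearMap.ext_ring (h v x)

/-- The map `b ⊗ x ↦ b w(x) ⊗ x`. -/
def groupTwist {B : Type*} [Ring B] [Algebra k B] (w : Γ → B) :
    B ⊗[k] MonoidAlgebra k Γ →ₗ[k] B ⊗[k] MonoidAlgebra k Γ :=
  map (LinearMap.mul' k B) LinearMap.id ∘ₗ (TensorProduct.assoc k B B _).symm.toLinearMap ∘ₗ
    map LinearMap.id (map (groupLift w) LinearMap.id ∘ₗ Coalgebra.comul (R := k))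

lemma groupTwist_tmul {B : Type*} [Ring B] [Algebra k B] (w : Γ → B) (b : B) (x : Γ) :
    groupTwist w (b ⊗ₜ[k] single x (1 : k)) = (b * w x) ⊗ₜ single x 1 := by
  simp [groupTwist]

lemma map_groupTwist {B C : Type*} [Ring B] [Algebra k B] [Ring C] [Algebra k C] (f : B →ₐ[k] C)
    (w : Γ → B) (t : B ⊗[k] MonoidAlgebra k Γ) :
    map f.toLinearMap LinearMap.id (groupTwist w t) =
      groupTwist (fun x => f (w x)) (map f.toLinearMap LinearMap.id t) := by
  refine LinearMap.congr_fun (f := map f.toLinearMap LinearMap.id ∘ₗ groupTwist w)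
    (g := groupTwist (fun x => f (w x)) ∘ₗ map f.toLinearMap LinearMap.id)
    (tensor_group_ext fun b x => ?_) t
  simp [groupTwist_tmul]

variable [Group Γ]

/-- Group-like elements of `A` lifting the elements of `Γ` along `π`. -/
structure GroupSection (π : A →ₐc[k] MonoidAlgebra k Γ) where
  u : Γ → Aˣ
  u_one : u 1 = 1
  groupLike : ∀ x, IsGroupLikeElem k (u x : A)
  proj : ∀ x, π (u x) = single x 1

namespace GroupSection

variable {π : A →ₐc[k] MonoidAlgebra k Γ} (s : GroupSection π)

lemma coact_u (x : Γ) : coact π (s.u x) = (s.u x : A) ⊗ₜ single x 1 := by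
  rw [coact_apply, (s.groupLike x).comul_eq_tmul_self, TensorProduct.map_tmul]
  exact congrArg _ (s.proj x)

lemma coact_u_inv (x : Γ) :
    coact π (↑(s.u x)⁻¹ : A) = (↑(s.u x)⁻¹ : A) ⊗ₜ single x⁻¹ 1 := by
  have h1 : coact π (↑(s.u x)⁻¹ : A) * coact π (s.u x) = 1 := by
    rw [← map_mul, Units.inv_mul, map_one]
  have h2 : coact π (s.u x) * ((↑(s.u x)⁻¹ : A) ⊗ₜ[k] single x⁻¹ (1 : k)) = 1 := by
    rw [s.coact_u, Algebra.TensorProduct.tmul_mul_tmul, Units.mul_inv,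
      MonoidAlgebra.single_mul_single]
    simp [Algebra.TensorProduct.one_def, MonoidAlgebra.one_def]
  exact left_inv_eq_right_inv h1 h2

/-- A coaction of k[Γ] is a Γ-grading, with the coinvariants in degree 1 and u(x) in degree x.
Conjugates u(x) a u(x)⁻¹, and likewise u(x)u(y)u(xy)⁻¹ below, stay in degree 1. -/
lemma conj_mem (x : Γ) {a : A} (ha : a ∈ coinv π) :
    (s.u x : A) * a * (↑(s.u x)⁻¹ : A) ∈ coinv π := by
  rw [mem_coinv] at ha ⊢
  rw [map_mul, map_mul, ha, s.coact_u, s.coact_u_inv, Algebra.TensorProduct.tmul_mul_tmul,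
    Algebra.TensorProduct.tmul_mul_tmul, mul_one, MonoidAlgebra.single_mul_single]
  simp [MonoidAlgebra.one_def]

lemma cocycle_mem (x y : Γ) :
    ((s.u x * s.u y * (s.u (x * y))⁻¹ : Aˣ) : A) ∈ coinv π := by
  rw [mem_coinv, Units.val_mul, Units.val_mul, map_mul, map_mul, s.coact_u, s.coact_u,
    s.coact_u_inv, Algebra.TensorProduct.tmul_mul_tmul,
    Algebra.TensorProduct.tmul_mul_tmul, MonoidAlgebra.single_mul_single,
    MonoidAlgebra.single_mul_single]
  simp [MonoidAlgebra.one_def]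

lemma cocycle_inv_mem (x y : Γ) :
    (((s.u x * s.u y * (s.u (x * y))⁻¹)⁻¹ : Aˣ) : A) ∈ coinv π := by
  have h1 := mem_coinv.1 (s.cocycle_mem x y)
  rw [mem_coinv]
  generalize s.u x * s.u y * (s.u (x * y))⁻¹ = v at h1
  have h2 : coact π (↑v⁻¹ : A) * coact π (v : A) = 1 := by
    rw [← map_mul, Units.inv_mul, map_one]
  have h3 : coact π (v : A) * ((↑v⁻¹ : A) ⊗ₜ[k] 1) = 1 := by
    rw [h1, Algebra.TensorProduct.tmul_mul_tmul, Units.mul_inv, mul_one]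
    rfl
  exact left_inv_eq_right_inv h2 h3

/-- The coinvariants carry a crossed system. -/
lemma exists_crossedSystem (i : D →ₐc[k] A) (hi : Function.Injective i)
    (hD : ∀ a, (∃ d, i d = a) ↔ a ∈ coinv π) :
    ∃ S : CrossedSystem k D Γ, (∀ x d, i (S.act x d) = (s.u x : A) * i d * (↑(s.u x)⁻¹ : A)) ∧
      ∀ x y, i (S.cocycle x y : D) = ((s.u x * s.u y * (s.u (x * y))⁻¹ : Aˣ) : A) := by
  have h1 : ∀ x : Γ, ∃ f : D →ₐ[k] D, ∀ d, i (f d) = (s.u x : A) * i d * (↑(s.u x)⁻¹ : A) := by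
    intro x
    have : ∀ d, ∃ d', i d' = (s.u x : A) * i d * (↑(s.u x)⁻¹ : A) := fun d =>
      (hD _).2 (s.conj_mem x ((hD _).1 ⟨d, rfl⟩))
    choose f hf using this
    refine ⟨AlgHom.ofLinearMap ⟨⟨f, fun a b => hi ?_⟩, fun c a => hi ?_⟩ (hi ?_) fun a b => hi ?_,
      hf⟩
    · rw [map_add, hf, hf, hf, map_add, mul_add, add_mul]
    · rw [RingHom.id_apply, map_smul, hf, hf, map_smul, mul_smul_comm, smul_mul_assoc]
    · change i (f 1) = i 1
      rw [hf, map_one, mul_one, Units.mul_inv]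
    · change i (f (a * b)) = i (f a * f b)
      rw [map_mul, hf, hf, hf, map_mul]
      simp [mul_assoc]
  have h2 : ∀ x y : Γ, ∃ w : Dˣ, i (w : D) = ((s.u x * s.u y * (s.u (x * y))⁻¹ : Aˣ) : A) ∧
      i (↑w⁻¹ : D) = (((s.u x * s.u y * (s.u (x * y))⁻¹)⁻¹ : Aˣ) : A) := by
    intro x y
    obtain ⟨a, ha⟩ := (hD _).2 (s.cocycle_mem x y)
    obtain ⟨b, hb⟩ := (hD _).2 (s.cocycle_inv_mem x y)
    refine ⟨⟨a, b, hi ?_, hi ?_⟩, ha, hb⟩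
    · rw [map_mul, ha, hb, Units.mul_inv, map_one]
    · rw [map_mul, ha, hb, Units.inv_mul, map_one]
  choose act hact using h1
  choose σ hσ hσ' using h2
  -- After applying the injection `i`, the axioms of a crossed system become identities between
  -- products of the units u(x) in A.
  refine ⟨⟨act, σ, fun a => hi ?_, fun x y a => hi ?_, fun x => Units.ext (hi ?_),
    fun x => Units.ext (hi ?_), fun x y z => hi ?_⟩, hact, hσ⟩
  · rw [hact, s.u_one]; simp
  · rw [hact, hact, map_mul, map_mul, hσ, hσ', hact]
    simp [mul_assoc]
  · rw [hσ, s.u_one]; simp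
  · rw [hσ, s.u_one]; simp
  · rw [map_mul, map_mul, hact, hσ, hσ, hσ, hσ]
    simp [mul_assoc]

/-- The elements of `Γ`, lifted to `A`, as a homomorphism of coalgebras. -/
def lift : MonoidAlgebra k Γ →ₗc[k] A where
  toLinearMap := groupLift fun x => (s.u x : A)
  counit_comp := MonoidAlgebra.lhom_ext' fun x => LinearMap.ext_ring <| by
    simp [(s.groupLike x).counit_eq_one]
  map_comp_comul := MonoidAlgebra.lhom_ext' fun x => LinearMap.ext_ring <| by
    simp [(s.groupLike x).comul_eq_tmul_self]

@[simp] lemma lift_single (x : Γ) : s.lift (single x 1) = s.u x :=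
  (groupLift_single _ _ _).trans (one_smul _ _)

/-- The map `d ⊗ x ↦ d u(x)`. -/
def mulMap (i : D →ₐc[k] A) : D ⊗[k] MonoidAlgebra k Γ →ₗc[k] A :=
  (Bialgebra.mulCoalgHom k A).comp (Coalgebra.TensorProduct.map (i : D →ₗc[k] A) s.lift)

lemma mulMap_tmul (i : D →ₐc[k] A) (d : D) (x : Γ) :
    s.mulMap i (d ⊗ₜ single x 1) = i d * s.u x :=
  congrArg (i d * ·) (s.lift_single x)

/-- The candidate inverse of d ⊗ x ↦ d u(x) sends an element a of degree x to a u(x)⁻¹ ⊗ x. This is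
the easy composite, seen through `i`. -/
lemma groupTwist_coact_mulMap (i : D →ₐc[k] A) (hD : ∀ a, (∃ d, i d = a) ↔ a ∈ coinv π)
    (t : D ⊗[k] MonoidAlgebra k Γ) :
    groupTwist (fun x => (↑(s.u x)⁻¹ : A)) (coact π (s.mulMap i t)) =
      map (i : D →ₗ[k] A) LinearMap.id t := by
  refine LinearMap.congr_fun (f := groupTwist (fun x => (↑(s.u x)⁻¹ : A)) ∘ₗ
    (coact π).toLinearMap ∘ₗ (s.mulMap i).toLinearMap) (tensor_group_ext fun d x => ?_) t
  change groupTwist (fun x => (↑(s.u x)⁻¹ : A)) (coact π (s.mulMap i (d ⊗ₜ single x 1))) = _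
  rw [s.mulMap_tmul, map_mul, mem_coinv.1 ((hD _).1 ⟨d, rfl⟩), s.coact_u,
    Algebra.TensorProduct.tmul_mul_tmul, one_mul, groupTwist_tmul, Units.mul_inv_cancel_right]
  rfl

lemma mulMap_bijective (i : D →ₐc[k] A) (hi : Function.Injective i)
    (hD : ∀ a, (∃ d, i d = a) ↔ a ∈ coinv π) : Function.Bijective (s.mulMap i) := by
  constructor
  · intro t t' h
    refine map_injective_of_injective (f := (i : D →ₗ[k] A))
      (g := (LinearMap.id : MonoidAlgebra k Γ →ₗ[k] _)) hi Function.injective_id ?_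
    rw [← s.groupTwist_coact_mulMap i hD, ← s.groupTwist_coact_mulMap i hD, h]
  · intro a
    set Θ : A ⊗[k] MonoidAlgebra k Γ →ₗ[k] A ⊗[k] MonoidAlgebra k Γ :=
      groupTwist (fun x => (↑(s.u x)⁻¹ : A)) with hΘ
    -- A component of degree x becomes one of degree x x⁻¹ = 1 after multiplication by u(x)⁻¹, so
    -- the first leg is coinvariant.
    have h1 : Θ (coact π a) ∈ tens (Subalgebra.toSubmodule (coinv π)) ⊤ := by
      rw [coinv_toSubmodule, mem_tens_ker_top, tensorMap_sub_left, LinearMap.sub_apply, sub_eq_zero,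
        hΘ, map_groupTwist, map_coact_coact]
      refine LinearMap.congr_fun (f := groupTwist (fun x => coact π (↑(s.u x)⁻¹ : A)) ∘ₗ
        (TensorProduct.assoc k A _ _).symm.toLinearMap ∘ₗ map LinearMap.id Coalgebra.comul)
        (g := map (Algebra.TensorProduct.includeLeft :
          A →ₐ[k] A ⊗[k] MonoidAlgebra k Γ).toLinearMap LinearMap.id ∘ₗ Θ)
        (tensor_group_ext fun b x => ?_) (coact π a)
      simp only [LinearMap.comp_apply, TensorProduct.map_tmul, LinearMap.id_apply,
        comul_single_one, LinearEquiv.coe_coe, TensorProduct.assoc_symm_tmul, groupTwist_tmul, hΘ,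
        s.coact_u_inv, Algebra.TensorProduct.tmul_mul_tmul, MonoidAlgebra.single_mul_single,
        mul_inv_cancel, mul_one, AlgHom.toLinearMap_apply,
        Algebra.TensorProduct.includeLeft_apply]
      rfl
    have h2 : tens (Subalgebra.toSubmodule (coinv π)) ⊤ ≤
        LinearMap.range (map (i : D →ₗ[k] A) (LinearMap.id : MonoidAlgebra k Γ →ₗ[k] _)) := by
      rw [tens_le]
      intro x hx y _
      obtain ⟨d, rfl⟩ := (hD x).2 hx
      exact ⟨d ⊗ₜ y, rfl⟩
    obtain ⟨t, ht⟩ := h2 h1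
    refine ⟨t, ?_⟩
    have h3 : s.mulMap i t = LinearMap.mul' k A (map LinearMap.id s.lift.toLinearMap
        (map (i : D →ₗ[k] A) LinearMap.id t)) := by
      rw [TensorProduct.map_map]
      rfl
    -- Multiplying back, u(x)⁻¹u(x) = 1 cancels, and the counit of the coaction returns a.
    have h4 : ∀ c, LinearMap.mul' k A (map LinearMap.id s.lift.toLinearMap (Θ c)) =
        TensorProduct.rid k A (map LinearMap.id Coalgebra.counit c) := by
      intro c
      refine LinearMap.congr_fun (f := LinearMap.mul' k A ∘ₗ map LinearMap.id s.lift.toLinearMap ∘ₗ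
        Θ) (g := (TensorProduct.rid k A).toLinearMap ∘ₗ map LinearMap.id Coalgebra.counit)
        (tensor_group_ext fun b x => ?_) c
      simp only [LinearMap.comp_apply, hΘ, groupTwist_tmul, TensorProduct.map_tmul,
        LinearMap.id_apply, LinearMap.mul'_apply, LinearEquiv.coe_coe, MonoidAlgebra.counit_single]
      refine (congrArg (b * (↑(s.u x)⁻¹ : A) * ·) (s.lift_single x)).trans ?_
      simp
    rw [h3, ht, h4, counit_coact]

/-- `A` is a crossed product of the coinvariants by the group algebra of `Γ`. -/
theorem exists_isCrossedProduct (s : GroupSection π) (i : D →ₐc[k] A) (hi : Function.Injective i)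
    (hD : ∀ a, (∃ d, i d = a) ↔ a ∈ coinv π) {r : A ⊗[k] A →ₗ[k] k} (hr : IsCoquasitriangular r) :
    ∃ (S : CrossedSystem k D Γ) (Φ : (D ⊗[k] MonoidAlgebra k Γ) ≃ₗc[k] A),
      IsCrossedProduct r (r ∘ₗ map (i : D →ₗ[k] A) (i : D →ₗ[k] A)) i S Φ := by
  obtain ⟨S, hS, hσ⟩ := s.exists_crossedSystem i hi hD
  have hΦ : ∀ d x, CoalgEquiv.ofBijective (s.mulMap_bijective i hi hD) (d ⊗ₜ single x 1) =
      i d * s.u x := s.mulMap_tmul i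
  refine ⟨S, CoalgEquiv.ofBijective (s.mulMap_bijective i hi hD), ?_, ?_, ?_, ?_⟩
  · intro a
    rw [hΦ, s.u_one, Units.val_one, mul_one]
  · intro a b x y
    rw [hΦ, hΦ, hΦ, map_mul, map_mul, hS, hσ]
    simp [mul_assoc]
  · intro a b
    rfl
  · intro a b x y
    -- Splitting the left argument of r(a u(x), b u(y)) gives r(a, b₁u(y)) r(u(x), b₂u(y)), since
    -- u(y) is group-like. Splitting the right arguments then gives r(a₁, u(y)) r(a₂, b₁) and
    -- r(u(x), u(y)) r(u(x), b₂).
    rw [hΦ, hΦ, hΦ, hΦ, map_one, one_mul, one_mul, hr.mul_left, Bialgebra.comul_mul,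
      (s.groupLike y).comul_eq_tmul_self, bialgHom_comul]
    generalize Coalgebra.comul (R := k) b = t
    induction t with
    | zero => simp
    | add t t' ht ht' =>
      simp only [map_add, add_mul, ht, ht', TensorProduct.tmul_add, mul_add]
    | tmul p q =>
      have h1 := hr.mul_right (i a) (i p) (s.u y)
      have h2 := hr.mul_right (s.u x) (i q) (s.u y)
      rw [(s.groupLike x).comul_eq_tmul_self] at h2
      rw [bialgHom_comul, TensorProduct.map_map] at h1
      rw [TensorProduct.map_tmul, Algebra.TensorProduct.tmul_mul_tmul, TensorProduct.map_tmul,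
        LinearMap.mul'_apply, TensorProduct.curry_apply, TensorProduct.curry_apply]
      refine (congrArg₂ (· * ·) h1 h2).trans ?_
      rw [TensorProduct.map_tmul, LinearMap.mul'_apply, TensorProduct.map_tmul,
        TensorProduct.rid_tmul, TensorProduct.tmul_smul, map_smul]
      generalize Coalgebra.comul (R := k) a = t
      have h3 : LinearMap.mul' k k (map ((TensorProduct.curry r).flip ↑(s.u y) ∘ₗ (i : D →ₗ[k] A))
          ((TensorProduct.curry r).flip (i p) ∘ₗ (i : D →ₗ[k] A)) t) =
          (r ∘ₗ map (i : D →ₗ[k] A) (i : D →ₗ[k] A)) ((TensorProduct.lid k D)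
            ((map ((TensorProduct.curry r).flip ↑(s.u y) ∘ₗ (i : D →ₗ[k] A)) LinearMap.id) t)
              ⊗ₜ[k] p) := by
        induction t with
        | zero => simp
        | add t t' ht ht' => simp only [map_add, ht, ht', TensorProduct.add_tmul]
        | tmul c d => simp [← TensorProduct.smul_tmul']
      refine (congrArg (· * _) h3).trans ?_
      simp only [LinearMap.flip_apply, TensorProduct.curry_apply, LinearMap.comp_apply, smul_eq_mul,
        LinearMap.id_apply]
      simp only [BialgHom.coe_toLinearMap]
      ring

end GroupSection

end CrossedProduct

/-! ### Hit actions of functionals on a coalgebra -/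

section Hit

open TensorProduct (map)
open WithConv

variable {k : Type v} [Field k] {C E : Type*} [AddCommGroup C] [Module k C] [Coalgebra k C]
  [AddCommGroup E] [Module k E] [Coalgebra k E]

/-- `a ↦ a₁ c(a₂)`. -/
def rhit (c : C →ₗ[k] k) : C →ₗ[k] C :=
  (TensorProduct.rid k C).toLinearMap ∘ₗ map LinearMap.id c ∘ₗ Coalgebra.comul (R := k)

/-- `a ↦ c(a₁) a₂`. -/
def lhit (c : C →ₗ[k] k) : C →ₗ[k] C :=
  (TensorProduct.lid k C).toLinearMap ∘ₗ map c LinearMap.id ∘ₗ Coalgebra.comul (R := k)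

lemma rhit_apply (c : C →ₗ[k] k) (a : C) : rhit c a =
    TensorProduct.rid k C (map LinearMap.id c (Coalgebra.comul (R := k) a)) := rfl

lemma lhit_apply (c : C →ₗ[k] k) (a : C) : lhit c a =
    TensorProduct.lid k C (map c LinearMap.id (Coalgebra.comul (R := k) a)) := rfl

lemma map_rhit (F : C →ₗc[k] E) (c : E →ₗ[k] k) (a : C) :
    F (rhit (c ∘ₗ F.toLinearMap) a) = rhit c (F a) := by
  have h : Coalgebra.comul (R := k) (F a) = map F.toLinearMap F.toLinearMap
    (Coalgebra.comul (R := k) a) := (CoalgHomClass.map_comp_comul_apply F a).symm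
  rw [rhit_apply, rhit_apply, h]
  generalize Coalgebra.comul (R := k) a = t
  induction t with
  | zero => simp
  | add x y hx hy => simp only [map_add, hx, hy]
  | tmul x y => simp

lemma map_lhit (F : C →ₗc[k] E) (c : E →ₗ[k] k) (a : C) :
    F (lhit (c ∘ₗ F.toLinearMap) a) = lhit c (F a) := by
  have h : Coalgebra.comul (R := k) (F a) = map F.toLinearMap F.toLinearMap
    (Coalgebra.comul (R := k) a) := (CoalgHomClass.map_comp_comul_apply F a).symm
  rw [lhit_apply, lhit_apply, h]
  generalize Coalgebra.comul (R := k) a = t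
  induction t with
  | zero => simp
  | add x y hx hy => simp only [map_add, hx, hy]
  | tmul x y => simp

lemma rhit_counit (a : C) : rhit (Coalgebra.counit (R := k)) a = a := by
  have := Coalgebra.lTensor_counit_comul (R := k) a
  rw [LinearMap.lTensor] at this
  rw [rhit_apply, this, TensorProduct.rid_tmul, one_smul]

lemma lhit_counit (a : C) : lhit (Coalgebra.counit (R := k)) a = a := by
  have := Coalgebra.rTensor_counit_comul (R := k) a
  rw [LinearMap.rTensor] at this
  rw [lhit_apply, this, TensorProduct.lid_tmul, one_smul]

lemma apply_rhit (c d : WithConv (C →ₗ[k] k)) (a : C) :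
    c.ofConv (rhit d.ofConv a) = (c * d).ofConv a := by
  change _ = LinearMap.mul' k k (map c.ofConv d.ofConv (Coalgebra.comul (R := k) a))
  rw [rhit_apply]
  generalize Coalgebra.comul (R := k) a = t
  induction t with
  | zero => simp
  | add x y hx hy => simp only [map_add, hx, hy]
  | tmul x y => simp [mul_comm]

lemma apply_lhit (c d : WithConv (C →ₗ[k] k)) (a : C) :
    d.ofConv (lhit c.ofConv a) = (c * d).ofConv a := by
  change _ = LinearMap.mul' k k (map c.ofConv d.ofConv (Coalgebra.comul (R := k) a))
  rw [lhit_apply]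
  generalize Coalgebra.comul (R := k) a = t
  induction t with
  | zero => simp
  | add x y hx hy => simp only [map_add, hx, hy]
  | tmul x y => simp

lemma counit_rhit (c : C →ₗ[k] k) (a : C) : Coalgebra.counit (R := k) (rhit c a) = c a := by
  have := apply_rhit 1 (toConv c) a
  rwa [one_mul] at this

/-- By coassociativity a right hit only touches the last leg. So right hits compose by convolution
(`rhit_rhit`) and commute with left hits (`lhit_rhit`). -/
lemma comul_rhit (c : C →ₗ[k] k) (a : C) : Coalgebra.comul (R := k) (rhit c a) =
    map LinearMap.id (rhit c) (Coalgebra.comul (R := k) a) := by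
  have h1 : ∀ t : C ⊗[k] C, Coalgebra.comul (R := k) (TensorProduct.rid k C (map LinearMap.id c t)) =
      map LinearMap.id ((TensorProduct.rid k C).toLinearMap ∘ₗ map LinearMap.id c)
        (TensorProduct.assoc k C C C (map Coalgebra.comul LinearMap.id t)) := by
    intro t
    induction t with
    | zero => simp
    | add x y hx hy => simp only [map_add, hx, hy]
    | tmul x y =>
      simp only [TensorProduct.map_tmul, LinearMap.id_apply, TensorProduct.rid_tmul, map_smul]
      generalize Coalgebra.comul (R := k) x = s
      induction s with
      | zero => simp
      | add x y hx hy => simp only [map_add, smul_add, hx, hy, TensorProduct.add_tmul]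
      | tmul x z => simp
  rw [rhit_apply, h1]
  have := Coalgebra.coassoc_apply (R := k) a
  rw [LinearMap.rTensor, LinearMap.lTensor] at this
  rw [this, TensorProduct.map_map]
  rfl

lemma comul_lhit (c : C →ₗ[k] k) (a : C) : Coalgebra.comul (R := k) (lhit c a) =
    map (lhit c) LinearMap.id (Coalgebra.comul (R := k) a) := by
  have h1 : ∀ t : C ⊗[k] C, Coalgebra.comul (R := k) (TensorProduct.lid k C (map c LinearMap.id t)) =
      map ((TensorProduct.lid k C).toLinearMap ∘ₗ map c LinearMap.id) LinearMap.id
        ((TensorProduct.assoc k C C C).symm (map LinearMap.id Coalgebra.comul t)) := by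
    intro t
    induction t with
    | zero => simp
    | add x y hx hy => simp only [map_add, hx, hy]
    | tmul x y =>
      simp only [TensorProduct.map_tmul, LinearMap.id_apply, TensorProduct.lid_tmul, map_smul]
      generalize Coalgebra.comul (R := k) y = s
      induction s with
      | zero => simp
      | add x y hx hy => simp only [map_add, smul_add, hx, hy, TensorProduct.tmul_add]
      | tmul x z => simp [TensorProduct.smul_tmul']
  rw [lhit_apply, h1]
  have := Coalgebra.coassoc_symm_apply (R := k) a
  rw [LinearMap.rTensor, LinearMap.lTensor] at this
  rw [this, TensorProduct.map_map]
  rfl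

lemma rhit_rhit (c d : WithConv (C →ₗ[k] k)) (a : C) :
    rhit c.ofConv (rhit d.ofConv a) = rhit (c * d).ofConv a := by
  rw [rhit_apply, comul_rhit, TensorProduct.map_map, rhit_apply]
  congr 2
  rw [LinearMap.id_comp]
  congr 1
  exact LinearMap.ext fun b => apply_rhit c d b

lemma lhit_lhit (c d : WithConv (C →ₗ[k] k)) (a : C) :
    lhit d.ofConv (lhit c.ofConv a) = lhit (c * d).ofConv a := by
  rw [lhit_apply, comul_lhit, TensorProduct.map_map, lhit_apply]
  congr 2
  rw [LinearMap.id_comp]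
  congr 1
  exact LinearMap.ext fun b => apply_lhit c d b

lemma lhit_rhit (c d : C →ₗ[k] k) (a : C) : lhit c (rhit d a) = rhit d (lhit c a) := by
  have h : ∀ t : C ⊗[k] C, TensorProduct.lid k C (map c (rhit d) t) =
      rhit d (TensorProduct.lid k C (map c LinearMap.id t)) := by
    intro t
    induction t with
    | zero => simp
    | add x y hx hy => simp only [map_add, hx, hy]
    | tmul x y => simp
  rw [lhit_apply, comul_rhit, TensorProduct.map_map, LinearMap.comp_id, LinearMap.id_comp, h,
    ← lhit_apply]

end Hit

/-! ### Functionals induced by functions on a group -/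

section GroupFunctionals

open TensorProduct (map)
open WithConv
open MonoidAlgebra (single)

variable {k : Type v} [Field k] {A : Type*} [Ring A] [HopfAlgebra k A] {G : Type u} [Group G]
  (π : A →ₐc[k] MonoidAlgebra k G)

/-- The functional on `A` induced by a function on `G`. -/
def groupChar (f : G → k) : A →ₗ[k] k := groupLift f ∘ₗ (π : A →ₗ[k] MonoidAlgebra k G)

lemma groupChar_apply (f : G → k) (a : A) : groupChar π f a = groupLift f (π a) := rfl

/-- Basis elements of the group algebra are group-like, so convolution there is the pointwise
product of functions. -/
lemma groupChar_mul (f f' : G → k) :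
    toConv (groupChar π f) * toConv (groupChar π f') = toConv (groupChar π (f * f')) := by
  have h : toConv (groupLift f) * toConv (groupLift f') =
      toConv (groupLift (f * f') : MonoidAlgebra k G →ₗ[k] k) := by
    apply WithConv.ofConv_injective
    refine MonoidAlgebra.lhom_ext' fun x => LinearMap.ext_ring ?_
    change LinearMap.mul' k k (map (groupLift f) (groupLift f')
      (Coalgebra.comul (R := k) (single x (1 : k)))) = groupLift (f * f') (single x 1)
    rw [comul_single_one]
    simp
  have := LinearMap.convMul_comp_coalgHom_distrib (toConv (groupLift f : MonoidAlgebra k G →ₗ[k] k))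
    (toConv (groupLift f')) (π : A →ₗc[k] MonoidAlgebra k G)
  rw [h] at this
  exact (congrArg toConv this).symm

lemma groupChar_one : groupChar π 1 = Coalgebra.counit (R := k) := by
  have h : groupLift (1 : G → k) = Coalgebra.counit (R := k) := by
    refine MonoidAlgebra.lhom_ext' fun x => LinearMap.ext_ring ?_
    change groupLift (1 : G → k) (single x 1) = Coalgebra.counit (R := k) (single x (1 : k))
    simp
  rw [groupChar, h]
  exact CoalgHomClass.counit_comp π

lemma rhit_groupChar (f : G → k) (a : A) : rhit (groupChar π f) a =
    TensorProduct.rid k A (map LinearMap.id (groupLift f) (coact π a)) := by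
  rw [rhit_apply, coact_apply, TensorProduct.map_map]
  rfl

lemma lhit_groupChar (f : G → k) (a : A) : lhit (groupChar π f) a =
    TensorProduct.rid k A (map LinearMap.id (groupLift f) (TensorProduct.comm k _ _
      (map (π : A →ₗ[k] MonoidAlgebra k G) LinearMap.id (Coalgebra.comul (R := k) a)))) := by
  rw [lhit_apply]
  generalize Coalgebra.comul (R := k) a = t
  induction t with
  | zero => simp
  | add x y hx hy => simp only [map_add, hx, hy]
  | tmul x y => simp [groupChar]

/-- Indicator functions of single group elements already read off the coefficients in V ⊗ k[G] ≅ (G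
→₀ V). -/
lemma tensor_group_eq {G : Type*} {V : Type*} [AddCommGroup V] [Module k V] {t t' : V ⊗[k] MonoidAlgebra k G}
    (h : ∀ f : G → k, TensorProduct.rid k V (map LinearMap.id (groupLift f) t) =
      TensorProduct.rid k V (map LinearMap.id (groupLift f) t')) : t = t' := by
  classical
  let e : V ⊗[k] MonoidAlgebra k G ≃ₗ[k] (G →₀ V) :=
    (LinearEquiv.lTensor V (MonoidAlgebra.coeffLinearEquiv k)).trans
      (TensorProduct.finsuppScalarRight k k V G)
  have he : ∀ x t, e t x =
      TensorProduct.rid k V (map LinearMap.id (groupLift (Pi.single x 1)) t) := by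
    intro x t
    refine LinearMap.congr_fun (f := Finsupp.lapply x ∘ₗ e.toLinearMap)
      (g := (TensorProduct.rid k V).toLinearMap ∘ₗ
        map LinearMap.id (groupLift (Pi.single x (1 : k)))) (tensor_group_ext fun v y => ?_) t
    by_cases hxy : y = x
    · subst hxy; simp [e]
    · simp [e, hxy]
  apply e.injective
  ext x
  rw [he, he, h]

lemma coact_eq_of_hit (h : ∀ f a, rhit (groupChar π f) a = lhit (groupChar π f) a) (a : A) :
    coact π a = TensorProduct.comm k _ A
      (map (π : A →ₗ[k] MonoidAlgebra k G) LinearMap.id (Coalgebra.comul (R := k) a)) :=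
  tensor_group_eq fun f => by rw [← rhit_groupChar, ← lhit_groupChar, h]

/-- In terms of the G-grading, hitting with the indicator of 1 projects onto the part of degree 1,
which is the space of coinvariants. -/
lemma mem_coinv_iff [DecidableEq G] {a : A} :
    a ∈ coinv π ↔ rhit (groupChar π (Pi.single 1 1)) a = a := by
  constructor
  · intro ha
    rw [rhit_groupChar, mem_coinv.1 ha, MonoidAlgebra.one_def]
    simp
  · intro ha
    rw [mem_coinv]
    have h2 : ∀ t : A ⊗[k] MonoidAlgebra k G,
        TensorProduct.rid k _ (map LinearMap.id (groupLift (Pi.single (1 : G) (1 : k)))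
          ((TensorProduct.assoc k A _ _).symm (map LinearMap.id Coalgebra.comul t))) =
        TensorProduct.rid k A (map LinearMap.id (groupLift (Pi.single (1 : G) (1 : k))) t)
          ⊗ₜ[k] single (1 : G) (1 : k) := by
      intro t
      refine LinearMap.congr_fun (f := (TensorProduct.rid k _).toLinearMap ∘ₗ
        map LinearMap.id (groupLift (Pi.single (1 : G) (1 : k))) ∘ₗ
        (TensorProduct.assoc k A _ _).symm.toLinearMap ∘ₗ map LinearMap.id Coalgebra.comul)
        (g := (TensorProduct.mk k A (MonoidAlgebra k G)).flip (single 1 1) ∘ₗ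
          (TensorProduct.rid k A).toLinearMap ∘ₗ
          map LinearMap.id (groupLift (Pi.single (1 : G) (1 : k))))
        (tensor_group_ext fun v y => ?_) t
      simp only [LinearMap.comp_apply, TensorProduct.map_tmul, comul_single_one,
        LinearEquiv.coe_coe, TensorProduct.assoc_symm_tmul, LinearMap.id_apply, groupLift_single,
        TensorProduct.rid_tmul, LinearMap.flip_apply, TensorProduct.mk_apply, one_smul]
      by_cases hy : y = 1
      · subst hy; simp
      · simp [hy]
    have h3 : ∀ t : A ⊗[k] MonoidAlgebra k G, coact π (TensorProduct.rid k A
        (map LinearMap.id (groupLift (Pi.single (1 : G) (1 : k))) t)) =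
        TensorProduct.rid k _ (map LinearMap.id (groupLift (Pi.single (1 : G) (1 : k)))
          (map (coact π).toLinearMap LinearMap.id t)) := by
      intro t
      induction t with
      | zero => simp
      | add x y hx hy => simp only [map_add, hx, hy]
      | tmul x y => simp
    rw [rhit_groupChar] at ha
    conv_lhs => rw [← ha]
    rw [h3, map_coact_coact, h2, ha, MonoidAlgebra.one_def]

end GroupFunctionals

/-! ### The retraction of gr(H) onto the group algebra H₀ -/

section GroupRetract

open TensorProduct (map)
open MonoidAlgebra (single)

/-- A retraction of a Hopf algebra onto a group algebra contained in it. -/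
structure GroupRetract (k : Type v) [Field k] (A : Type*) [Ring A] [HopfAlgebra k A]
    (G : Type*) [Group G] where
  ι : G →* A
  π : A →ₐc[k] MonoidAlgebra k G
  groupLike : ∀ g, IsGroupLikeElem k (ι g)
  proj : ∀ g, π (ι g) = single g 1

variable {k : Type v} [Field k] {H : Type u} [Ring H] [HopfAlgebra k H]

lemma FiltGr.snd_eq {V V' : Type*} [AddCommGroup V] [Module k V] [AddCommGroup V'] [Module k V']
    (X : FiltGr k V V') {n : ℕ} {p q : V × V'} (hp : p ∈ X.Rel n) (hq : q ∈ X.Rel n)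
    (h : p.1 = q.1) : p.2 = q.2 := by
  rw [← X.P_eq n p hp, ← X.P_eq n q hq, h]

lemma liftGroupLike_single (g : GroupLike k H) :
    MonoidAlgebra.liftGroupLikeBialgHom (R := k) (single g (1 : k)) = g.val := by
  simp

lemma liftGroupLike_eq (t : MonoidAlgebra k (GroupLike k H)) :
    MonoidAlgebra.liftGroupLikeBialgHom t = groupLift (GroupLike.val (R := k) (A := H)) t := by
  refine LinearMap.congr_fun (f := ((MonoidAlgebra.liftGroupLikeBialgHom :
    MonoidAlgebra k (GroupLike k H) →ₐc[k] H) : MonoidAlgebra k (GroupLike k H) →ₗ[k] H))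
    (MonoidAlgebra.lhom_ext' fun x => LinearMap.ext_ring ?_) t
  change MonoidAlgebra.liftGroupLikeBialgHom (single x (1 : k)) = groupLift _ (single x (1 : k))
  rw [liftGroupLike_single, groupLift_single, one_smul]

lemma liftGroupLike_injective : Function.Injective
    (MonoidAlgebra.liftGroupLikeBialgHom : MonoidAlgebra k (GroupLike k H) →ₐc[k] H) := by
  intro s t h
  rw [liftGroupLike_eq, liftGroupLike_eq] at h
  have := (linearIndep_groupLikeVal (R := k) (A := H)) h
  exact MonoidAlgebra.coeff_injective this

lemma exists_liftGroupLike_eq (hH : IsPointedCoalgebra k H) {a : H} (ha : a ∈ coradFilt k H 0) :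
    ∃ t : MonoidAlgebra k (GroupLike k H), MonoidAlgebra.liftGroupLikeBialgHom t = a := by
  rw [coradFilt, coradical_eq_span hH, ← Finsupp.range_linearCombination] at ha
  obtain ⟨t, rfl⟩ := ha
  exact ⟨MonoidAlgebra.ofCoeff t, liftGroupLike_eq _⟩

variable {A : Type u} [Ring A] [HopfAlgebra k A] {φ : Gr k H ≃ₗ[k] A}

namespace IsGrHopf

/-- For pointed H the coradical is the image of the group algebra, embedded because group-likes are
linearly independent. The projection to H₀ lifts, and its properties are read off in H. -/
lemma exists_projGroup (h : IsGrHopf φ) (hH : IsPointedCoalgebra k H) :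
    ∃ π : A →ₐc[k] MonoidAlgebra k (GroupLike k H),
      ∀ a, MonoidAlgebra.liftGroupLikeBialgHom (π a) = grProj φ a := by
  choose p hp using fun a => exists_liftGroupLike_eq hH (grProj_mem φ a)
  set L : MonoidAlgebra k (GroupLike k H) →ₐc[k] H := MonoidAlgebra.liftGroupLikeBialgHom with hL
  have hLi : Function.Injective L := liftGroupLike_injective
  let p' : A →ₐ[k] MonoidAlgebra k (GroupLike k H) :=
    AlgHom.ofLinearMap ⟨⟨p, fun a b => hLi (by rw [map_add, hp, hp, hp, map_add])⟩,
      fun c a => hLi (by rw [RingHom.id_apply, map_smul, hp, hp, map_smul])⟩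
      (hLi (by
        change L (p 1) = L 1
        rw [hp, h.grProj_one, map_one L]))
      (fun a b => hLi (by
        change L (p (a * b)) = L (p a * p b)
        rw [map_mul, hp, hp, hp, h.grProj_mul]))
  have hp' : (L : MonoidAlgebra k (GroupLike k H) →ₗ[k] H) ∘ₗ p'.toLinearMap = grProj φ :=
    LinearMap.ext hp
  refine ⟨BialgHom.ofAlgHom p' (AlgHom.ext fun a => ?_) (AlgHom.ext fun a => ?_), hp⟩
  · change Coalgebra.counit (R := k) (p a) = Coalgebra.counit (R := k) a
    rw [← CoalgHomClass.counit_comp_apply L, hp, h.counit_grProj]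
  · refine map_injective_of_injective (f := (L : MonoidAlgebra k (GroupLike k H) →ₗ[k] H))
      (g := (L : MonoidAlgebra k (GroupLike k H) →ₗ[k] H)) hLi hLi ?_
    change map _ _ (map p'.toLinearMap p'.toLinearMap (Coalgebra.comul (R := k) a)) =
      map _ _ (Coalgebra.comul (R := k) (p a))
    rw [TensorProduct.map_map, hp', ← bialgHom_comul, hp, h.comul_grProj]

/-- `gr(H)` retracts onto the group algebra `H₀`. -/
theorem exists_groupRetract (h : IsGrHopf φ) (hH : IsPointedCoalgebra k H) :
    ∃ R : GroupRetract k A (GroupLike k H),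
      (∀ n (a : coradFilt k H (n + 1)), R.π (φ (grClass k H (n + 1) a)) = 0) ∧
      (∀ g : GroupLike k H, R.ι g = φ (grClass k H 0 ⟨g.val, groupLike_mem_coradFilt hH g⟩)) ∧
      (∀ a : coradFilt k H 0, φ (grClass k H 0 a) ∈ Submodule.span k (Set.range R.ι)) ∧
      ∀ r : H ⊗[k] H →ₗ[k] k,
        ∃ r₀ : MonoidAlgebra k (GroupLike k H) ⊗[k] MonoidAlgebra k (GroupLike k H) →ₗ[k] k,
          ∀ a b, grForm φ r (a ⊗ₜ b) = r₀ (R.π a ⊗ₜ R.π b) := by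
  obtain ⟨π, hπ⟩ := h.exists_projGroup hH
  let c : GroupLike k H → coradFilt k H 0 := fun g => ⟨g.val, groupLike_mem_coradFilt hH g⟩
  let ι : GroupLike k H →* A :=
    { toFun := fun g => φ (grClass k H 0 (c g))
      map_one' := by
        obtain ⟨e, he, he'⟩ := h.one
        rw [← he']
        congr 2
        exact Subtype.ext he.symm
      map_mul' := fun g g' => by
        obtain ⟨d, hd, hd'⟩ := h.mul 0 0 (c g) (c g')
        rw [hd']
        exact congrArg (fun x => φ (grClass k H 0 x)) (Subtype.ext hd.symm) }
  have hι : ∀ g, ι g = φ (grClass k H 0 (c g)) := fun g => rfl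
  refine ⟨⟨ι, π, fun g => ⟨?_, ?_⟩, fun g => liftGroupLike_injective ?_⟩, fun n a =>
    liftGroupLike_injective ?_, hι, fun a => ?_, fun r => ⟨r ∘ₗ map
      ((MonoidAlgebra.liftGroupLikeBialgHom : MonoidAlgebra k (GroupLike k H) →ₐc[k] H) :
        MonoidAlgebra k (GroupLike k H) →ₗ[k] H)
      ((MonoidAlgebra.liftGroupLikeBialgHom : MonoidAlgebra k (GroupLike k H) →ₐc[k] H) :
        MonoidAlgebra k (GroupLike k H) →ₗ[k] H), fun a b => ?_⟩⟩
  · rw [hι, h.counit_zero]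
    exact g.isGroupLikeElem_val.counit_eq_one
  -- The coproduct of the class of g and the tensor square of that class are both the degree 0 class
  -- of Δ(g) = g ⊗ g.
  · have h1 := h.isSymbol_comul 0 _ (mem_grFilt (φ := φ) (c g))
    have h2 := FiltGr.tmul_mem_tensor (mem_grFilt (φ := φ) (c g)) (mem_grFilt (φ := φ) (c g))
    exact FiltGr.snd_eq _ h1 h2 g.isGroupLikeElem_val.comul_eq_tmul_self
  · rw [hπ, hι, grProj_zero, liftGroupLike_single]
  · rw [hπ, grProj_succ, map_zero]
  · have h1 : (⊤ : Submodule k (coradFilt k H 0)) ≤ (Submodule.span k (Set.range ι)).comap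
        (φ.toLinearMap ∘ₗ grClass k H 0) := by
      have h2 : coradFilt k H 0 ≤ ((Submodule.span k (Set.range ι)).comap
          (φ.toLinearMap ∘ₗ grClass k H 0)).map (coradFilt k H 0).subtype := by
        conv_lhs => rw [coradFilt, coradical_eq_span hH]
        rw [Submodule.span_le]
        rintro _ ⟨g, rfl⟩
        exact ⟨c g, Submodule.subset_span ⟨g, rfl⟩, rfl⟩
      intro x _
      obtain ⟨y, hy, hxy⟩ := h2 x.2
      rwa [← Subtype.ext hxy]
    exact h1 (Submodule.mem_top (x := a))
  · rw [grForm_tmul, ← hπ, ← hπ]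
    rfl

end IsGrHopf

end GroupRetract

/-! ### Vertex functionals and connected components -/

section PathFunctionals

open TensorProduct (map)

variable {k : Type v} [Field k] {V : Type u} [Quiver.{u} V]

/-- The functional on the path coalgebra that extends a function on vertices by zero. -/
def vertexFun (f : V → k) : PathCoalgebra k V →ₗ[k] k :=
  pathLift fun x _ p => if p.length = 0 then f x else 0

lemma vertexFun_pathElt (f : V → k) {x y : V} (p : Quiver.Path x y) :
    vertexFun f (pathElt k p) = if p.length = 0 then f x else 0 := pathLift_pathElt k _ p

/-- Only the splitting of p with the source vertex as right factor survives. So right hits scale by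
the value at the source and, in `lhit_vertexFun`, left hits by the value at the target. -/
lemma rhit_vertexFun (f : V → k) {x y : V} (p : Quiver.Path x y) :
    rhit (vertexFun f) (pathElt k p) = f x • pathElt k p := by
  rw [rhit_apply, comul_pathElt, pathComul, map_list_sum, map_list_sum, List.map_map, List.map_map]
  have h := congrArg (fun t => f x • TensorProduct.rid k _ t)
    (pathSplits_counit_right k p (fun z q => pathElt k q))
  simp only [TensorProduct.rid_tmul, one_smul] at h
  rw [← h, map_list_sum, List.smul_sum, List.map_map, List.map_map]
  congr 2
  refine funext fun s => ?_
  simp [Function.comp_def, vertexFun_pathElt]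

lemma lhit_vertexFun (f : V → k) {x y : V} (p : Quiver.Path x y) :
    lhit (vertexFun f) (pathElt k p) = f y • pathElt k p := by
  rw [lhit_apply, comul_pathElt, pathComul, map_list_sum, map_list_sum, List.map_map, List.map_map]
  cases p with
  | nil => simp [pathSplits, vertexFun_pathElt]
  | cons p e => simp [pathSplits, vertexFun_pathElt, Function.comp_def]

lemma path_eq_of_arrow {α : Type*} (F : V → α) (hF : ∀ (x y : V) (_ : x ⟶ y), F x = F y) {x y : V}
    (p : Quiver.Path x y) : F x = F y := by
  induction p with
  | nil => rfl
  | cons p e ih => exact ih.trans (hF _ _ e)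

/-- Reduces constancy on a component to single arrows, traversed in either direction. Below, F
records components of translates or values of the symmetrized form. -/
lemma component_eq_of_arrow {α : Type*} (F : V → α) (hF : ∀ (x y : V) (_ : x ⟶ y), F x = F y)
    {x y : V} (h : Quiver.WeaklyConnectedComponent.mk x = Quiver.WeaklyConnectedComponent.mk y) :
    F x = F y := by
  obtain ⟨p⟩ := (Quiver.WeaklyConnectedComponent.eq x y).1 h
  refine path_eq_of_arrow (V := Quiver.Symmetrify V) F (fun a b e => ?_) p
  rcases e with e | e
  · exact hF _ _ e
  · exact (hF _ _ e).symm

lemma component_arrow {x y : V} (e : x ⟶ y) :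
    Quiver.WeaklyConnectedComponent.mk x = Quiver.WeaklyConnectedComponent.mk y :=
  (Quiver.WeaklyConnectedComponent.eq x y).2 ⟨Quiver.Hom.toPath (V := Quiver.Symmetrify V) (Sum.inl e)⟩

lemma rhit_vertexFun_eq_lhit {f : V → k} (hf : ∀ (x y : V) (_ : x ⟶ y), f x = f y)
    (b : PathCoalgebra k V) : rhit (vertexFun f) b = lhit (vertexFun f) b := by
  refine LinearMap.congr_fun (pathHom_ext fun x y p => ?_) b
  rw [rhit_vertexFun, lhit_vertexFun, path_eq_of_arrow f hf p]

open Classical in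
/-- The indicator function of the connected component of a vertex. -/
def componentInd (k : Type v) [Field k] (e : V) : V → k := fun x =>
  if Quiver.WeaklyConnectedComponent.mk x = Quiver.WeaklyConnectedComponent.mk e then 1 else 0

lemma componentInd_arrow (e : V) (x y : V) (a : x ⟶ y) :
    componentInd k e x = componentInd k e y := by
  rw [componentInd, componentInd, component_arrow a]

/-- Hitting with the indicator of a component is the projection onto the span of the paths whose
source lies in it. -/
lemma mem_componentSpan_iff {e : V} {b : PathCoalgebra k V} :
    b ∈ componentSpan k e ↔ rhit (vertexFun (componentInd k e)) b = b := by
  constructor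
  · intro hb
    induction hb using Submodule.span_induction with
    | zero => rw [map_zero]
    | add x y _ _ hx hy => rw [map_add, hx, hy]
    | smul c x _ hx => rw [map_smul, hx]
    | mem z hz =>
      obtain ⟨x, y, p, h, rfl⟩ := hz
      rw [rhit_vertexFun, componentInd, if_pos h, one_smul]
  · intro hb
    rw [← hb]
    have h : (⊤ : Submodule k (PathCoalgebra k V)) ≤
        (componentSpan k e).comap (rhit (vertexFun (componentInd k e))) := by
      have h1 : (componentSpan k e).mkQ ∘ₗ rhit (vertexFun (componentInd k e)) = 0 := by
        refine pathHom_ext fun x y p => ?_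
        rw [LinearMap.comp_apply, rhit_vertexFun, LinearMap.zero_apply, Submodule.mkQ_apply,
          Submodule.Quotient.mk_eq_zero, componentInd]
        split_ifs with h
        · rw [one_smul]
          exact Submodule.subset_span ⟨x, y, p, h, rfl⟩
        · rw [zero_smul]
          exact zero_mem _
      intro b _
      exact (Submodule.Quotient.mk_eq_zero (componentSpan k e)).1 (LinearMap.congr_fun h1 b)
    exact h Submodule.mem_top

lemma isGroupLikeElem_vertex (x : V) :
    IsGroupLikeElem k (pathElt k (Quiver.Path.nil : Quiver.Path x x)) where
  counit_eq_one := by simp [counit_pathElt]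
  comul_eq_tmul_self := by simp [comul_pathElt, pathComul, pathSplits]

/-- The group-like elements of degree `0` of a path coalgebra are the vertices. -/
lemma exists_vertex {b : PathCoalgebra k V} (hb : IsGroupLikeElem k b)
    (h0 : b ∈ pathDegree k V 0) :
    ∃ x : V, b = pathElt k (Quiver.Path.nil : Quiver.Path x x) := by
  by_contra hne
  let s : Set (GroupLike k (PathCoalgebra k V)) :=
    {g | ∃ x : V, g.val = pathElt k (Quiver.Path.nil : Quiver.Path x x)}
  have h1 : (⟨b, hb⟩ : GroupLike k (PathCoalgebra k V)) ∉ s := hne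
  -- Distinct group-likes are linearly independent, so one that lies in the span of the vertices is
  -- itself a vertex.
  refine linearIndep_groupLikeVal.notMem_span_image h1 ?_
  refine Submodule.span_mono ?_ h0
  rintro _ ⟨x, y, p, hp, rfl⟩
  cases p with
  | cons p e => exact absurd hp (Nat.succ_ne_zero _)
  | nil =>
    exact ⟨⟨_, isGroupLikeElem_vertex x⟩, ⟨x, rfl⟩, rfl⟩

end PathFunctionals

/-! ### Embeddings into path coalgebras with vertices from the group -/

section QuiverRealization

open TensorProduct (map)
open MonoidAlgebra (single)

variable {k : Type v} [Field k] {A : Type*} [Ring A] [HopfAlgebra k A] {G : Type*} [Group G]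
  {V : Type u} [Quiver.{u} V]

/-- `j` embeds the Hopf algebra `A` into the path coalgebra of a quiver whose vertices are the
elements of the group `G`, such that all vertices and arrows are in the image. -/
structure IsQuiverRealization (R : GroupRetract k A G) (j : A →ₗc[k] PathCoalgebra k V)
    (ν : G → V) : Prop where
  injective : Function.Injective j
  vertex : ∀ g, j (R.ι g) = pathElt k (Quiver.Path.nil : Quiver.Path (ν g) (ν g))
  char : ∀ f : V → k, vertexFun f ∘ₗ j.toLinearMap = groupChar R.π (f ∘ ν)
  large : ∀ (x y : V) (p : Quiver.Path x y), p.length ≤ 1 → ∃ a, j a = pathElt k p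

lemma GroupRetract.ι_injective (R : GroupRetract k A G) : Function.Injective R.ι := fun g h hgh => by
  have := congrArg R.π hgh
  rw [R.proj, R.proj] at this
  by_contra hne
  have h2 := congrArg (fun t => MonoidAlgebra.coeff t g) this
  simp [Ne.symm hne] at h2

/-- A graded coalgebra map sends group-likes of degree 0 to vertices, which defines `ν`. The two
functionals in `char` agree on the spanning elements ι(g) in degree 0 and both vanish in positive
degree. -/
lemma exists_isQuiverRealization {H : Type u} [Ring H] [HopfAlgebra k H] {A : Type u} [Ring A]
    [HopfAlgebra k A] {φ : Gr k H ≃ₗ[k] A} {R : GroupRetract k A (GroupLike k H)}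
    (h1 : ∀ n (a : coradFilt k H (n + 1)), R.π (φ (grClass k H (n + 1) a)) = 0)
    (hH : ∀ g : GroupLike k H, ∃ a, R.ι g = φ (grClass k H 0 a))
    (h0 : ∀ a : coradFilt k H 0, φ (grClass k H 0 a) ∈ Submodule.span k (Set.range R.ι))
    {j : A →ₗc[k] PathCoalgebra k V} (hj : IsLargeEmbedding φ j) :
    ∃ ν, IsQuiverRealization R j ν := by
  have hv : ∀ g, ∃ x : V, j (R.ι g) = pathElt k (Quiver.Path.nil : Quiver.Path x x) := by
    intro g
    refine exists_vertex ((R.groupLike g).map j) ?_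
    obtain ⟨a, ha⟩ := hH g
    rw [ha]
    exact hj.graded 0 a
  choose ν hν using hv
  refine ⟨ν, hj.injective, hν, fun f => gr_hom_ext φ ?_, fun x y p hp => hj.large _ hp _ <|
    Submodule.subset_span ⟨x, y, p, rfl, rfl⟩⟩
  rintro (_ | n) a
  · have h2 : Submodule.span k (Set.range R.ι) ≤
        LinearMap.eqLocus (vertexFun f ∘ₗ j.toLinearMap) (groupChar R.π (f ∘ ν)) := by
      rw [Submodule.span_le]
      rintro _ ⟨g, rfl⟩
      change vertexFun f (j (R.ι g)) = groupLift (f ∘ ν) (R.π (R.ι g))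
      rw [hν, vertexFun_pathElt, R.proj, groupLift_single]
      simp
    exact h2 (h0 a)
  · rw [groupChar_apply, h1, map_zero]
    have h2 : pathDegree k V (n + 1) ≤ LinearMap.ker (vertexFun f) := by
      rw [pathDegree, Submodule.span_le]
      rintro _ ⟨x, y, p, hp, rfl⟩
      change vertexFun f (pathElt k p) = 0
      rw [vertexFun_pathElt, if_neg (by omega)]
    exact h2 (hj.graded (n + 1) a)

end QuiverRealization

/-! ### Values of the form on group-likes and skew-primitives -/

section FormGroupLike

open TensorProduct (map)
open WithConv

variable {k : Type v} [Field k] {A : Type*} [Ring A] [HopfAlgebra k A] {r : A ⊗[k] A →ₗ[k] k}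

lemma comul_tmul_groupLike {g h : A} (hg : IsGroupLikeElem k g) (hh : IsGroupLikeElem k h) :
    Coalgebra.comul (R := k) (g ⊗ₜ[k] h) = (g ⊗ₜ[k] h) ⊗ₜ[k] (g ⊗ₜ[k] h) := by
  rw [TensorProduct.comul_tmul, hg.comul_eq_tmul_self, hh.comul_eq_tmul_self]
  rfl

namespace IsCoquasitriangular

/-- Evaluation at a pair of group-likes is multiplicative for convolution, so the convolution
inverse provides an inverse scalar. -/
lemma apply_groupLike_ne_zero (hr : IsCoquasitriangular r) {g h : A} (hg : IsGroupLikeElem k g)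
    (hh : IsGroupLikeElem k h) : r (g ⊗ₜ h) ≠ 0 := by
  intro h0
  obtain ⟨s, hs⟩ := hr.conv_invertible.exists_right_inv
  have h1 := congrArg (fun c : WithConv (A ⊗[k] A →ₗ[k] k) => c.ofConv (g ⊗ₜ h)) hs
  change LinearMap.mul' k k (map r s.ofConv (Coalgebra.comul (R := k) (g ⊗ₜ[k] h))) =
    Coalgebra.counit (R := k) (g ⊗ₜ[k] h) at h1
  rw [comul_tmul_groupLike hg hh, TensorProduct.map_tmul, LinearMap.mul'_apply, h0, zero_mul,
    TensorProduct.counit_tmul, hg.counit_eq_one, hh.counit_eq_one] at h1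
  simp at h1

lemma one_groupLike (hr : IsCoquasitriangular r) {h : A} (hh : IsGroupLikeElem k h) :
    r (1 ⊗ₜ h) = 1 := by
  have h1 := hr.mul_left 1 1 h
  rw [hh.comul_eq_tmul_self, one_mul] at h1
  refine mul_left_cancel₀ (hr.apply_groupLike_ne_zero IsGroupLikeElem.one hh) ?_
  rw [mul_one]
  exact h1.symm

lemma groupLike_one (hr : IsCoquasitriangular r) {g : A} (hg : IsGroupLikeElem k g) :
    r (g ⊗ₜ 1) = 1 := by
  have h1 := hr.mul_right g 1 1
  rw [hg.comul_eq_tmul_self, one_mul] at h1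
  refine mul_left_cancel₀ (hr.apply_groupLike_ne_zero hg IsGroupLikeElem.one) ?_
  rw [mul_one]
  exact h1.symm

/-- For group-likes braided commutativity reads r(g, h) hg = r(g, h) gh, and the scalar is nonzero.
-/
lemma groupLike_comm (hr : IsCoquasitriangular r) {g h : A} (hg : IsGroupLikeElem k g)
    (hh : IsGroupLikeElem k h) : g * h = h * g := by
  have h1 := hr.braided_comm g h
  rw [comul_tmul_groupLike hg hh] at h1
  simp only [TensorProduct.map_tmul, LinearMap.comp_apply, LinearEquiv.coe_coe,
    TensorProduct.comm_tmul, LinearMap.mul'_apply, TensorProduct.rid_tmul,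
    TensorProduct.lid_tmul] at h1
  exact (smul_right_injective A (hr.apply_groupLike_ne_zero hg hh) h1).symm

/-- If `x` is skew-primitive over `g` and `h` and the form vanishes on `x`, then `y` commutes
with `x` up to a scalar. -/
lemma skewPrimitive_comm_left (hr : IsCoquasitriangular r) {g h x y : A}
    (hx : Coalgebra.comul (R := k) x = h ⊗ₜ x + x ⊗ₜ g) (hy : IsGroupLikeElem k y)
    (h0 : r (x ⊗ₜ y) = 0) : r (g ⊗ₜ y) • (y * x) = r (h ⊗ₜ y) • (x * y) := by
  have h1 := hr.braided_comm x y
  have h2 : Coalgebra.comul (R := k) (x ⊗ₜ[k] y) =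
      (h ⊗ₜ[k] y) ⊗ₜ[k] (x ⊗ₜ[k] y) + (x ⊗ₜ[k] y) ⊗ₜ[k] (g ⊗ₜ[k] y) := by
    rw [TensorProduct.comul_tmul, hx, hy.comul_eq_tmul_self, TensorProduct.add_tmul, map_add]
    rfl
  rw [h2] at h1
  simpa [h0] using h1

lemma skewPrimitive_comm_right (hr : IsCoquasitriangular r) {g h x y : A}
    (hx : Coalgebra.comul (R := k) x = h ⊗ₜ x + x ⊗ₜ g) (hy : IsGroupLikeElem k y)
    (h0 : r (y ⊗ₜ x) = 0) : r (y ⊗ₜ g) • (x * y) = r (y ⊗ₜ h) • (y * x) := by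
  have h1 := hr.braided_comm y x
  have h2 : Coalgebra.comul (R := k) (y ⊗ₜ[k] x) =
      (y ⊗ₜ[k] h) ⊗ₜ[k] (y ⊗ₜ[k] x) + (y ⊗ₜ[k] x) ⊗ₜ[k] (y ⊗ₜ[k] g) := by
    rw [TensorProduct.comul_tmul, hx, hy.comul_eq_tmul_self, TensorProduct.tmul_add, map_add]
    rfl
  rw [h2] at h1
  simpa [h0] using h1

end IsCoquasitriangular

variable {B : Type*} [Ring B] [HopfAlgebra k B]

/-- Both sides of the cotriangularity identity are compatible with homomorphisms. -/
lemma skew_comp (F : B →ₐc[k] A) (r : A ⊗[k] A →ₗ[k] k) (a b : B) :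
    LinearMap.mul' k k (map (r ∘ₗ map (F : B →ₗ[k] A) (F : B →ₗ[k] A))
      ((r ∘ₗ map (F : B →ₗ[k] A) (F : B →ₗ[k] A)) ∘ₗ (TensorProduct.comm k B B).toLinearMap)
      (Coalgebra.comul (R := k) (a ⊗ₜ[k] b))) =
    LinearMap.mul' k k (map r (r ∘ₗ (TensorProduct.comm k A A).toLinearMap)
      (Coalgebra.comul (R := k) (F a ⊗ₜ[k] F b))) := by
  have hΔ : Coalgebra.comul (R := k) (F a ⊗ₜ[k] F b) =
      map (map (F : B →ₗ[k] A) (F : B →ₗ[k] A)) (map (F : B →ₗ[k] A) (F : B →ₗ[k] A))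
        (Coalgebra.comul (R := k) (a ⊗ₜ[k] b)) :=
    (CoalgHomClass.map_comp_comul_apply
      (Coalgebra.TensorProduct.map (F : B →ₗc[k] A) (F : B →ₗc[k] A)) (a ⊗ₜ[k] b)).symm
  rw [hΔ, TensorProduct.map_map, LinearMap.comp_assoc, LinearMap.comp_assoc,
    TensorProduct.map_comp_comm_eq]

end FormGroupLike

/-! ### The principal block -/

section Block

open TensorProduct (map)
open MonoidAlgebra (single)
open WithConv

variable {k : Type v} [Field k] {A : Type u} [Ring A] [HopfAlgebra k A] {G : Type u} [Group G]
  {V : Type u} [Quiver.{u} V] {R : GroupRetract k A G} {j : A →ₗc[k] PathCoalgebra k V} {ν : G → V}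

lemma groupLift_pi_single {G : Type*} [DecidableEq G] (g : G) (t : MonoidAlgebra k G) :
    groupLift (Pi.single g (1 : k)) t = t.coeff g := by
  refine LinearMap.congr_fun (f := groupLift (Pi.single g (1 : k)))
    (g := Finsupp.lapply g ∘ₗ (MonoidAlgebra.coeffLinearEquiv k).toLinearMap)
    (MonoidAlgebra.lhom_ext' fun x => LinearMap.ext_ring ?_) t
  change groupLift (Pi.single g (1 : k)) (single x (1 : k)) = (single x (1 : k)).coeff g
  by_cases hx : x = g
  · subst hx; simp
  · simp [hx]

lemma groupAlgebra_eq_zero {G : Type*} {t : MonoidAlgebra k G}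
    (h : ∀ f : G → k, groupLift f t = 0) : t = 0 := by
  classical
  ext g
  rw [← groupLift_pi_single, h]
  rfl

lemma groupChar_ι (R : GroupRetract k A G) (f : G → k) (g : G) :
    groupChar R.π f (R.ι g) = f g := by
  rw [groupChar_apply, R.proj, groupLift_single, one_smul]

lemma ι_mul_ne_zero (R : GroupRetract k A G) (g : G) {x : A} (hx : x ≠ 0) : R.ι g * x ≠ 0 := by
  intro h
  apply hx
  have := congrArg (R.ι g⁻¹ * ·) h
  simpa [← mul_assoc, ← map_mul] using this

namespace IsQuiverRealization

lemma vertex_injective (h : IsQuiverRealization R j ν) : Function.Injective ν := by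
  intro g g' hg
  refine R.ι_injective (h.injective ?_)
  rw [h.vertex, h.vertex, hg]

/-- For a vertex x outside the image of `ν` the indicator of x would induce the zero functional on
A, although x itself lies in the image of `j`. -/
lemma vertex_surjective (h : IsQuiverRealization R j ν) : Function.Surjective ν := by
  classical
  intro x
  by_contra hx
  obtain ⟨a, ha⟩ := h.large x x Quiver.Path.nil (Nat.zero_le 1)
  have h1 := LinearMap.congr_fun (h.char (Pi.single x 1)) a
  have h2 : (Pi.single x 1 : V → k) ∘ ν = 0 := by
    refine funext fun g => ?_
    rw [Function.comp_apply, Pi.single_eq_of_ne (fun hg => hx ⟨g, hg⟩)]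
    rfl
  have h3 : groupLift (0 : G → k) = (0 : MonoidAlgebra k G →ₗ[k] k) :=
    MonoidAlgebra.lhom_ext' fun x => LinearMap.ext_ring (by
      change groupLift (0 : G → k) (single x (1 : k)) = 0
      simp)
  rw [h2, groupChar, h3, LinearMap.zero_comp] at h1
  change vertexFun (Pi.single x 1) (j a) = 0 at h1
  rw [ha, vertexFun_pathElt] at h1
  simp at h1

/-- A function constant along arrows has the same value at the source and the target of every path.
-/
lemma rhit_eq_lhit (h : IsQuiverRealization R j ν) {f : V → k}
    (hf : ∀ (x y : V) (_ : x ⟶ y), f x = f y) (a : A) :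
    rhit (groupChar R.π (f ∘ ν)) a = lhit (groupChar R.π (f ∘ ν)) a := by
  apply h.injective
  rw [← h.char, map_rhit, map_lhit, rhit_vertexFun_eq_lhit hf]

/-- x is the preimage of the arrow. It is killed by the projection because every function on G comes
from a function on vertices, whose functional vanishes on arrows. -/
lemma exists_skewPrimitive (h : IsQuiverRealization R j ν) {g g' : G} (e : ν g ⟶ ν g') :
    ∃ x : A, x ≠ 0 ∧ Coalgebra.comul (R := k) x = R.ι g' ⊗ₜ x + x ⊗ₜ R.ι g ∧ R.π x = 0 := by
  obtain ⟨x, hx⟩ := h.large _ _ e.toPath (le_refl 1)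
  refine ⟨x, ?_, ?_, ?_⟩
  · rintro rfl
    rw [map_zero] at hx
    have : pathElt k e.toPath = Finsupp.single (⟨_, _, e.toPath⟩ : QPath V) (1 : k) := rfl
    rw [this] at hx
    exact Finsupp.single_ne_zero.2 one_ne_zero hx.symm
  · refine map_injective_of_injective (f := j.toLinearMap) (g := j.toLinearMap) h.injective
      h.injective ?_
    have h1 : map j.toLinearMap j.toLinearMap (Coalgebra.comul (R := k) x) =
      Coalgebra.comul (R := k) (j x) := CoalgHomClass.map_comp_comul_apply j x
    rw [h1, hx, comul_pathElt, map_add, TensorProduct.map_tmul, TensorProduct.map_tmul]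
    change _ = j (R.ι g') ⊗ₜ[k] j x + j x ⊗ₜ[k] j (R.ι g)
    rw [hx, h.vertex, h.vertex]
    simp [pathComul, Quiver.Hom.toPath, pathSplits]
  · refine groupAlgebra_eq_zero fun f => ?_
    have h1 := LinearMap.congr_fun (h.char (f ∘ Function.invFun ν)) x
    rw [Function.comp_assoc, Function.invFun_comp h.vertex_injective, Function.comp_id,
      groupChar_apply] at h1
    rw [← h1]
    change vertexFun _ (j x) = 0
    rw [hx, vertexFun_pathElt]
    simp

/-- If x belongs to an arrow g → g', then ι(y)x is nonzero, skew-primitive between yg and yg', and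
killed by the projection. Left and right hits with the indicator of a component agree on it, so the
indicator takes equal values at yg and yg'; no arrow between these two is needed. -/
lemma component_mul_left (h : IsQuiverRealization R j ν) (y : G) {g g' : G}
    (hg : Quiver.WeaklyConnectedComponent.mk (ν g) = Quiver.WeaklyConnectedComponent.mk (ν g')) :
    Quiver.WeaklyConnectedComponent.mk (ν (y * g)) =
      Quiver.WeaklyConnectedComponent.mk (ν (y * g')) := by
  have hinv : ∀ g, Function.invFun ν (ν g) = g := Function.leftInverse_invFun h.vertex_injective
  have key := component_eq_of_arrow
    (fun v => Quiver.WeaklyConnectedComponent.mk (ν (y * Function.invFun ν v))) ?_ hg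
  · simpa only [hinv] using key
  · intro v w e
    obtain ⟨g, rfl⟩ := h.vertex_surjective v
    obtain ⟨g', rfl⟩ := h.vertex_surjective w
    simp only [hinv]
    obtain ⟨x, hx, hΔ, hπ⟩ := h.exists_skewPrimitive e
    set f := componentInd k (ν (y * g)) with hf
    have h1 := h.rhit_eq_lhit (componentInd_arrow (k := k) (ν (y * g))) (R.ι y * x)
    have h2 : Coalgebra.comul (R := k) (R.ι y * x) =
        R.ι (y * g') ⊗ₜ (R.ι y * x) + (R.ι y * x) ⊗ₜ R.ι (y * g) := by
      rw [Bialgebra.comul_mul, (R.groupLike y).comul_eq_tmul_self, hΔ, mul_add,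
        Algebra.TensorProduct.tmul_mul_tmul, Algebra.TensorProduct.tmul_mul_tmul, map_mul, map_mul]
    have h3 : ∀ f, groupChar R.π f (R.ι y * x) = 0 := fun f => by
      rw [groupChar_apply, map_mul, hπ, mul_zero, map_zero]
    rw [rhit_apply, lhit_apply, h2] at h1
    simp only [map_add, TensorProduct.map_tmul, TensorProduct.rid_tmul, TensorProduct.lid_tmul, h3,
      LinearMap.id_apply, groupChar_ι, zero_smul, zero_add, add_zero, Function.comp_apply] at h1
    have h4 := smul_left_injective k (ι_mul_ne_zero R y hx) h1
    rw [componentInd, componentInd, if_pos rfl] at h4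
    by_contra hne
    rw [if_neg (Ne.symm hne)] at h4
    exact one_ne_zero h4

/-- The elements of `G` in the connected component of the unit. -/
def unitComponent (h : IsQuiverRealization R j ν) : Subgroup G where
  carrier := {g | Quiver.WeaklyConnectedComponent.mk (ν g) =
    Quiver.WeaklyConnectedComponent.mk (ν 1)}
  one_mem' := rfl
  mul_mem' {a b} ha hb := by
    have := h.component_mul_left a hb
    rw [mul_one] at this
    exact this.trans ha
  inv_mem' {a} ha := by
    have := h.component_mul_left a⁻¹ ha
    rw [mul_one, inv_mul_cancel] at this
    exact this.symm

lemma mem_unitComponent (h : IsQuiverRealization R j ν) {g : G} : g ∈ h.unitComponent ↔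
    Quiver.WeaklyConnectedComponent.mk (ν g) = Quiver.WeaklyConnectedComponent.mk (ν 1) := Iff.rfl

variable {r : A ⊗[k] A →ₗ[k] k} {r₀ : MonoidAlgebra k G ⊗[k] MonoidAlgebra k G →ₗ[k] k}

lemma mul_comm_of_form (hr : IsCoquasitriangular r) (R : GroupRetract k A G) (g g' : G) :
    g * g' = g' * g := by
  apply R.ι_injective
  rw [map_mul, map_mul, hr.groupLike_comm (R.groupLike g) (R.groupLike g')]

/-- The symmetrized form is trivial on the connected component of the unit. -/
lemma form_mul_form (h : IsQuiverRealization R j ν) (hr : IsCoquasitriangular r)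
    (hr₀ : ∀ a b, r (a ⊗ₜ b) = r₀ (R.π a ⊗ₜ R.π b)) {g : G} (hg : g ∈ h.unitComponent) (y : G) :
    r (R.ι g ⊗ₜ R.ι y) * r (R.ι y ⊗ₜ R.ι g) = 1 := by
  have hinv : ∀ g, Function.invFun ν (ν g) = g := Function.leftInverse_invFun h.vertex_injective
  have key := component_eq_of_arrow
    (fun v => r (R.ι (Function.invFun ν v) ⊗ₜ R.ι y) * r (R.ι y ⊗ₜ R.ι (Function.invFun ν v)))
    ?_ (h.mem_unitComponent.1 hg)
  · simp only [hinv] at key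
    rw [key, map_one, hr.one_groupLike (R.groupLike y), hr.groupLike_one (R.groupLike y), mul_one]
  · intro v w e
    obtain ⟨g, rfl⟩ := h.vertex_surjective v
    obtain ⟨g', rfl⟩ := h.vertex_surjective w
    simp only [hinv]
    obtain ⟨x, hx, hΔ, hπ⟩ := h.exists_skewPrimitive e
    -- The projection kills x, hence so does the form. The two commutation relations express xy
    -- through yx with reciprocal factors; combining them compares two multiples of the nonzero
    -- element yx.
    have h1 := hr.skewPrimitive_comm_left hΔ (R.groupLike y) (by rw [hr₀, hπ]; simp)
    have h2 := hr.skewPrimitive_comm_right hΔ (R.groupLike y) (by rw [hr₀, hπ]; simp)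
    have h3 := congrArg (r (R.ι y ⊗ₜ R.ι g) • ·) h1
    simp only [smul_comm _ (r (R.ι g' ⊗ₜ R.ι y)), h2, smul_smul] at h3
    have h4 := smul_left_injective k (ι_mul_ne_zero R y hx) h3
    simpa [mul_comm] using h4

/-- The cotriangularity identity holds for elements that only meet the component of the unit. -/
lemma skew (h : IsQuiverRealization R j ν) (hr : IsCoquasitriangular r)
    (hr₀ : ∀ a b, r (a ⊗ₜ b) = r₀ (R.π a ⊗ₜ R.π b)) {a : A}
    (ha : ∀ f : G → k, (∀ g ∈ h.unitComponent, f g = 1) →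
      groupChar R.π f a = Coalgebra.counit (R := k) a) (b : A) :
    LinearMap.mul' k k (map r (r ∘ₗ (TensorProduct.comm k A A).toLinearMap)
      (Coalgebra.comul (R := k) (a ⊗ₜ[k] b))) =
    Coalgebra.counit (R := k) a * Coalgebra.counit (R := k) b := by
  have h1 : r = r₀ ∘ₗ map (R.π : A →ₗ[k] MonoidAlgebra k G) (R.π : A →ₗ[k] MonoidAlgebra k G) :=
    TensorProduct.ext' hr₀
  have h2 := skew_comp R.π r₀ a b
  rw [← h1] at h2
  rw [h2]
  set S₀ : MonoidAlgebra k G ⊗[k] MonoidAlgebra k G →ₗ[k] k := LinearMap.mul' k k ∘ₗ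
    map r₀ (r₀ ∘ₗ (TensorProduct.comm k _ _).toLinearMap) ∘ₗ Coalgebra.comul (R := k) with hS₀
  have h3 : ∀ g y, S₀ (single g 1 ⊗ₜ single y 1) =
      r (R.ι g ⊗ₜ R.ι y) * r (R.ι y ⊗ₜ R.ι g) := by
    intro g y
    rw [hS₀, LinearMap.comp_apply, LinearMap.comp_apply,
      comul_tmul_groupLike (MonoidAlgebra.isGroupLikeElem_single_one g)
        (MonoidAlgebra.isGroupLikeElem_single_one y), hr₀, hr₀, R.proj, R.proj]
    simp
  have h4 : (TensorProduct.curry S₀ (R.π a)) = Coalgebra.counit (R := k) a • Coalgebra.counit := by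
    refine MonoidAlgebra.lhom_ext' fun y => LinearMap.ext_ring ?_
    change S₀ (R.π a ⊗ₜ single y (1 : k)) =
      Coalgebra.counit (R := k) a * Coalgebra.counit (R := k) (single y (1 : k))
    -- For fixed y this functional is induced by g ↦ r(g, y) r(y, g), which is 1 on the component of
    -- the unit; so `ha` evaluates it at a.
    have h5 : (TensorProduct.curry S₀).flip (single y 1) =
        groupLift fun g => r (R.ι g ⊗ₜ R.ι y) * r (R.ι y ⊗ₜ R.ι g) := by
      refine MonoidAlgebra.lhom_ext' fun g => LinearMap.ext_ring ?_
      change S₀ (single g (1 : k) ⊗ₜ single y (1 : k)) = groupLift _ (single g (1 : k))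
      rw [h3, groupLift_single, one_smul]
    refine (LinearMap.congr_fun h5 (R.π a)).trans ?_
    rw [← groupChar_apply, ha _ fun g hg => h.form_mul_form hr hr₀ hg y]
    simp
  refine (LinearMap.congr_fun h4 (R.π b)).trans ?_
  rw [LinearMap.smul_apply, smul_eq_mul, CoalgHomClass.counit_comp_apply]

/-- If the quiver is connected then the form is cotriangular. -/
theorem isCotriangular_of_connected (h : IsQuiverRealization R j ν) (hr : IsCoquasitriangular r)
    (hr₀ : ∀ a b, r (a ⊗ₜ b) = r₀ (R.π a ⊗ₜ R.π b)) (hV : IsConnectedQuiver V) :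
    IsCotriangular r where
  toIsCoquasitriangular := hr
  skew a b := by
    refine h.skew hr hr₀ (fun f hf => ?_) b
    have : f = 1 := funext fun g => hf g (h.mem_unitComponent.2 (hV.2 _ _))
    rw [this, groupChar_one]

/-- The principal block is a cotriangular Hopf subalgebra, over which `A` is a crossed product. -/
theorem exists_block (h : IsQuiverRealization R j ν) (hr : IsCoquasitriangular r)
    (hr₀ : ∀ a b, r (a ⊗ₜ b) = r₀ (R.π a ⊗ₜ R.π b)) :
    ∃ (D : Type u) (_ : Ring D) (_ : HopfAlgebra k D) (i : D →ₐc[k] A),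
      Function.Injective i ∧ LinearMap.range (i : D →ₗ[k] A) = blockAt j (ν 1) ∧
      IsCotriangular (r ∘ₗ map (i : D →ₗ[k] A) (i : D →ₗ[k] A)) ∧
      ∃ (Γ : Type u) (_ : Group Γ) (S : CrossedSystem k D Γ)
        (Φ : (D ⊗[k] MonoidAlgebra k Γ) ≃ₗc[k] A),
        IsCrossedProduct r (r ∘ₗ map (i : D →ₗ[k] A) (i : D →ₗ[k] A)) i S Φ := by
  classical
  let N := h.unitComponent
  -- Normality is automatic, as the existence of the form makes G commutative.
  have hN : N.Normal := ⟨fun n hn g => by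
    rwa [mul_comm_of_form hr R g n, mul_inv_cancel_right]⟩
  let q : G →* G ⧸ N := QuotientGroup.mk' N
  let ϖ : A →ₐc[k] MonoidAlgebra k (G ⧸ N) := (MonoidAlgebra.mapDomainBialgHom k q).comp R.π
  have hchar : ∀ f : G ⧸ N → k, groupChar ϖ f = groupChar R.π (f ∘ q) := by
    intro f
    have : groupLift f ∘ₗ ((MonoidAlgebra.mapDomainBialgHom k q : MonoidAlgebra k G →ₐc[k]
        MonoidAlgebra k (G ⧸ N)) : MonoidAlgebra k G →ₗ[k] MonoidAlgebra k (G ⧸ N)) =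
        groupLift (f ∘ q) := by
      refine MonoidAlgebra.lhom_ext' fun g => LinearMap.ext_ring ?_
      change groupLift f (MonoidAlgebra.mapDomainBialgHom k q (single g (1 : k))) =
        groupLift (f ∘ q) (single g (1 : k))
      rw [MonoidAlgebra.mapDomainBialgHom_single, groupLift_single, groupLift_single]
      rfl
    rw [groupChar, groupChar, ← this]
    rfl
  have hind : (Pi.single 1 1 : G ⧸ N → k) ∘ q = componentInd k (ν 1) ∘ ν := by
    refine funext fun g => ?_
    have : q g = 1 ↔ g ∈ N := QuotientGroup.eq_one_iff g
    rw [Function.comp_apply, Function.comp_apply, componentInd, Pi.single_apply]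
    exact if_congr (this.trans h.mem_unitComponent) rfl rfl
  -- Left and right coactions agree because f ∘ q is constant along arrows: for an arrow g → g' the
  -- element g⁻¹g' lies in the component of the unit.
  have hD := isHopfSubalgebra_coinv ϖ (coact_eq_of_hit ϖ fun f a => by
    have hf : f ∘ q = (f ∘ q ∘ Function.invFun ν) ∘ ν := by
      rw [Function.comp_assoc, Function.comp_assoc, Function.invFun_comp h.vertex_injective,
        Function.comp_id]
    rw [hchar, hf]
    refine h.rhit_eq_lhit (fun x y e => congrArg f ?_) a
    obtain ⟨g, rfl⟩ := h.vertex_surjective x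
    obtain ⟨g', rfl⟩ := h.vertex_surjective y
    rw [Function.comp_apply, Function.comp_apply, Function.leftInverse_invFun h.vertex_injective,
      Function.leftInverse_invFun h.vertex_injective]
    refine QuotientGroup.eq.2 (h.mem_unitComponent.2 ?_)
    have := h.component_mul_left g⁻¹ (component_arrow e)
    rw [inv_mul_cancel] at this
    exact this.symm)
  obtain ⟨D, _, _, i, hi, hrange⟩ := hD.exists_bialgHom
  have hmem : ∀ a, (∃ d, i d = a) ↔ a ∈ coinv ϖ := fun a => by
    rw [← Subalgebra.mem_toSubmodule, ← hrange]
    rfl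
  refine ⟨D, inferInstance, inferInstance, i, hi, ?_, ⟨?_, ?_⟩, G ⧸ N, inferInstance, ?_⟩
  -- Both the coinvariants and the block consist of the elements fixed by the right hit with the
  -- indicator of the unit component.
  · rw [hrange]
    ext a
    rw [Subalgebra.mem_toSubmodule, mem_coinv_iff, hchar, hind, blockAt, Submodule.mem_comap]
    change _ ↔ j a ∈ componentSpan k (ν 1)
    rw [mem_componentSpan_iff, ← map_rhit, h.char]
    exact h.injective.eq_iff.symm
  · exact hr.comp i (braided_comm_comp i hi hr.braided_comm)
  · intro a b
    rw [skew_comp, h.skew hr hr₀, CoalgHomClass.counit_comp_apply, CoalgHomClass.counit_comp_apply]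
    intro f hf
    -- With χ the indicator of N, an element a of the block satisfies a = a₁χ(a₂), so that χ(a) =
    -- ε(a). If f = 1 on N then fχ = χ and f(a) = (fχ)(a) = χ(a) = ε(a).
    have ha := (mem_coinv_iff ϖ).1 ((hmem _).1 ⟨a, rfl⟩)
    have h1 : f * ((Pi.single 1 1 : G ⧸ N → k) ∘ q) = (Pi.single 1 1 : G ⧸ N → k) ∘ q := by
      refine funext fun g => ?_
      have : q g = 1 ↔ g ∈ N := QuotientGroup.eq_one_iff g
      rw [Pi.mul_apply, Function.comp_apply, Pi.single_apply]
      split_ifs with hg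
      · rw [hf g (this.1 hg), one_mul]
      · rw [mul_zero]
    rw [hchar] at ha
    have h2 := apply_rhit (toConv (groupChar R.π f))
      (toConv (groupChar R.π ((Pi.single 1 1 : G ⧸ N → k) ∘ q))) (i a)
    rw [groupChar_mul, h1] at h2
    change groupChar R.π f (rhit (groupChar R.π ((Pi.single 1 1 : G ⧸ N → k) ∘ q)) (i a)) =
      groupChar R.π ((Pi.single 1 1 : G ⧸ N → k) ∘ q) (i a) at h2
    rw [ha, ← counit_rhit (groupChar R.π ((Pi.single 1 1 : G ⧸ N → k) ∘ q)), ha] at h2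
    exact h2
  -- The representative of the trivial coset is chosen to be 1 in order that the cocycle be
  -- normalized.
  · let s : G ⧸ N → G := fun x => if x = 1 then 1 else x.out
    have hs : ∀ x, q (s x) = x := by
      intro x
      by_cases hx : x = 1
      · simp [s, hx]
      · simp only [s, if_neg hx]
        exact Quotient.out_eq' x
    let σ : GroupSection ϖ :=
      { u := fun x => R.ι.toHomUnits (s x)
        u_one := by simp [s]
        groupLike := fun x => R.groupLike _
        proj := fun x => by
          change MonoidAlgebra.mapDomainBialgHom k q (R.π (R.ι (s x))) = _
          rw [R.proj, MonoidAlgebra.mapDomainBialgHom_single, hs] }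
    exact σ.exists_isCrossedProduct i hi hmem hr

end IsQuiverRealization

end Block

/-! ### Coalgebra maps into a path coalgebra -/

section PathMaps

open TensorProduct (map)
open WithConv

variable {k : Type v} [Field k] {V : Type u} [Quiver.{u} V]

section PathVal

variable {W : Type*} [Ring W]

/-- The product of the values of the arrows of a path. -/
def pathVal (t : V → W) (arr : ∀ x y : V, (x ⟶ y) → W) : {x y : V} → Quiver.Path x y → W
  | x, _, .nil => t x
  | _, _, .cons p e => arr _ _ e * pathVal t arr p

@[simp] lemma pathVal_nil (t : V → W) (arr : ∀ x y : V, (x ⟶ y) → W) (x : V) :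
    pathVal t arr (Quiver.Path.nil : Quiver.Path x x) = t x := by
  rw [pathVal]

/-- Orthogonal idempotents for the vertices of a quiver, with compatible elements for the
arrows. -/
structure IsQuiverRep (t : V → W) (arr : ∀ x y : V, (x ⟶ y) → W) : Prop where
  idem : ∀ x, t x * t x = t x
  orth : ∀ x y, x ≠ y → t x * t y = 0
  left : ∀ x y (e : x ⟶ y), t y * arr x y e = arr x y e
  right : ∀ x y (e : x ⟶ y), arr x y e * t x = arr x y e

namespace IsQuiverRep

variable {t : V → W} {arr : ∀ x y : V, (x ⟶ y) → W}

lemma mul_pathVal (h : IsQuiverRep t arr) {x y : V} (p : Quiver.Path x y) :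
    t y * pathVal t arr p = pathVal t arr p := by
  cases p with
  | nil => rw [pathVal_nil, h.idem]
  | cons p e => rw [pathVal, ← mul_assoc, h.left]

lemma pathVal_mul (h : IsQuiverRep t arr) {x y : V} (p : Quiver.Path x y) :
    pathVal t arr p * t x = pathVal t arr p := by
  induction p with
  | nil => rw [pathVal_nil, h.idem]
  | cons p e ih => rw [pathVal, mul_assoc, ih]

lemma pathVal_comp (h : IsQuiverRep t arr) {x y z : V} (p : Quiver.Path x y)
    (q : Quiver.Path y z) : pathVal t arr q * pathVal t arr p = pathVal t arr (p.comp q) := by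
  induction q with
  | nil => rw [pathVal_nil, h.mul_pathVal, Quiver.Path.comp_nil]
  | cons q e ih => rw [pathVal, mul_assoc, ih, Quiver.Path.comp_cons, pathVal]

lemma pathVal_mul_eq_zero (h : IsQuiverRep t arr) {x y y' z : V} (p : Quiver.Path x y)
    (q : Quiver.Path y' z) (hy : y' ≠ y) : pathVal t arr q * pathVal t arr p = 0 := by
  rw [← h.pathVal_mul q, ← h.mul_pathVal p, mul_assoc, ← mul_assoc (t y'), h.orth _ _ hy, zero_mul,
    mul_zero]

end IsQuiverRep

end PathVal

/-- The coefficient of a path. -/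
def pathCoord (k : Type v) [Field k] (p : QPath V) : PathCoalgebra k V →ₗ[k] k :=
  (Finsupp.lapply p : (QPath V →₀ k) →ₗ[k] k)

lemma pathCoord_self {x y : V} (p : Quiver.Path x y) :
    pathCoord k ⟨x, y, p⟩ (pathElt k p) = 1 := Finsupp.single_eq_same

lemma pathCoord_ne {x y : V} {p : Quiver.Path x y} {q : QPath V} (h : q ≠ ⟨x, y, p⟩) :
    pathCoord k q (pathElt k p) = 0 := Finsupp.single_eq_of_ne h

lemma pathCoord_ext {b b' : PathCoalgebra k V} (h : ∀ p, pathCoord k p b = pathCoord k p b') :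
    b = b' := Finsupp.ext h

lemma tensor_pathCoord_ext {t t' : PathCoalgebra k V ⊗[k] PathCoalgebra k V}
    (h : ∀ q p, LinearMap.mul' k k (map (pathCoord k q) (pathCoord k p) t) =
      LinearMap.mul' k k (map (pathCoord k q) (pathCoord k p) t')) : t = t' := by
  let e : PathCoalgebra k V ⊗[k] PathCoalgebra k V ≃ₗ[k] (QPath V × QPath V →₀ k) :=
    finsuppTensorFinsupp' k (QPath V) (QPath V)
  have he : ∀ t q p, e t (q, p) = LinearMap.mul' k k (map (pathCoord k q) (pathCoord k p) t) := by
    intro t q p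
    induction t with
    | zero => simp
    | add x y hx hy => rw [map_add, Finsupp.add_apply, hx, hy, map_add, map_add]
    | tmul x y => exact finsuppTensorFinsupp'_apply_apply k _ _ x y q p
  apply e.injective
  ext ⟨q, p⟩
  rw [he, he, h]

lemma conv_vertexFun (c : PathCoalgebra k V →ₗ[k] k) (f : V → k) {x y : V}
    (p : Quiver.Path x y) :
    (toConv c * toConv (vertexFun f)).ofConv (pathElt k p) = f x * c (pathElt k p) := by
  have := apply_rhit (toConv c) (toConv (vertexFun f)) (pathElt k p)
  rw [← this]
  change c (rhit (vertexFun f) (pathElt k p)) = _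
  rw [rhit_vertexFun, map_smul, smul_eq_mul]

lemma vertexFun_conv (c : PathCoalgebra k V →ₗ[k] k) (f : V → k) {x y : V}
    (p : Quiver.Path x y) :
    (toConv (vertexFun f) * toConv c).ofConv (pathElt k p) = f y * c (pathElt k p) := by
  have := apply_lhit (toConv (vertexFun f)) (toConv c) (pathElt k p)
  rw [← this]
  change c (lhit (vertexFun f) (pathElt k p)) = _
  rw [lhit_vertexFun, map_smul, smul_eq_mul]

/-- The coefficient of the trivial path at a vertex. -/
abbrev vertexCoord (k : Type v) [Field k] (x : V) : WithConv (PathCoalgebra k V →ₗ[k] k) :=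
  toConv (pathCoord k ⟨x, x, Quiver.Path.nil⟩)

/-- The coefficient of an arrow. -/
abbrev arrowCoord (k : Type v) [Field k] (x y : V) (e : x ⟶ y) :
    WithConv (PathCoalgebra k V →ₗ[k] k) :=
  toConv (pathCoord k ⟨x, y, e.toPath⟩)

lemma pathCoord_nil [DecidableEq V] (x : V) :
    pathCoord k (⟨x, x, Quiver.Path.nil⟩ : QPath V) = vertexFun (Pi.single x 1) := by
  refine pathHom_ext fun a b p => ?_
  rw [vertexFun_pathElt]
  cases p with
  | nil =>
    by_cases h : a = x
    · subst h
      rw [pathCoord_self]; simp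
    · rw [pathCoord_ne]
      · simp [h]
      · intro h'
        exact h (congrArg Sigma.fst h').symm
  | cons p e =>
    rw [pathCoord_ne, if_neg (by simp)]
    intro h'
    have := congrArg (fun p : QPath V => p.2.2.length) h'
    simp at this

/-- The universal example. With `pathCoord_cons` it shows that the coordinate of a path is the
convolution product of the coordinates of its arrows (`pathVal_coord`). -/
lemma isQuiverRep_pathCoord : IsQuiverRep (V := V) (vertexCoord k) (arrowCoord k) := by
  classical
  refine ⟨fun x => ?_, fun x y hxy => ?_, fun x y e => ?_, fun x y e => ?_⟩ <;>
    apply WithConv.ofConv_injective <;> refine pathHom_ext fun a b p => ?_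
  · rw [vertexCoord, pathCoord_nil, conv_vertexFun]
    change _ = vertexFun _ _
    rw [vertexFun_pathElt]
    by_cases h : a = x
    · subst h; simp
    · simp [h]
  · rw [vertexCoord, vertexCoord, pathCoord_nil, pathCoord_nil, conv_vertexFun, vertexFun_pathElt]
    change _ = (0 : k)
    by_cases h : a = y
    · subst h; simp [hxy.symm]
    · simp [h]
  · rw [vertexCoord, pathCoord_nil, vertexFun_conv]
    change _ = pathCoord k _ _
    by_cases h : (⟨x, y, e.toPath⟩ : QPath V) = ⟨a, b, p⟩
    · have : b = y := (congrArg (fun p : QPath V => p.2.1) h).symm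
      simp [this]
    · rw [pathCoord_ne h, mul_zero]
  · rw [vertexCoord, pathCoord_nil, conv_vertexFun]
    change _ = pathCoord k _ _
    by_cases h : (⟨x, y, e.toPath⟩ : QPath V) = ⟨a, b, p⟩
    · have : a = x := (congrArg (fun p : QPath V => p.1) h).symm
      simp [this]
    · rw [pathCoord_ne h, mul_zero]

lemma conv_apply_pathElt (c d : PathCoalgebra k V →ₗ[k] k) {x y : V} (p : Quiver.Path x y) :
    (toConv c * toConv d).ofConv (pathElt k p) =
      ((pathSplits p).map fun s => c (pathElt k s.2.2) * d (pathElt k s.2.1)).sum := by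
  change LinearMap.mul' k k (map c d (Coalgebra.comul (R := k) (pathElt k p))) = _
  rw [comul_pathElt, pathComul, map_list_sum, map_list_sum, List.map_map, List.map_map]
  rfl

/-- Among the splittings of a path only the one that cuts off the last arrow has a left factor of
length 1. -/
lemma pathCoord_cons {x y z : V} (p : Quiver.Path x y) (e : y ⟶ z) :
    toConv (pathCoord k ⟨x, z, p.cons e⟩) =
      arrowCoord k y z e * toConv (pathCoord k ⟨x, y, p⟩) := by
  apply WithConv.ofConv_injective
  refine pathHom_ext fun a b w => ?_
  rw [arrowCoord, conv_apply_pathElt]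
  change pathCoord k _ _ = _
  have hlen : ∀ {a b : V} (w : Quiver.Path a b), w.length ≠ 1 →
      pathCoord k (⟨y, z, e.toPath⟩ : QPath V) (pathElt k w) = 0 := by
    intro a b w hw
    refine pathCoord_ne fun h => hw ?_
    have := congrArg (fun p : QPath V => p.2.2.length) h
    exact this.symm
  have hnil : ∀ a : V, pathCoord k (⟨y, z, e.toPath⟩ : QPath V)
      (pathElt k (Quiver.Path.nil : Quiver.Path a a)) = 0 := fun a => hlen _ (by simp)
  have hcc : ∀ {a b c d : V} (w : Quiver.Path a b) (e₁ : b ⟶ c) (e₂ : c ⟶ d),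
      pathCoord k (⟨y, z, e.toPath⟩ : QPath V) (pathElt k ((w.cons e₁).cons e₂)) = 0 :=
    fun w e₁ e₂ => hlen _ (by simp)
  cases w with
  | nil =>
    rw [pathCoord_ne]
    · simp only [pathSplits, List.map_cons, List.map_nil, List.sum_cons, List.sum_nil, hnil,
        zero_mul, add_zero]
    · intro h'
      have := congrArg (fun p : QPath V => p.2.2.length) h'
      simp at this
  | @cons c _ w e' =>
    have h1 : ((pathSplits (w.cons e')).map fun s =>
        pathCoord k (⟨y, z, e.toPath⟩ : QPath V) (pathElt k s.2.2) *
          pathCoord k (⟨x, y, p⟩ : QPath V) (pathElt k s.2.1)).sum =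
        pathCoord k (⟨y, z, e.toPath⟩ : QPath V) (pathElt k e'.toPath) *
          pathCoord k (⟨x, y, p⟩ : QPath V) (pathElt k w) := by
      cases w with
      | nil =>
        simp only [pathSplits, List.map_cons, List.map_nil, List.sum_cons, List.sum_nil, hnil,
          zero_mul, add_zero, zero_add]
        rfl
      | cons w e'' =>
        simp only [pathSplits, List.map_cons, List.map_map, List.sum_cons, hnil, hcc, zero_mul,
          zero_add, Function.comp_def, List.map_const', List.sum_replicate, smul_zero, add_zero]
        rfl
    rw [h1]
    by_cases h2 : (⟨x, y, p⟩ : QPath V) = ⟨a, c, w⟩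
    · cases h2
      rw [pathCoord_self, mul_one]
      by_cases h3 : (⟨y, z, e.toPath⟩ : QPath V) = ⟨y, b, e'.toPath⟩
      · cases h3
        rw [pathCoord_self, pathCoord_self]
      · rw [pathCoord_ne h3, pathCoord_ne]
        intro h4
        apply h3
        cases h4
        rfl
    · rw [pathCoord_ne h2, mul_zero, pathCoord_ne]
      intro h3
      apply h2
      cases h3
      rfl

lemma pathVal_coord {x y : V} (p : Quiver.Path x y) :
    pathVal (vertexCoord k) (arrowCoord k) p = toConv (pathCoord k ⟨x, y, p⟩) := by
  induction p with
  | nil => exact pathVal_nil _ _ _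
  | cons p e ih => rw [pathVal, ih, pathCoord_cons]

/-- The counit is the sum of all vertex coordinates. There may be infinitely many vertices, so the
sum is expressed by stationarity over large finite sets. -/
lemma exists_sum_vertexCoord (b : PathCoalgebra k V) : ∃ S : Finset V, ∀ S', S ⊆ S' →
    ∑ x ∈ S', (vertexCoord k x).ofConv b = Coalgebra.counit (R := k) b := by
  classical
  have h : ∀ b : QPath V →₀ k, ∃ S : Finset V, ∀ S', S ⊆ S' →
    ∑ x ∈ S', pathCoord k (⟨x, x, Quiver.Path.nil⟩ : QPath V) b =
      Coalgebra.counit (R := k) (A := PathCoalgebra k V) b := by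
    intro b
    induction b using Finsupp.induction_linear with
    | zero => exact ⟨∅, fun S' _ => by
        exact (Finset.sum_eq_zero fun x _ => map_zero _).trans (map_zero _).symm⟩
    | add b b' hb hb' =>
      obtain ⟨S, hS⟩ := hb
      obtain ⟨T, hT⟩ := hb'
      refine ⟨S ∪ T, fun S' hS' => ?_⟩
      refine Eq.trans ?_ (map_add (Coalgebra.counit (R := k) (A := PathCoalgebra k V)) b b').symm
      exact (Finset.sum_congr rfl fun x _ => map_add (pathCoord k _) b b').trans
        (Finset.sum_add_distrib.trans (congrArg₂ (· + ·)
          (hS S' (Finset.union_subset_left hS')) (hT S' (Finset.union_subset_right hS'))))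
    | single p c =>
      obtain ⟨x, y, p⟩ := p
      refine ⟨{x}, fun S' hS' => ?_⟩
      have h1 : (Finsupp.single (⟨x, y, p⟩ : QPath V) c : PathCoalgebra k V) =
          c • pathElt k p := by
        change _ = c • Finsupp.single (⟨x, y, p⟩ : QPath V) (1 : k)
        rw [Finsupp.smul_single, smul_eq_mul, mul_one]
      have h2 : ∑ a ∈ S', pathCoord k (⟨a, a, Quiver.Path.nil⟩ : QPath V) (pathElt k p) =
          Coalgebra.counit (R := k) (pathElt k p) := by
        simp_rw [pathCoord_nil, vertexFun_pathElt]
        rw [counit_pathElt]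
        split_ifs with h3
        · simp only [Pi.single_apply]
          rw [Finset.sum_ite_eq, if_pos (hS' (Finset.mem_singleton_self x))]
        · simp
      rw [h1]
      refine Eq.trans ?_ (map_smul (Coalgebra.counit (R := k) (A := PathCoalgebra k V)) c _).symm
      rw [← h2, Finset.smul_sum]
      exact Finset.sum_congr rfl fun x _ => map_smul _ _ _
  exact h b

variable {C : Type*} [AddCommGroup C] [Module k C] [Coalgebra k C]

/-- Coalgebra maps into a path coalgebra from functionals for the vertices and arrows. -/
theorem exists_pathMap {t : V → WithConv (C →ₗ[k] k)}
    {arr : ∀ x y : V, (x ⟶ y) → WithConv (C →ₗ[k] k)} (h : IsQuiverRep t arr)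
    (hfin : ∀ a : C, {p : QPath V | (pathVal t arr p.2.2).ofConv a ≠ 0}.Finite)
    (hcounit : ∀ a : C, ∃ S : Finset V, ∀ S', S ⊆ S' →
      ∑ x ∈ S', (t x).ofConv a = Coalgebra.counit (R := k) a) :
    ∃ J : C →ₗc[k] PathCoalgebra k V, ∀ (p : QPath V) (a : C),
      pathCoord k p (J a) = (pathVal t arr p.2.2).ofConv a := by
  classical
  let J₀ : C →ₗ[k] PathCoalgebra k V :=
    { toFun := fun a => (Finsupp.ofSupportFinite
        (fun p : QPath V => (pathVal t arr p.2.2).ofConv a) (hfin a) : QPath V →₀ k)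
      map_add' := fun a b => Finsupp.ext fun p => map_add (pathVal t arr p.2.2).ofConv a b
      map_smul' := fun c a => Finsupp.ext fun p =>
        map_smul (pathVal t arr p.2.2).ofConv c a }
  have hJ : ∀ p, pathCoord k p ∘ₗ J₀ = (pathVal t arr p.2.2).ofConv := fun p =>
    LinearMap.ext fun a => rfl
  refine ⟨{ J₀ with counit_comp := ?_, map_comp_comul := ?_ }, fun p a => rfl⟩
  · refine LinearMap.ext fun a => ?_
    obtain ⟨S, hS⟩ := hcounit a
    obtain ⟨T, hT⟩ := exists_sum_vertexCoord (J₀ a)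
    refine (hT (S ∪ T) Finset.subset_union_right).symm.trans
      (Eq.trans (Finset.sum_congr rfl fun x _ => ?_) (hS (S ∪ T) Finset.subset_union_left))
    rw [← pathVal_nil t arr x]
    rfl
  · refine LinearMap.ext fun a => tensor_pathCoord_ext fun q p => ?_
    obtain ⟨x, y, p⟩ := p
    obtain ⟨y', z, q⟩ := q
    have h1 : LinearMap.mul' k k (map (pathCoord k ⟨y', z, q⟩) (pathCoord k ⟨x, y, p⟩)
        (map J₀ J₀ (Coalgebra.comul (R := k) a))) =
        (pathVal t arr q * pathVal t arr p).ofConv a := by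
      rw [TensorProduct.map_map, hJ, hJ]
      rfl
    have h2 : LinearMap.mul' k k (map (pathCoord k ⟨y', z, q⟩) (pathCoord k ⟨x, y, p⟩)
        (Coalgebra.comul (R := k) (J₀ a))) =
        (pathVal (vertexCoord k) (arrowCoord k) q *
          pathVal (vertexCoord k) (arrowCoord k) p).ofConv (J₀ a) := by
      rw [pathVal_coord, pathVal_coord]
      rfl
    -- Both sides are convolution products of path values: the value of the concatenation if q
    -- starts where p ends, and zero by orthogonality otherwise.
    refine h1.trans (Eq.trans ?_ h2.symm)
    by_cases hy : y' = y
    · subst hy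
      rw [h.pathVal_comp, isQuiverRep_pathCoord.pathVal_comp, pathVal_coord]
      rfl
    · rw [h.pathVal_mul_eq_zero _ _ hy, isQuiverRep_pathCoord.pathVal_mul_eq_zero _ _ hy]
      rfl

end PathMaps

/-! ### Embedding coradically graded coalgebras into path coalgebras -/

section GradedPathMaps

open TensorProduct (map)
open WithConv

variable {k : Type v} [Field k]

/-- A grading of a coalgebra, given by its projections. -/
structure IsCoalgebraGrading {C : Type*} [AddCommGroup C] [Module k C] [Coalgebra k C]
    (pr : ℕ → C →ₗ[k] C) : Prop where
  idem : ∀ n a, pr n (pr n a) = pr n a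
  orth : ∀ m n a, m ≠ n → pr m (pr n a) = 0
  sum : ∀ a, ∃ N, ∑ n ∈ Finset.range N, pr n a = a
  comul : ∀ i j a, map (pr i) (pr j) (Coalgebra.comul (R := k) (pr (i + j) a)) =
    map (pr i) (pr j) (Coalgebra.comul (R := k) a)

namespace IsCoalgebraGrading

variable {C : Type*} [AddCommGroup C] [Module k C] [Coalgebra k C] {pr : ℕ → C →ₗ[k] C}

lemma ext (h : IsCoalgebraGrading pr) {a b : C} (hab : ∀ n, pr n a = pr n b) : a = b := by
  have h0 : ∀ n, pr n (a - b) = 0 := fun n => by rw [map_sub, hab, sub_self]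
  obtain ⟨N, hN⟩ := h.sum (a - b)
  rw [Finset.sum_eq_zero fun n _ => h0 n] at hN
  exact (sub_eq_zero.1 hN.symm)

lemma conv (h : IsCoalgebraGrading pr) {i j : ℕ} {c d : WithConv (C →ₗ[k] k)}
    (hc : c.ofConv ∘ₗ pr i = c.ofConv) (hd : d.ofConv ∘ₗ pr j = d.ofConv) :
    (c * d).ofConv ∘ₗ pr (i + j) = (c * d).ofConv := by
  refine LinearMap.ext fun a => ?_
  change LinearMap.mul' k k (map c.ofConv d.ofConv (Coalgebra.comul (R := k) (pr (i + j) a))) =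
    LinearMap.mul' k k (map c.ofConv d.ofConv (Coalgebra.comul (R := k) a))
  rw [← hc, ← hd, ← TensorProduct.map_map, h.comul, TensorProduct.map_map]

lemma apply_ne (h : IsCoalgebraGrading pr) {i n : ℕ} {c : C →ₗ[k] k} (hc : c ∘ₗ pr i = c)
    (hn : i ≠ n) (a : C) : c (pr n a) = 0 := by
  rw [← hc, LinearMap.comp_apply, h.orth _ _ _ hn, map_zero]

/-- A functional of degree 0 only sees the (n, 0) component of the coproduct, and that component
depends only on `pr n a`. -/
lemma pr_rhit (h : IsCoalgebraGrading pr) {c : C →ₗ[k] k} (hc : c ∘ₗ pr 0 = c) (n : ℕ) (a : C) :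
    pr n (rhit c a) = rhit c (pr n a) := by
  have h1 : ∀ n a, pr n (rhit c a) =
      TensorProduct.rid k C (map LinearMap.id c (map (pr n) (pr 0) (Coalgebra.comul (R := k) a))) := by
    intro n a
    rw [TensorProduct.map_map, hc, rhit_apply]
    generalize Coalgebra.comul (R := k) a = t
    induction t with
    | zero => simp
    | add x y hx hy => simp only [map_add, hx, hy]
    | tmul x y => simp
  have h2 : ∀ n a, pr n (rhit c a) = pr n (rhit c (pr n a)) := by
    intro n a
    rw [h1, ← h.comul, ← h1, add_zero]
  refine h.ext fun m => ?_
  by_cases hm : m = n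
  · rw [hm, h.idem, h2]
  · rw [h.orth _ _ _ hm, h2, h.orth _ _ _ hm, map_zero, map_zero]

lemma pr_lhit (h : IsCoalgebraGrading pr) {c : C →ₗ[k] k} (hc : c ∘ₗ pr 0 = c) (n : ℕ) (a : C) :
    pr n (lhit c a) = lhit c (pr n a) := by
  have h1 : ∀ n a, pr n (lhit c a) =
      TensorProduct.lid k C (map c LinearMap.id (map (pr 0) (pr n) (Coalgebra.comul (R := k) a))) := by
    intro n a
    rw [TensorProduct.map_map, hc, lhit_apply]
    generalize Coalgebra.comul (R := k) a = t
    induction t with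
    | zero => simp
    | add x y hx hy => simp only [map_add, hx, hy]
    | tmul x y => simp
  have h2 : ∀ n a, pr n (lhit c a) = pr n (lhit c (pr n a)) := by
    intro n a
    rw [h1, ← h.comul, ← h1, zero_add]
  refine h.ext fun m => ?_
  by_cases hm : m = n
  · rw [hm, h.idem, h2]
  · rw [h.orth _ _ _ hm, h2, h.orth _ _ _ hm, map_zero, map_zero]

end IsCoalgebraGrading

section Separation

lemma exists_sum_eq_of_tensor {C E V : Type*} [AddCommGroup C] [Module k C] [AddCommGroup E]
    [Module k E] {t : V → WithConv (C →ₗ[k] k)} {c : C →ₗ[k] k}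
    (h : ∀ a : C, ∃ S : Finset V, ∀ S', S ⊆ S' → ∑ x ∈ S', (t x).ofConv a = c a)
    (s : E ⊗[k] C) : ∃ S : Finset V, ∀ S', S ⊆ S' →
      ∑ x ∈ S', map (LinearMap.id : E →ₗ[k] E) (t x).ofConv s = map LinearMap.id c s := by
  classical
  induction s with
  | zero => exact ⟨∅, fun S' _ => by simp⟩
  | add s s' hs hs' =>
    obtain ⟨S, hS⟩ := hs
    obtain ⟨T, hT⟩ := hs'
    refine ⟨S ∪ T, fun S' hS' => ?_⟩
    simp only [map_add, Finset.sum_add_distrib]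
    rw [hS S' (Finset.union_subset_left hS'), hT S' (Finset.union_subset_right hS')]
  | tmul e a =>
    obtain ⟨S, hS⟩ := h a
    refine ⟨S, fun S' hS' => ?_⟩
    simp only [TensorProduct.map_tmul, LinearMap.id_apply]
    rw [← TensorProduct.tmul_sum, hS S' hS']

variable {C : Type*} [AddCommGroup C] [Module k C] [Coalgebra k C] {V : Type*}
  {t : V → WithConv (C →ₗ[k] k)}

/-- Adding one point outside S leaves the sum unchanged, so f vanishes there. -/
lemma finite_support_of_sum_eq (f : V → k) (c : k)
    (h : ∃ S : Finset V, ∀ S', S ⊆ S' → ∑ x ∈ S', f x = c) : {x | f x ≠ 0}.Finite := by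
  classical
  obtain ⟨S, hS⟩ := h
  refine S.finite_toSet.subset fun x hx => ?_
  by_contra hxS
  have h1 := hS (insert x S) (Finset.subset_insert x S)
  rw [Finset.sum_insert hxS, hS S subset_rfl, add_eq_right] at h1
  exact hx h1

lemma finite_rhit (h : ∀ a, {x | (t x).ofConv a ≠ 0}.Finite) (a : C) :
    {x | rhit (t x).ofConv a ≠ 0}.Finite := by
  let ρ := Coalgebra.Repr.arbitrary k a
  refine (Set.Finite.biUnion ρ.index.finite_toSet fun i _ => h (ρ.right i)).subset fun x hx => ?_
  by_contra hne
  refine hx ?_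
  rw [rhit_apply, ← ρ.eq, map_sum, map_sum]
  refine Finset.sum_eq_zero fun i hi => ?_
  have : (t x).ofConv (ρ.right i) = 0 := by
    by_contra h0
    exact hne (Set.mem_biUnion hi h0)
  simp [this]

lemma finite_lhit (h : ∀ a, {x | (t x).ofConv a ≠ 0}.Finite) (a : C) :
    {x | lhit (t x).ofConv a ≠ 0}.Finite := by
  let ρ := Coalgebra.Repr.arbitrary k a
  refine (Set.Finite.biUnion ρ.index.finite_toSet fun i _ => h (ρ.left i)).subset fun x hx => ?_
  by_contra hne
  refine hx ?_
  rw [lhit_apply, ← ρ.eq, map_sum, map_sum]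
  refine Finset.sum_eq_zero fun i hi => ?_
  have : (t x).ofConv (ρ.left i) = 0 := by
    by_contra h0
    exact hne (Set.mem_biUnion hi h0)
  simp [this]

/-- The functionals t x sum to the counit, so a = a₁ε(a₂) is a finite sum of the hits by the t x. -/
lemma eq_zero_of_rhit (h : ∀ a : C, ∃ S : Finset V, ∀ S', S ⊆ S' →
      ∑ x ∈ S', (t x).ofConv a = Coalgebra.counit (R := k) a) {a : C}
    (ha : ∀ x, rhit (t x).ofConv a = 0) : a = 0 := by
  obtain ⟨S, hS⟩ := exists_sum_eq_of_tensor h (Coalgebra.comul (R := k) a)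
  have h1 := congrArg (TensorProduct.rid k C) (hS S subset_rfl)
  rw [map_sum] at h1
  rw [← rhit_counit (k := k) a, rhit_apply, ← h1]
  exact Finset.sum_eq_zero fun x _ => ha x

lemma eq_zero_of_lhit (h : ∀ a : C, ∃ S : Finset V, ∀ S', S ⊆ S' →
      ∑ x ∈ S', (t x).ofConv a = Coalgebra.counit (R := k) a) {a : C}
    (ha : ∀ x, lhit (t x).ofConv a = 0) : a = 0 := by
  have hc : ∀ (c : C →ₗ[k] k) (s : C ⊗[k] C), TensorProduct.lid k C (map c LinearMap.id s) =
      TensorProduct.rid k C (map LinearMap.id c (TensorProduct.comm k C C s)) := by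
    intro c s
    induction s with
    | zero => simp
    | add x y hx hy => simp only [map_add, hx, hy]
    | tmul x y => simp
  obtain ⟨S, hS⟩ := exists_sum_eq_of_tensor h
    (TensorProduct.comm k C C (Coalgebra.comul (R := k) a))
  have h1 := congrArg (TensorProduct.rid k C) (hS S subset_rfl)
  rw [map_sum] at h1
  rw [← lhit_counit (k := k) a, lhit_apply, hc, ← h1]
  refine Finset.sum_eq_zero fun x _ => ?_
  rw [← hc]
  exact ha x

end Separation

section PathDegree

variable {V : Type u} [Quiver.{u} V]

lemma mem_pathDegree {n : ℕ} {b : PathCoalgebra k V}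
    (h : ∀ p : QPath V, p.2.2.length ≠ n → pathCoord k p b = 0) : b ∈ pathDegree k V n := by
  let f : QPath V →₀ k := b
  have hb : b = f.sum fun p c => c • pathElt k p.2.2 := by
    have : f.sum (fun p c => Finsupp.single p c) = f := Finsupp.sum_single f
    refine Eq.trans this.symm (Finset.sum_congr rfl fun p _ => ?_)
    change _ = f p • Finsupp.single p (1 : k)
    rw [Finsupp.smul_single, smul_eq_mul, mul_one]
  rw [hb]
  refine Submodule.sum_mem _ fun p hp => Submodule.smul_mem _ _ (Submodule.subset_span ?_)
  refine ⟨_, _, p.2.2, ?_, rfl⟩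
  by_contra hne
  exact (Finsupp.mem_support_iff.1 hp) (h p hne)

/-- A degree-preserving coalgebra map into a path coalgebra that is an isomorphism onto `kQ₀` and
`kQ₁` in degrees `0` and `1`, for a coalgebra that is coradically graded. -/
theorem exists_gradedPathEmbedding {C : Type*} [AddCommGroup C] [Module k C] [Coalgebra k C]
    {pr : ℕ → C →ₗ[k] C} (hpr : IsCoalgebraGrading pr) {t : V → WithConv (C →ₗ[k] k)}
    {arr : ∀ x y : V, (x ⟶ y) → WithConv (C →ₗ[k] k)} (h : IsQuiverRep t arr)
    (hsum : ∀ a : C, ∃ S : Finset V, ∀ S', S ⊆ S' →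
      ∑ x ∈ S', (t x).ofConv a = Coalgebra.counit (R := k) a)
    (hfin : ∀ a : C, {e : Σ x y : V, (x ⟶ y) | (arr _ _ e.2.2).ofConv a ≠ 0}.Finite)
    (ht : ∀ x, (t x).ofConv ∘ₗ pr 0 = (t x).ofConv)
    (harr : ∀ x y (e : x ⟶ y), (arr x y e).ofConv ∘ₗ pr 1 = (arr x y e).ofConv)
    (h0 : ∀ a, (∀ x, (t x).ofConv a = 0) → pr 0 a = 0)
    (h1 : ∀ a, (∀ x y (e : x ⟶ y), (arr x y e).ofConv a = 0) → pr 1 a = 0)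
    (h2 : ∀ n a, map (pr 1) (pr (n + 1)) (Coalgebra.comul (R := k) (pr (n + 2) a)) = 0 →
      pr (n + 2) a = 0)
    (hvertex : ∀ x, ∃ a, pr 0 a = a ∧ (t x).ofConv a = 1 ∧ ∀ y, y ≠ x → (t y).ofConv a = 0)
    (harrow : ∀ x y (e : x ⟶ y), ∃ a, pr 1 a = a ∧ (arr x y e).ofConv a = 1 ∧
      ∀ x' y' (e' : x' ⟶ y'), (⟨x', y', e'⟩ : Σ x y : V, (x ⟶ y)) ≠ ⟨x, y, e⟩ →
        (arr x' y' e').ofConv a = 0) :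
    ∃ J : C →ₗc[k] PathCoalgebra k V, Function.Injective J ∧
      (∀ n a, J (pr n a) ∈ pathDegree k V n) ∧
      ∀ n ≤ 1, ∀ b ∈ pathDegree k V n, ∃ a, J a = b := by
  have hdeg : ∀ {x y : V} (p : Quiver.Path x y),
      (pathVal t arr p).ofConv ∘ₗ pr p.length = (pathVal t arr p).ofConv := by
    intro x y p
    induction p with
    | nil => rw [pathVal_nil]; exact ht x
    | cons p e ih =>
      rw [pathVal, Quiver.Path.length_cons, add_comm]
      exact hpr.conv (harr _ _ e) ih
  have htfin : ∀ a, {x | (t x).ofConv a ≠ 0}.Finite := fun a =>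
    finite_support_of_sum_eq _ _ (hsum a)
  -- Fix a finite expression of Δ(a). If a path of length n + 1 has a nonzero value at a, then in
  -- one of the terms its last arrow is nonzero on the left factor and the remaining path on the
  -- right factor.
  have hpathfin : ∀ n a,
      {p : QPath V | p.2.2.length = n ∧ (pathVal t arr p.2.2).ofConv a ≠ 0}.Finite := by
    intro n
    induction n with
    | zero =>
      intro a
      refine ((htfin a).image fun x => (⟨x, x, Quiver.Path.nil⟩ : QPath V)).subset ?_
      rintro ⟨x, y, p⟩ ⟨hp, hpa⟩
      cases p with
      | cons p e => exact absurd hp (Nat.succ_ne_zero _)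
      | nil =>
        refine ⟨x, ?_, rfl⟩
        rwa [pathVal_nil] at hpa
    | succ n ih =>
      intro a
      let ρ := Coalgebra.Repr.arbitrary k a
      refine (Set.Finite.biUnion ρ.index.finite_toSet fun i _ =>
        Set.Finite.biUnion (hfin (ρ.left i)) fun e _ => Set.Finite.biUnion (ih (ρ.right i))
          fun p _ => (Set.Subsingleton.finite (s := {q : QPath V | ∃ (x y z : V)
            (p' : Quiver.Path x y) (e' : y ⟶ z), q = ⟨x, z, p'.cons e'⟩ ∧ p = ⟨x, y, p'⟩ ∧
              e = ⟨y, z, e'⟩}) ?_)).subset ?_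
      · rintro _ ⟨x, y, z, p', e', rfl, rfl, rfl⟩ _ ⟨x₂, y₂, z₂, p₂, e₂, rfl, hp, he⟩
        cases hp
        cases he
        rfl
      · rintro ⟨x, z, q⟩ ⟨hq, hqa⟩
        cases q with
        | nil => exact absurd hq.symm (Nat.succ_ne_zero _)
        | @cons y _ p e =>
          change (pathVal t arr (p.cons e)).ofConv a ≠ 0 at hqa
          have h3 : (pathVal t arr (p.cons e)).ofConv a = ∑ i ∈ ρ.index,
              (arr _ _ e).ofConv (ρ.left i) * (pathVal t arr p).ofConv (ρ.right i) := by
            rw [pathVal]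
            change LinearMap.mul' k k (map _ _ (Coalgebra.comul (R := k) a)) = _
            rw [← ρ.eq, map_sum, map_sum]
            rfl
          rw [h3] at hqa
          obtain ⟨i, hi, hne⟩ := Finset.exists_ne_zero_of_sum_ne_zero hqa
          refine Set.mem_biUnion hi (Set.mem_biUnion (x := ⟨y, z, e⟩) (left_ne_zero_of_mul hne)
            (Set.mem_biUnion (x := ⟨x, y, p⟩) ⟨Nat.succ.inj (show p.length + 1 = n + 1 from hq),
              right_ne_zero_of_mul hne⟩
              ⟨x, y, z, p, e, rfl, rfl, rfl⟩))
  -- An element has components in finitely many degrees, which bounds the length of the paths that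
  -- occur.
  have hall : ∀ a, {p : QPath V | (pathVal t arr p.2.2).ofConv a ≠ 0}.Finite := by
    intro a
    obtain ⟨N, hN⟩ := hpr.sum a
    refine (Set.Finite.biUnion (Finset.range N).finite_toSet fun n _ => hpathfin n a).subset ?_
    rintro p hp
    refine Set.mem_biUnion (x := p.2.2.length) ?_ ⟨rfl, hp⟩
    by_contra hlen
    refine hp ?_
    rw [← hN, map_sum]
    refine Finset.sum_eq_zero fun n hn => hpr.apply_ne (hdeg _) ?_ a
    rintro rfl
    exact hlen hn
  obtain ⟨J, hJ⟩ := exists_pathMap h hall hsum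
  have hJne : ∀ (p : QPath V) n a, p.2.2.length ≠ n → pathCoord k p (J (pr n a)) = 0 :=
    fun p n a hp => by rw [hJ]; exact hpr.apply_ne (hdeg _) hp a
  have hJeq : ∀ (p : QPath V) a, pathCoord k p (J (pr p.2.2.length a)) = pathCoord k p (J a) :=
    fun p a => by rw [hJ, hJ]; exact LinearMap.congr_fun (hdeg p.2.2) a
  have hinj1 : ∀ a, J (pr 1 a) = 0 → pr 1 a = 0 := by
    intro a ha
    rw [← hpr.idem]
    refine h1 _ fun x y e => ?_
    have h3 := hJ ⟨x, y, e.toPath⟩ (pr 1 a)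
    rw [ha, map_zero] at h3
    change 0 = (pathVal t arr (Quiver.Path.nil.cons e)).ofConv (pr 1 a) at h3
    rw [pathVal, pathVal_nil, h.right] at h3
    exact h3.symm
  have hinj : ∀ n a, J (pr (n + 1) a) = 0 → pr (n + 1) a = 0 := by
    intro n
    induction n with
    | zero => exact hinj1
    | succ n ih =>
      intro a ha
      -- It suffices that the (1, n + 1) component of the coproduct vanishes. By induction J is
      -- injective on both legs, and after applying it the coordinate at arrow q and path p is the
      -- coordinate of J at their concatenation, or zero.
      refine h2 n a ?_
      have hker : ∀ m, (∀ a, J (pr m a) = 0 → pr m a = 0) →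
          LinearMap.ker (J.toLinearMap ∘ₗ pr m) = LinearMap.ker (pr m) := fun m hm =>
        le_antisymm (fun x hx => hm x hx) fun x hx => by
          change J (pr m x) = 0
          rw [LinearMap.mem_ker.1 hx, map_zero]
      rw [← LinearMap.mem_ker, ker_tensorMap, ← hker 1 hinj1, ← hker (n + 1) ih,
        ← ker_tensorMap, LinearMap.mem_ker]
      refine tensor_pathCoord_ext fun q p => ?_
      rw [map_zero, map_zero, TensorProduct.map_map]
      by_cases hq : q.2.2.length = 1
      · by_cases hp : p.2.2.length = n + 1
        · have hc : ∀ (p : QPath V) m, p.2.2.length = m →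
              pathCoord k p ∘ₗ J.toLinearMap ∘ₗ pr m = (pathVal t arr p.2.2).ofConv := by
            rintro p m rfl
            refine LinearMap.ext fun b => ?_
            exact (hJeq p b).trans (hJ p b)
          rw [hc q _ hq, hc p _ hp]
          change (pathVal t arr q.2.2 * pathVal t arr p.2.2).ofConv _ = 0
          obtain ⟨x, y, p⟩ := p
          obtain ⟨y', z, q⟩ := q
          by_cases hy : y' = y
          · subst hy
            rw [h.pathVal_comp]
            have := hJ ⟨x, z, p.comp q⟩ (pr (n + 1 + 1) a)
            rw [ha, map_zero] at this
            exact this.symm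
          · rw [h.pathVal_mul_eq_zero _ _ hy]
            rfl
        · have : pathCoord k p ∘ₗ J.toLinearMap ∘ₗ pr (n + 1) = 0 :=
            LinearMap.ext fun b => hJne p _ b hp
          rw [this, TensorProduct.map_zero_right, LinearMap.zero_apply, map_zero]
      · have : pathCoord k q ∘ₗ J.toLinearMap ∘ₗ pr 1 = 0 :=
          LinearMap.ext fun b => hJne q _ b hq
        rw [this, TensorProduct.map_zero_left, LinearMap.zero_apply, map_zero]
  refine ⟨J, ?_, fun n a => mem_pathDegree fun p hp => hJne p n a hp, fun n hn b hb => ?_⟩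
  · rw [injective_iff_map_eq_zero]
    intro a ha
    have h3 : ∀ n, J (pr n a) = 0 := by
      intro n
      refine pathCoord_ext fun p => ?_
      rw [map_zero]
      by_cases hp : p.2.2.length = n
      · subst hp
        rw [hJeq, ha, map_zero]
      · exact hJne p n a hp
    refine hpr.ext fun n => ?_
    rw [map_zero]
    cases n with
    | succ n => exact hinj n a (h3 _)
    | zero =>
      rw [← hpr.idem]
      refine h0 _ fun x => ?_
      have h4 := hJ ⟨x, x, Quiver.Path.nil⟩ (pr 0 a)
      rw [h3, map_zero, pathVal_nil] at h4
      exact h4.symm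
  · have h3 : pathDegree k V n ≤ LinearMap.range (J : C →ₗ[k] PathCoalgebra k V) := by
      rw [pathDegree, Submodule.span_le]
      rintro _ ⟨x, y, p, hp, rfl⟩
      -- As n ≤ 1, the path is a vertex or an arrow, and the assumptions supply an element dual to
      -- it among all paths of that length.
      have hex : ∃ a, pr n a = a ∧ (pathVal t arr p).ofConv a = 1 ∧
          ∀ q : QPath V, q.2.2.length = n → q ≠ ⟨x, y, p⟩ → (pathVal t arr q.2.2).ofConv a = 0 := by
        subst hp
        cases p with
        | nil =>
          obtain ⟨a, ha, ha1, ha2⟩ := hvertex x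
          refine ⟨a, ha, by rw [pathVal_nil, ha1], ?_⟩
          rintro ⟨x', y', q⟩ hq hne
          cases q with
          | cons q e => exact absurd hq (Nat.succ_ne_zero _)
          | nil =>
            rw [pathVal_nil]
            refine ha2 _ ?_
            rintro rfl
            exact hne rfl
        | cons p e =>
          cases p with
          | cons p e' =>
            simp only [Quiver.Path.length_cons] at hn
            omega
          | nil =>
            obtain ⟨a, ha, ha1, ha2⟩ := harrow x y e
            refine ⟨a, ha, by rw [pathVal, pathVal_nil, h.right, ha1], ?_⟩
            rintro ⟨x', y', q⟩ hq hne
            cases q with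
            | nil => exact absurd hq.symm (Nat.succ_ne_zero _)
            | cons q e₂ =>
              cases q with
              | cons q e₃ =>
                simp at hq
              | nil =>
                change (pathVal t arr (Quiver.Path.nil.cons e₂)).ofConv a = 0
                rw [pathVal, pathVal_nil, h.right]
                refine ha2 _ _ _ ?_
                intro h5
                cases h5
                exact hne rfl
      obtain ⟨a, ha, ha1, ha2⟩ := hex
      refine ⟨a, pathCoord_ext fun q => ?_⟩
      change pathCoord k q (J a) = _
      by_cases hq : q = ⟨x, y, p⟩
      · subst hq
        rw [pathCoord_self, hJ, ha1]
      · rw [pathCoord_ne hq]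
        by_cases hqn : q.2.2.length = n
        · rw [hJ, ha2 q hqn hq]
        · rw [← ha, hJne q n a hqn]
    exact h3 hb

end PathDegree

end GradedPathMaps

/-! ### Arrows as bases of the degree 1 components -/

section CoradicallyGraded

open TensorProduct (map)
open WithConv

variable {k : Type v} [Field k]

lemma finite_sigma_sigma {V : Type*} {E : V → V → Type*} (P : ∀ x y, Set (E x y))
    (h1 : {x | ∃ y, (P x y).Nonempty}.Finite) (h2 : ∀ x, {y | (P x y).Nonempty}.Finite)
    (h3 : ∀ x y, (P x y).Finite) :
    {e : Σ x y, E x y | e.2.2 ∈ P e.1 e.2.1}.Finite := by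
  refine (h1.biUnion fun x _ => (h2 x).biUnion fun y _ =>
    (h3 x y).image fun e => (⟨x, y, e⟩ : Σ x y, E x y)).subset ?_
  rintro ⟨x, y, e⟩ he
  exact Set.mem_biUnion (x := x) ⟨y, e, he⟩ (Set.mem_biUnion (x := y) ⟨e, he⟩ ⟨e, he, rfl⟩)

/-- The component of degree `1` between two group-like functionals. -/
def arrowProj {C V : Type*} [AddCommGroup C] [Module k C] [Coalgebra k C] (pr : ℕ → C →ₗ[k] C)
    (t : V → WithConv (C →ₗ[k] k)) (x y : V) : C →ₗ[k] C :=
  lhit (t y).ofConv ∘ₗ rhit (t x).ofConv ∘ₗ pr 1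

/-- A coradically graded coalgebra with group-like degree `0` part embeds into the path coalgebra
of a quiver whose arrows are bases of the skew-primitive spaces of degree `1`. -/
theorem exists_gradedPathEmbedding_of_basis {C : Type*} {V : Type u} [AddCommGroup C] [Module k C]
    [Coalgebra k C] [Quiver.{u} V] {pr : ℕ → C →ₗ[k] C} (hpr : IsCoalgebraGrading pr)
    {t : V → WithConv (C →ₗ[k] k)} (hidem : ∀ x, t x * t x = t x)
    (horth : ∀ x y, x ≠ y → t x * t y = 0)
    (hsum : ∀ a : C, ∃ S : Finset V, ∀ S', S ⊆ S' →
      ∑ x ∈ S', (t x).ofConv a = Coalgebra.counit (R := k) a)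
    (ht : ∀ x, (t x).ofConv ∘ₗ pr 0 = (t x).ofConv)
    (h0 : ∀ a, (∀ x, (t x).ofConv a = 0) → pr 0 a = 0)
    (h2 : ∀ n a, map (pr 1) (pr (n + 1)) (Coalgebra.comul (R := k) (pr (n + 2) a)) = 0 →
      pr (n + 2) a = 0)
    (hvertex : ∀ x, ∃ a, pr 0 a = a ∧ (t x).ofConv a = 1 ∧ ∀ y, y ≠ x → (t y).ofConv a = 0)
    (B : ∀ x y : V, Module.Basis (x ⟶ y) k (LinearMap.range (arrowProj pr t x y))) :
    ∃ J : C →ₗc[k] PathCoalgebra k V, Function.Injective J ∧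
      (∀ n a, J (pr n a) ∈ pathDegree k V n) ∧
      ∀ n ≤ 1, ∀ b ∈ pathDegree k V n, ∃ a, J a = b := by
  -- The Q x y are mutually orthogonal idempotents that cut the degree 1 part into components with
  -- source x and target y.
  let Q : V → V → C →ₗ[k] C := arrowProj pr t
  have hQ : ∀ x y a, Q x y a = lhit (t y).ofConv (rhit (t x).ofConv (pr 1 a)) := fun _ _ _ => rfl
  have hrzero : ∀ a : C, rhit (0 : WithConv (C →ₗ[k] k)).ofConv a = 0 := fun a => by
    change TensorProduct.rid k C (map LinearMap.id (0 : C →ₗ[k] k) _) = 0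
    rw [TensorProduct.map_zero_right, LinearMap.zero_apply, map_zero]
  have hlzero : ∀ a : C, lhit (0 : WithConv (C →ₗ[k] k)).ofConv a = 0 := fun a => by
    change TensorProduct.lid k C (map (0 : C →ₗ[k] k) LinearMap.id _) = 0
    rw [TensorProduct.map_zero_left, LinearMap.zero_apply, map_zero]
  have hQr : ∀ x y a, Q x y (rhit (t x).ofConv a) = Q x y a := fun x y a => by
    rw [hQ, hpr.pr_rhit (ht x), rhit_rhit, hidem, hQ]
  have hQl : ∀ x y a, Q x y (lhit (t y).ofConv a) = Q x y a := fun x y a => by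
    rw [hQ, hpr.pr_lhit (ht y), ← lhit_rhit, lhit_lhit, hidem, hQ]
  have hQpr : ∀ x y a, Q x y (pr 1 a) = Q x y a := fun x y a => by rw [hQ, hpr.idem, hQ]
  have hprQ : ∀ x y a, pr 1 (Q x y a) = Q x y a := fun x y a => by
    rw [hQ, hpr.pr_lhit (ht y), hpr.pr_rhit (ht x), hpr.idem]
  have hQQ : ∀ x y a, Q x y (Q x y a) = Q x y a := fun x y a => by
    conv_lhs => rw [hQ x y a]
    rw [hQl, hQr, hQpr]
  have hQne : ∀ x y x' y' a, ¬(x' = x ∧ y' = y) → Q x' y' (Q x y a) = 0 := by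
    intro x y x' y' a hne
    rw [hQ, hprQ, hQ, ← lhit_rhit, rhit_rhit, lhit_lhit]
    by_cases hx : x' = x
    · rw [horth y y' fun hy => hne ⟨hx, hy.symm⟩, hlzero]
    · rw [horth x' x hx, hrzero, map_zero]
  let c : ∀ x y : V, (x ⟶ y) → C →ₗ[k] k := fun x y e => (B x y).coord e ∘ₗ (Q x y).rangeRestrict
  have hc : ∀ x y (e : x ⟶ y) a b, Q x y a = Q x y b → c x y e a = c x y e b :=
    fun x y e a b hab => congrArg ((B x y).coord e) (Subtype.ext hab)
  have hc0 : ∀ x y (e : x ⟶ y) a, Q x y a = 0 → c x y e a = 0 := fun x y e a ha => by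
    rw [hc x y e a 0 (by rw [ha, map_zero]), map_zero]
  have hfin : ∀ a, {x | (t x).ofConv a ≠ 0}.Finite := fun a =>
    finite_support_of_sum_eq _ _ (hsum a)
  have hcfin : ∀ a, {e : Σ x y : V, (x ⟶ y) | c e.1 e.2.1 e.2.2 a ≠ 0}.Finite := by
    intro a
    refine finite_sigma_sigma (fun x y => {e : x ⟶ y | c x y e a ≠ 0})
      ((finite_rhit hfin (pr 1 a)).subset ?_)
      (fun x => (finite_lhit hfin (rhit (t x).ofConv (pr 1 a))).subset ?_) fun x y =>
        (Finset.finite_toSet ((B x y).repr ((Q x y).rangeRestrict a)).support).subset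
          fun e he => Finsupp.mem_support_iff.2 he
    · rintro x ⟨y, e, he⟩ hx
      refine he (hc0 x y e a ?_)
      rw [hQ, hx, map_zero]
    · rintro y ⟨e, he⟩ hy
      exact he (hc0 x y e a hy)
  refine exists_gradedPathEmbedding hpr (t := t) (arr := fun x y e => toConv (c x y e))
    ⟨hidem, horth, fun x y e => ?_, fun x y e => ?_⟩ hsum ?_ ht ?_ h0 ?_ h2 hvertex ?_
  · apply WithConv.ofConv_injective
    refine LinearMap.ext fun a => ?_
    rw [← apply_lhit]
    exact hc _ _ _ _ _ (hQl x y a)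
  · apply WithConv.ofConv_injective
    refine LinearMap.ext fun a => ?_
    rw [← apply_rhit]
    exact hc _ _ _ _ _ (hQr x y a)
  · exact hcfin
  · exact fun x y e => LinearMap.ext fun a => hc _ _ _ _ _ (hQpr x y a)
  -- If all arrow coordinates vanish, so does every component Q x y a; summing over targets and
  -- sources recovers `pr 1 a`.
  · intro a ha
    refine eq_zero_of_rhit hsum fun x => eq_zero_of_lhit hsum fun y => ?_
    have h3 : (Q x y).rangeRestrict a = 0 := (B x y).ext_elem fun e => by
      rw [map_zero]
      exact ha x y e
    exact congrArg Subtype.val h3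
  · intro x y e
    obtain ⟨a, ha⟩ := (B x y e).2
    have h3 : Q x y (B x y e) = B x y e := by
      rw [← ha, hQQ]
    have h4 : (Q x y).rangeRestrict (B x y e) = B x y e := Subtype.ext h3
    refine ⟨B x y e, ?_, ?_, ?_⟩
    · rw [← ha, hprQ]
    · change (B x y).coord e ((Q x y).rangeRestrict (B x y e)) = 1
      rw [h4, Module.Basis.coord_apply, Module.Basis.repr_self, Finsupp.single_eq_same]
    · intro x' y' e' hne
      by_cases hxy : x' = x ∧ y' = y
      · obtain ⟨rfl, rfl⟩ := hxy
        change (B x' y').coord e' ((Q x' y').rangeRestrict (B x' y' e)) = 0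
        rw [h4, Module.Basis.coord_apply, Module.Basis.repr_self, Finsupp.single_eq_of_ne]
        rintro rfl
        exact hne rfl
      · refine hc0 x' y' e' _ ?_
        rw [← ha, hQne x y x' y' a hxy]

/-- The arrows from x to y are taken to be the vectors of a basis of the corresponding component.
They live in the universe of C, which is why C and V share it. -/
lemma exists_quiver_gradedPathEmbedding {C V : Type u} [AddCommGroup C] [Module k C]
    [Coalgebra k C] {pr : ℕ → C →ₗ[k] C} (hpr : IsCoalgebraGrading pr)
    {t : V → WithConv (C →ₗ[k] k)} (hidem : ∀ x, t x * t x = t x)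
    (horth : ∀ x y, x ≠ y → t x * t y = 0)
    (hsum : ∀ a : C, ∃ S : Finset V, ∀ S', S ⊆ S' →
      ∑ x ∈ S', (t x).ofConv a = Coalgebra.counit (R := k) a)
    (ht : ∀ x, (t x).ofConv ∘ₗ pr 0 = (t x).ofConv)
    (h0 : ∀ a, (∀ x, (t x).ofConv a = 0) → pr 0 a = 0)
    (h2 : ∀ n a, map (pr 1) (pr (n + 1)) (Coalgebra.comul (R := k) (pr (n + 2) a)) = 0 →
      pr (n + 2) a = 0)
    (hvertex : ∀ x, ∃ a, pr 0 a = a ∧ (t x).ofConv a = 1 ∧ ∀ y, y ≠ x → (t y).ofConv a = 0) :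
    ∃ (_ : Quiver.{u} V) (J : C →ₗc[k] PathCoalgebra k V), Function.Injective J ∧
      (∀ n a, J (pr n a) ∈ pathDegree k V n) ∧
      ∀ n ≤ 1, ∀ b ∈ pathDegree k V n, ∃ a, J a = b :=
  let inst : Quiver.{u} V :=
    ⟨fun x y => Module.Basis.ofVectorSpaceIndex k (LinearMap.range (arrowProj pr t x y))⟩
  ⟨inst, exists_gradedPathEmbedding_of_basis hpr hidem horth hsum ht h0 h2 hvertex
    fun x y => Module.Basis.ofVectorSpace k (LinearMap.range (arrowProj pr t x y))⟩

end CoradicallyGraded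

/-! ### Existence of the quiver of H -/

section GrQuiver

open TensorProduct (map)
open WithConv
open MonoidAlgebra (single)

variable {k : Type v} [Field k] {H : Type u} [Ring H] [HopfAlgebra k H] {A : Type u} [Ring A]
  [HopfAlgebra k A]

/-- The projection of a model of `gr(H)` onto its part of degree `n`. -/
def degProj (φ : Gr k H ≃ₗ[k] A) (n : ℕ) : A →ₗ[k] A :=
  φ.toLinearMap ∘ₗ DirectSum.lof k ℕ (GrPiece k H) n ∘ₗ DirectSum.component k ℕ (GrPiece k H) n ∘ₗ
    φ.symm.toLinearMap

variable {φ : Gr k H ≃ₗ[k] A}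

lemma degProj_self (n : ℕ) (a : coradFilt k H n) :
    degProj φ n (φ (grClass k H n a)) = φ (grClass k H n a) := by
  simp [degProj, grClass, DirectSum.component.lof_self]

lemma degProj_ne {m n : ℕ} (hmn : m ≠ n) (a : coradFilt k H n) :
    degProj φ m (φ (grClass k H n a)) = 0 := by
  simp [degProj, grClass, DirectSum.component.of, hmn.symm]

lemma exists_degProj_eq (n : ℕ) (a : A) : ∃ x, degProj φ n a = φ (grClass k H n x) := by
  obtain ⟨x, hx⟩ := Submodule.mkQ_surjective _ (DirectSum.component k ℕ (GrPiece k H) n (φ.symm a))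
  exact ⟨x, by rw [grClass, LinearMap.comp_apply, hx]; rfl⟩

lemma eq_zero_of_grClass_eq_zero {n : ℕ} {a : coradFilt k H n} (h : φ (grClass k H n a) = 0) :
    (a : H) ∈ coradFiltPrev k H n := by
  have h1 : grClass k H n a = 0 := φ.injective (by rw [h, map_zero])
  have h2 : Submodule.Quotient.mk a = 0 :=
    DirectSum.of_injective (β := GrPiece k H) n (h1.trans (map_zero _).symm)
  have h3 : a ∈ (coradFiltPrev k H n).submoduleOf (coradFilt k H n) :=
    (Submodule.Quotient.mk_eq_zero _).1 h2
  exact h3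

namespace IsGrHopf

lemma isCoalgebraGrading (h : IsGrHopf φ) : IsCoalgebraGrading (degProj φ) where
  idem n a := by
    obtain ⟨x, hx⟩ := exists_degProj_eq (φ := φ) n a
    rw [hx, degProj_self]
  orth m n a hmn := by
    obtain ⟨x, hx⟩ := exists_degProj_eq (φ := φ) n a
    rw [hx, degProj_ne hmn]
  sum a := by
    classical
    let b : Gr k H := φ.symm a
    obtain ⟨N, hN⟩ := (DFinsupp.support b).exists_nat_subset_range
    refine ⟨N, φ.symm.injective ?_⟩
    have h1 : ∀ n, φ.symm (degProj φ n a) = DirectSum.of (GrPiece k H) n (b n) := fun n => by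
      simp [degProj, b]
      rfl
    rw [map_sum, Finset.sum_congr rfl fun n _ => h1 n]
    refine Eq.trans ?_ (DirectSum.sum_support_of b)
    refine (Finset.sum_subset hN fun n _ hn => ?_).symm
    rw [DFinsupp.notMem_support_iff.1 hn, map_zero]
  comul i j a := by
    refine LinearMap.congr_fun (f := map (degProj φ i) (degProj φ j) ∘ₗ Coalgebra.comul ∘ₗ
      degProj φ (i + j)) (g := map (degProj φ i) (degProj φ j) ∘ₗ Coalgebra.comul)
      (gr_hom_ext φ fun n x => ?_) a
    simp only [LinearMap.comp_apply]
    by_cases hn : i + j = n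
    · subst hn
      rw [degProj_self]
    · rw [degProj_ne hn, map_zero, map_zero]
      obtain ⟨t, -, ht⟩ := h.comul n x
      rw [ht, map_sum]
      refine (Finset.sum_eq_zero fun p hp => ?_).symm
      rw [TensorProduct.map_map]
      by_cases hi : i = p.1
      · have hj : j ≠ p.2 := by
          have := Finset.HasAntidiagonal.mem_antidiagonal.1 hp
          omega
        have : degProj φ j ∘ₗ φ.toLinearMap ∘ₗ grClass k H p.2 = 0 :=
          LinearMap.ext fun y => degProj_ne hj y
        rw [this, TensorProduct.map_zero_right, LinearMap.zero_apply]
      · have : degProj φ i ∘ₗ φ.toLinearMap ∘ₗ grClass k H p.1 = 0 :=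
          LinearMap.ext fun y => degProj_ne hi y
        rw [this, TensorProduct.map_zero_left, LinearMap.zero_apply]

/-- `gr(H)` is coradically graded. -/
lemma degProj_eq_zero (h : IsGrHopf φ) (n : ℕ) (a : A)
    (ha : map (degProj φ 1) (degProj φ (n + 1))
      (Coalgebra.comul (R := k) (degProj φ (n + 2) a)) = 0) : degProj φ (n + 2) a = 0 := by
  obtain ⟨x, hx⟩ := exists_degProj_eq (φ := φ) (n + 2) a
  rw [hx] at ha ⊢
  obtain ⟨t, ht, ht'⟩ := h.comul (n + 2) x
  have hmem : (1, n + 1) ∈ Finset.HasAntidiagonal.antidiagonal (n + 2) :=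
    Finset.HasAntidiagonal.mem_antidiagonal.2 (by omega)
  have h1 : map (φ.toLinearMap ∘ₗ grClass k H 1) (φ.toLinearMap ∘ₗ grClass k H (n + 1))
      (t (1, n + 1)) = 0 := by
    rw [← ha, ht', map_sum, Finset.sum_eq_single (1, n + 1) _ (fun hne => absurd hmem hne),
      TensorProduct.map_map]
    · congr 2 <;> exact LinearMap.ext fun y => (degProj_self _ y).symm
    · intro p hp hne
      have hp' := Finset.HasAntidiagonal.mem_antidiagonal.1 hp
      have hi : 1 ≠ p.1 := by
        intro hi
        apply hne
        ext <;> simp <;> omega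
      have : degProj φ 1 ∘ₗ φ.toLinearMap ∘ₗ grClass k H p.1 = 0 :=
        LinearMap.ext fun y => degProj_ne hi y
      rw [TensorProduct.map_map, this, TensorProduct.map_zero_left, LinearMap.zero_apply]
  have h2 : TensorProduct.mapIncl (coradFilt k H 1) (coradFilt k H (n + 1)) (t (1, n + 1)) ∈
      tens (coradical k H) (⊤ : Submodule k H) ⊔ tens (⊤ : Submodule k H) (coradFilt k H n) := by
    rw [← LinearMap.mem_ker, ker_tensorMap] at h1
    have h3 : tens (LinearMap.ker (φ.toLinearMap ∘ₗ grClass k H 1)) ⊤ ⊔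
        tens ⊤ (LinearMap.ker (φ.toLinearMap ∘ₗ grClass k H (n + 1))) ≤
        (tens (coradical k H) (⊤ : Submodule k H) ⊔
          tens (⊤ : Submodule k H) (coradFilt k H n)).comap
          (TensorProduct.mapIncl (coradFilt k H 1) (coradFilt k H (n + 1))) := by
      refine sup_le (tens_le.2 fun y hy z _ => ?_) (tens_le.2 fun y _ z hz => ?_)
      · exact Submodule.mem_sup_left (tmul_mem_tens (eq_zero_of_grClass_eq_zero hy)
          Submodule.mem_top)
      · exact Submodule.mem_sup_right (tmul_mem_tens Submodule.mem_top
          (eq_zero_of_grClass_eq_zero hz))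
    exact h3 h1
  -- Membership means Δ(x) ∈ H₀ ⊗ H + H ⊗ H_n. Components of bidegree (i, j) with i = 0 or j ≤ n lie
  -- there anyway, and (1, n + 1) is the only other bidegree. The class of x in degree n + 2 is then
  -- zero.
  have h4 : (x : H) ∈ coradFilt k H (n + 1) := by
    change Coalgebra.comul (R := k) (x : H) ∈ tens (coradical k H) (⊤ : Submodule k H) ⊔
      tens (⊤ : Submodule k H) (coradFilt k H n)
    rw [ht]
    refine Submodule.sum_mem _ fun p hp => ?_
    have hp' := Finset.HasAntidiagonal.mem_antidiagonal.1 hp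
    by_cases hp1 : p = (1, n + 1)
    · subst hp1
      exact h2
    · have h5 : TensorProduct.mapIncl (coradFilt k H p.1) (coradFilt k H p.2) (t p) ∈
          tens (coradFilt k H p.1) (coradFilt k H p.2) := LinearMap.mem_range_self _ _
      obtain hp0 | hp0 : p.1 = 0 ∨ p.2 ≤ n := by
        by_contra! hcon
        apply hp1
        ext <;> simp <;> omega
      · refine Submodule.mem_sup_left (tens_mono ?_ le_top h5)
        rw [hp0]
        exact le_rfl
      · exact Submodule.mem_sup_right (tens_mono le_top (coradFilt_mono hp0) h5)
  rw [grClass_eq_zero x.2 h4, map_zero]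

/-- The quiver of `H` exists. -/
theorem exists_isLargeEmbedding (h : IsGrHopf φ) {G : Type u} [Group G] {R : GroupRetract k A G}
    (h1 : ∀ n (a : coradFilt k H (n + 1)), R.π (φ (grClass k H (n + 1) a)) = 0)
    (hH : ∀ g : G, ∃ a, R.ι g = φ (grClass k H 0 a))
    (h0 : ∀ a : coradFilt k H 0, φ (grClass k H 0 a) ∈ Submodule.span k (Set.range R.ι)) :
    ∃ (V : Type u) (_ : Quiver.{u} V) (j : A →ₗc[k] PathCoalgebra k V), IsLargeEmbedding φ j := by
  classical
  have hχι : ∀ x g, groupChar R.π (Pi.single x 1) (R.ι g) = (Pi.single x (1 : k) : G → k) g :=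
    fun x g => by rw [groupChar_apply, R.proj, groupLift_single, one_smul]
  have hdeg : ∀ x, groupChar R.π (Pi.single x 1) ∘ₗ degProj φ 0 =
      groupChar R.π (Pi.single x 1) := by
    intro x
    refine gr_hom_ext φ ?_
    rintro (_ | n) a
    · rw [LinearMap.comp_apply, degProj_self]
    · rw [LinearMap.comp_apply, degProj_ne (Nat.succ_ne_zero n).symm, map_zero, groupChar_apply, h1,
        map_zero]
  suffices hJ : ∃ (_ : Quiver.{u} G) (J : A →ₗc[k] PathCoalgebra k G), Function.Injective J ∧
      (∀ n a, J (degProj φ n a) ∈ pathDegree k G n) ∧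
      ∀ n ≤ 1, ∀ b ∈ pathDegree k G n, ∃ a, J a = b by
    obtain ⟨inst, J, hinj, hgr, hlarge⟩ := hJ
    exact ⟨G, inst, J, hinj, fun n a => by
      have := hgr n (φ (grClass k H n a))
      rwa [degProj_self] at this, hlarge⟩
  -- The vertices are the elements of G, each represented by its coefficient functional on the
  -- degree 0 part.
  refine exists_quiver_gradedPathEmbedding h.isCoalgebraGrading
    (t := fun x => toConv (groupChar R.π (Pi.single x 1)))
    (fun x => ?_) (fun x y hxy => ?_) (fun a => ?_) hdeg (fun a ha => ?_)
    h.degProj_eq_zero (fun x => ?_)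
  · rw [groupChar_mul, ← Pi.single_mul, one_mul]
  · rw [groupChar_mul]
    have : (Pi.single x (1 : k) : G → k) * Pi.single y 1 = 0 := by
      ext z
      by_cases hz : z = x
      · subst hz
        simp [hxy]
      · simp [hz]
    rw [this]
    apply WithConv.ofConv_injective
    refine LinearMap.ext fun a => ?_
    change groupLift (0 : G → k) (R.π a) = 0
    generalize R.π a = s
    refine LinearMap.congr_fun (f := groupLift (0 : G → k)) (g := 0)
      (MonoidAlgebra.lhom_ext' fun x => LinearMap.ext_ring ?_) s
    change groupLift (0 : G → k) (single x 1) = 0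
    simp
  · have h3 : ∀ s : MonoidAlgebra k G, ∃ S : Finset G, ∀ S', S ⊆ S' →
        ∑ x ∈ S', groupLift (Pi.single x (1 : k)) s = groupLift (1 : G → k) s := by
      intro s
      induction s using MonoidAlgebra.induction_linear with
      | zero => exact ⟨∅, fun S' _ => by simp⟩
      | add s s' hs hs' =>
        obtain ⟨S, hS⟩ := hs
        obtain ⟨T, hT⟩ := hs'
        refine ⟨S ∪ T, fun S' hS' => ?_⟩
        simp only [map_add, Finset.sum_add_distrib]
        rw [hS S' (Finset.union_subset_left hS'), hT S' (Finset.union_subset_right hS')]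
      | single g c =>
        refine ⟨{g}, fun S' hS' => ?_⟩
        simp only [groupLift_single, Pi.single_apply, Pi.one_apply, smul_eq_mul]
        rw [← Finset.mul_sum, Finset.sum_ite_eq, if_pos (hS' (Finset.mem_singleton_self g))]
    rw [← groupChar_one R.π]
    exact h3 (R.π a)
  · obtain ⟨x, hx⟩ := exists_degProj_eq (φ := φ) 0 a
    have h3 : ∀ y, groupChar R.π (Pi.single y (1 : k)) (φ (grClass k H 0 x)) = 0 := fun y => by
      rw [← hx, ← LinearMap.comp_apply, hdeg]
      exact ha y
    have h4 : R.π (φ (grClass k H 0 x)) = 0 := by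
      ext y
      rw [← groupLift_pi_single, ← groupChar_apply, h3]
      rfl
    have h5 : Submodule.span k (Set.range R.ι) ≤
        LinearMap.eqLocus (groupLift R.ι ∘ₗ (R.π : A →ₗ[k] MonoidAlgebra k G)) LinearMap.id := by
      rw [Submodule.span_le]
      rintro _ ⟨g, rfl⟩
      change groupLift R.ι (R.π (R.ι g)) = R.ι g
      rw [R.proj, groupLift_single, one_smul]
    have h6 : groupLift R.ι (R.π (φ (grClass k H 0 x))) = φ (grClass k H 0 x) := h5 (h0 x)
    rw [hx, ← h6, h4, map_zero]
  · obtain ⟨a, ha⟩ := hH x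
    refine ⟨R.ι x, by rw [ha, degProj_self], ?_, fun y hy => ?_⟩
    · change groupChar _ _ _ = _
      rw [hχι, Pi.single_eq_same]
    · change groupChar _ _ _ = _
      rw [hχι, Pi.single_eq_of_ne hy.symm]

end IsGrHopf

end GrQuiver

end

theorem corollary4p3 {k : Type v} [Field k] {H : Type u} [Ring H] [HopfAlgebra k H]
    (hH : IsPointedCoalgebra k H) (r : H ⊗[k] H →ₗ[k] k) (hr : IsCoquasitriangular r) :
    -- the Hopf algebra `A = gr(H)`
    ∃ (A : Type u) (_ : Ring A) (_ : HopfAlgebra k A) (φ : Gr k H ≃ₗ[k] A),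
      IsGrHopf φ ∧ IsCoquasitriangular (grForm φ r) ∧
      -- the quiver of `H` exists
      (∃ (V : Type u) (_ : Quiver.{u} V) (j : A →ₗc[k] PathCoalgebra k V),
        IsLargeEmbedding φ j) ∧
      -- and, whichever realization of it is used:
      ∀ (V : Type u) [Quiver.{u} V] (j : A →ₗc[k] PathCoalgebra k V), IsLargeEmbedding φ j →
        -- the principal block is a Hopf subalgebra `D`, cotriangular for the restricted form,
        (∃ e : V, j 1 = pathElt k (Quiver.Path.nil : Quiver.Path e e) ∧
          ∃ (D : Type u) (_ : Ring D) (_ : HopfAlgebra k D) (i : D →ₐc[k] A),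
            Function.Injective i ∧ LinearMap.range (i : D →ₗ[k] A) = blockAt j e ∧
            IsCotriangular (grForm φ r ∘ₗ
              TensorProduct.map (i : D →ₗ[k] A) (i : D →ₗ[k] A)) ∧
            -- and `gr(H)` is a crossed product of it by a group algebra;
            ∃ (Γ : Type u) (_ : Group Γ) (S : CrossedSystem k D Γ)
              (Φ : (D ⊗[k] MonoidAlgebra k Γ) ≃ₗc[k] A),
              IsCrossedProduct (grForm φ r) (grForm φ r ∘ₗ
                TensorProduct.map (i : D →ₗ[k] A) (i : D →ₗ[k] A)) i S Φ) ∧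
        -- if the quiver of `H` is connected, then `gr(H)` is cotriangular.
        (IsConnectedQuiver V → IsCotriangular (grForm φ r)) := by
  obtain ⟨A, _, _, φ, h⟩ := exists_isGrHopf hH
  obtain ⟨R, h1, hι, h0, hform⟩ := h.exists_groupRetract hH
  obtain ⟨r₀, hr₀⟩ := hform r
  have hA := h.isCoquasitriangular hr
  refine ⟨A, _, _, φ, h, hA,
    h.exists_isLargeEmbedding h1 (fun g => ⟨_, hι g⟩) h0, fun V _ j hj => ?_⟩
  -- For an arbitrary large embedding the unit is ι(1), so it is sent to the vertex ν(1), whose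
  -- component defines the block.
  obtain ⟨ν, hν⟩ := exists_isQuiverRealization h1 (fun g => ⟨_, hι g⟩) h0 hj
  refine ⟨⟨ν 1, ?_, hν.exists_block hA hr₀⟩, hν.isCotriangular_of_connected hA hr₀⟩
  rw [← hν.vertex 1, map_one R.ι]
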